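/- Let $S\subset\mathbb C$ be a set without accumulation points in $\mathbb C$, and let $\Lambda$ be the set of points of $S$ in the closed strip $0\le \Re z\le 1$. Assume that $\Lambda$ is finite, that $0<\Re\lambda<1$ and $\Im\lambda\neq0$ for every $\lambda\in\Lambda$, and that distinct elements of $\Lambda$ have distinct real parts. For $\lambda\in\Lambda$ put $d_\lambda=i$ if $\Im\lambda>0$ and $d_\lambda=-i$ if $\Im\lambda<0$, and call $\{\lambda+s d_\lambda: s\ge 0\}$ the cut at $\lambda$. The cut strip is the closed strip $0\le\Re z\le1$ with all these cuts removed; the open cut strip is defined in the same way from $0<\Re z<1$. Let $f$ be holomorphic in a neighbourhood of each point of the cut strip, and suppose that its germ at $0$ can be continued analytically along every path that starts at $0$ and avoids $S$. Assume: 1. $f(z)=o(e^{2\pi|\Im z|})$ as $|\Im z|\to\infty$ in the cut strip, uniformly in $\Re z$. 2. For every $\lambda\in\Lambda$ there are real numbers $\alpha_\lambda,\beta_\lambda$ and a holomorphic germ $h_\lambda$ at $0$ such that $f(\lambda+u)=u^{\alpha_\lambda}(\log u)^{\beta_\lambda}h_\lambda(u)$ for small $u$ off the cut (for some continuous branches of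 $\log u$ and $\log\log u$). 3. For every $\lambda\in\Lambda$, $\int_1^\infty |f_\lambda(s d_\lambda)|\,e^{-2\pi s}\,ds<\infty$. Here $f_\lambda$ is the variation of $f$ at $\lambda$, defined for $u$ on the open ray $d_\lambda\mathbb R_{>0}$ by $$f_\lambda(u)=\lim_{\delta\to0^+}\bigl(f(\lambda+ue^{-i\delta})-f(\lambda+ue^{i\delta})\bigr).$$ For $m\ge1$ and $p>0$ put $$G_{f,\lambda,m}(p)=\frac{i}{2\pi m}\,f_\lambda\Bigl(\frac{d_\lambda\,p}{2\pi m}\Bigr).$$ Write $(\mathcal L G)(x)=\int_0^\infty e^{-xp}G(p)\,dp=\lim_{P\to\infty}\int_0^P e^{-xp}G(p)\,dp$. Let $B_n$ be the Bernoulli numbers. Then the Borel transform $$\sum_{n\ge1}\frac{B_{2n}}{(2n)!}\bigl(f^{(2n-1)}(1)-f^{(2n-1)}(0)\bigr)\frac{p^{2n-2}}{(2n-2)!}$$ converges near $p=0$ and has an analytic continuation $G_f$ to a neighbourhood of $[0,\infty)$, and $(\mathcal L G_f)(N)$ converges for every integer $N\ge1$. Moreover: (a) If $\alpha_\lambda>-1$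 for all $\lambda\in\Lambda$, then for every integer $N\ge1$ all Laplace integrals and series below converge (the series absolutely), and $$\sum_{k=1}^N f\Bigl(\frac kN\Bigr)=N\int_0^1 f(s)\,ds+\frac{f(1)-f(0)}2+(\mathcal L G_f)(N)+N\sum_{\lambda:\,\Im\lambda>0}\ \sum_{m=1}^\infty e^{2\pi i\lambda mN}(\mathcal L G_{f,\lambda,m})(N)+N\sum_{\lambda:\,\Im\lambda<0}\ \sum_{m=1}^\infty e^{-2\pi i\lambda mN}(\mathcal L G_{f,\lambda,m})(N).$$ (b) Suppose that some $\alpha_\lambda\le-1$, and let $M$ be an integer with $M\ge\lfloor-\alpha_\lambda\rfloor$ for every $\lambda\in\Lambda$ with $\alpha_\lambda\le-1$. Then there is a holomorphic $F$ on the open cut strip with $F^{(M)}=f$. For every such $F$ and every integer $N\ge1$, the formula of (a) holds (with convergence of all Laplace integrals and absolute convergence of the series) once its transseries terms are integrated by parts $M$ times, that is, after $(\mathcal L G_{f,\lambda,m})(N)$ is replaced by $(-2\pi i mN)^M(\mathcal L G_{F,\lambda,m})(N)$ if $\Im\lambda>0$ and by $(2\pi i mN)^M(\mathcal L G_{F,\lambda,m})(N)$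 if $\Im\lambda<0$. Here $G_{F,\lambda,m}$ is built from the variation of $F$ in the same way as $G_{f,\lambda,m}$ is built from that of $f$. -/

import Mathlib

open Complex Filter Topology MeasureTheory
open scoped Nat

noncomputable section

/-! ### Analytic continuation -/

/-- The germ of `f` at the starting point of `γ` can be continued analytically along `γ`:
there is a family of germs `F t` at `γ t`, locally compatible, which starts with `f`. -/
def ContinuesAlong (f : ℂ → ℂ) {a b : ℂ} (γ : Path a b) : Prop :=
  ∃ F : unitInterval → ℂ → ℂ,
    F 0 =ᶠ[𝓝 a] f ∧
    (∀ t, AnalyticAt ℂ (F t) (γ t)) ∧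
    ∀ t, ∀ᶠ s in 𝓝 t, F s =ᶠ[𝓝 (γ s)] F t

/-- Endless analytic continuation with singular set `S`: the set `S` has no accumulation point in
the plane (in particular it is countable), and the germ of `f` at `0` can be continued along every
path which starts at `0` and avoids `S`. -/
def EndlesslyContinuable (f : ℂ → ℂ) (S : Set ℂ) : Prop :=
  (∀ R : ℝ, (S ∩ Metric.closedBall 0 R).Finite) ∧
  ∀ (z : ℂ) (γ : Path 0 z), (∀ t, γ t ∉ S) → ContinuesAlong f γ

/-! ### The strip `0 ≤ Re z ≤ 1`, cut along outgoing vertical rays -/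

/-- The vertical direction pointing from `c` away from the real axis. -/
def outDir (c : ℂ) : ℂ := if 0 < c.im then I else -I

/-- The closed vertical ray from `c` to infinity, away from the real axis. -/
def cutRay (c : ℂ) : Set ℂ := {z | ∃ s : ℝ, 0 ≤ s ∧ z = c + s * outDir c}

/-- The closed strip `0 ≤ Re z ≤ 1` without the cuts. -/
def cutStrip (Λ : Finset ℂ) : Set ℂ :=
  {z | 0 ≤ z.re ∧ z.re ≤ 1 ∧ ∀ c ∈ Λ, z ∉ cutRay c}

/-- The open strip `0 < Re z < 1` without the cuts. -/
def openCutStrip (Λ : Finset ℂ) : Set ℂ :=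
  {z | 0 < z.re ∧ z.re < 1 ∧ ∀ c ∈ Λ, z ∉ cutRay c}

/-- `f(u) = o(exp (2 π |Im u|))` as `|Im u| → ∞` in the cut strip, uniformly in `Re u`. -/
def StripGrowth (f : ℂ → ℂ) (Λ : Finset ℂ) : Prop :=
  ∀ ε : ℝ, 0 < ε → ∃ R : ℝ, ∀ z ∈ cutStrip Λ, R ≤ |z.im| →
    ‖f z‖ ≤ ε * Real.exp (2 * Real.pi * |z.im|)

/-- `f(c + u) = u ^ α (log u) ^ β h(u)` for small `u` off the cut, where `h` is a holomorphic germ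
at `0`, for some continuous branches `l` of `log u` and `ll` of `log (log u)` on the slit disc;
`u ^ α` is `exp (α l)` and `(log u) ^ β` is `exp (β ll)`. -/
def HasLocalForm (f : ℂ → ℂ) (c : ℂ) (α β : ℝ) : Prop :=
  ∃ (h l ll : ℂ → ℂ) (r : ℝ), 0 < r ∧ AnalyticAt ℂ h 0 ∧
    ContinuousOn l {u | ‖u‖ < r ∧ c + u ∉ cutRay c} ∧
    ContinuousOn ll {u | ‖u‖ < r ∧ c + u ∉ cutRay c} ∧
    ∀ u : ℂ, ‖u‖ < r → c + u ∉ cutRay c →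
      exp (l u) = u ∧ exp (ll u) = l u ∧ f (c + u) = exp (α * l u) * exp (β * ll u) * h u

/-- The variation of `f(c + ·)` at the point `u` of the outgoing vertical ray from `0`: the
determination obtained by approaching the ray counterclockwise (from smaller arguments) minus the
one obtained by approaching it clockwise, that is `f(c + u) - f(c + u e ^ (-2 π i))`. -/
def variation (f : ℂ → ℂ) (c u : ℂ) : ℂ :=
  limUnder (𝓝[>] (0 : ℝ)) fun δ : ℝ => f (c + u * exp (-(δ * I))) - f (c + u * exp (δ * I))

/-- `G_{f,c,m}(p) = i / (2 π m) * f_c (± i p / (2 π m))`, the sign being that of `Im c`, and `f_c`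
the variation of `f` at `c`. -/
def varG (f : ℂ → ℂ) (c : ℂ) (m : ℕ) (p : ℝ) : ℂ :=
  I / (2 * Real.pi * m) * variation f c (outDir c * (p / (2 * Real.pi * m)))

/-! ### Laplace transform -/

/-- `∫_0^P e ^ (-x p) G(p) dp`. -/
def truncatedLaplace (G : ℝ → ℂ) (x P : ℝ) : ℂ :=
  ∫ p in (0 : ℝ)..P, exp (-(x * p)) * G p

/-- The Laplace integral `∫_0^∞ e ^ (-x p) G(p) dp` converges, as an improper integral at `∞`. -/
def LaplaceConverges (G : ℝ → ℂ) (x : ℝ) : Prop :=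
  (∀ P : ℝ, 0 < P → IntervalIntegrable (fun p : ℝ => exp (-(x * p)) * G p) volume 0 P) ∧
  ∃ L : ℂ, Tendsto (truncatedLaplace G x) atTop (𝓝 L)

/-- The Laplace transform `∫_0^∞ e ^ (-x p) G(p) dp = lim_{P → ∞} ∫_0^P e ^ (-x p) G(p) dp`. -/
def laplace (G : ℝ → ℂ) (x : ℝ) : ℂ := limUnder atTop (truncatedLaplace G x)

/-! ### The Euler-MacLaurin series and its Borel transform -/

/-- The formal power series `∑_{n ≥ 1} B_{2n} / (2n)! (f^{(2n-1)}(1) - f^{(2n-1)}(0)) X^{2n-1}`,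
in the variable `X = 1 / N`. -/
def emSeries (f : ℂ → ℂ) : PowerSeries ℂ :=
  PowerSeries.mk fun j =>
    if Odd j then
      (bernoulli (j + 1) : ℂ) / ((j + 1)! : ℂ) * (iteratedDeriv j f 1 - iteratedDeriv j f 0)
    else 0

/-- The formal Borel transform, `∑ a_n X^{n+1} ↦ ∑ a_n / n! p^n`. -/
def formalBorel (A : PowerSeries ℂ) : PowerSeries ℂ :=
  PowerSeries.mk fun n => PowerSeries.coeff (n + 1) A / (n ! : ℂ)

/-- `G` is the analytic continuation of the formal power series `A`, convergent near `0`, to a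
neighbourhood of the half-line `[0, ∞)`. -/
def IsContinuationToHalfLine (G : ℂ → ℂ) (A : PowerSeries ℂ) : Prop :=
  AnalyticOnNhd ℂ G {z | ∃ p : ℝ, 0 ≤ p ∧ z = p} ∧
  ∀ n : ℕ, iteratedDeriv n G 0 / (n ! : ℂ) = PowerSeries.coeff n A

/-- `F` is holomorphic in the open cut strip and `F^{(M)} = f` there. -/
def IsIteratedPrimitive (F f : ℂ → ℂ) (M : ℕ) (Λ : Finset ℂ) : Prop :=
  AnalyticOnNhd ℂ F (openCutStrip Λ) ∧ ∀ z ∈ openCutStrip Λ, iteratedDeriv M F z = f z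

end

open Complex Filter Topology MeasureTheory
open scoped Nat

noncomputable section

/-! ### The Borel sum of the Euler-MacLaurin series -/

/-! By Poisson summation the error of the trapezoidal rule is `N` times the sum over `m ≥ 1` of the
Fourier integrals of `f` over `[0, 1]` at the frequencies `± m N` (`hasSum_fourier_eq_trapezoid`).
For frequency `n > 0` the contour is moved to `+ i ∞` in the strip. The growth hypothesis kills the
top side. The two vertical sides carry the same weight `e ^ (-2 π n t)`, since `e ^ (2 π i n) = 1`.
What remains is one jump for each cut (`UpperStrip.contour_identity`,
`UpperStrip.tendsto_integral_sides`). Negative frequencies reduce to positive ones by the rotation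
`z ↦ 1 - z`.

The vertical sides produce the Borel sum. Integrating by parts and substituting `t = p / (2 π m)`
turns them into Laplace integrals at `N` of rescaled copies of one kernel `ψ`. The sum over `m` of
these copies is `G_f`. It is analytic along the half-line because `ψ` is, and its Taylor
coefficients contain `∑ (2 π m) ^ (-2k)`, hence the Bernoulli numbers
(`isContinuationToHalfLine_borelSum`, `laplace_borelSum`).

The cuts produce the transseries: the jump at `c` is the integral of the variation against `e ^ (2 π
i n z)`, which after rescaling is a Laplace transform of `varG`. If the singularity at the tip is
not integrable, an `M`-fold primitive `F` is used. Each integration gains almost one power at the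
tip (`SlitBound.of_hasDerivAt`), so the jump is computed for `F` by dominated convergence and
carried up to `F ^ (M) = f` by integration by parts (`UpperStrip.tendsto_vertInt_jump`). Part (a) is
the case `M = 0`, `F = f`. Analytic continuation serves to extend `f` analytically to each cut from
either side (`exists_isSideExt_of_endlesslyContinuable`), so that the variation exists and can be
differentiated.

The delicate case is `n = 1`, where the weight only just balances the growth: there convergence
comes from the little-o and from the integrability of the variation of `f`. -/

theorem exists_ball_analyticAt_mul_and_bound {ψ : ℂ → ℂ} (hψ : ∀ t : ℝ, AnalyticAt ℂ ψ t) {p₀ : ℝ}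
    (hp₀ : 0 ≤ p₀) :
    ∃ r > 0, ∃ C, ∀ p ∈ Metric.ball (p₀ : ℂ) r, ∀ a : ℝ, 0 ≤ a → a ≤ 1 →
      AnalyticAt ℂ ψ (a * p) ∧ ‖ψ (a * p)‖ ≤ C := by
  set K : Set ℂ := (fun t : ℝ => (t : ℂ)) '' Set.Icc 0 p₀ with hK
  have hKc : IsCompact K := isCompact_Icc.image continuous_ofReal
  have hKU : K ⊆ {z | AnalyticAt ℂ ψ z} := by
    rintro _ ⟨t, -, rfl⟩
    exact hψ t
  -- One thickening of the segment serves all dilation factors at once, because `a * p` is within `a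
  -- * r ≤ r` of the point `a * p₀` of the segment.
  obtain ⟨r, hr, hrU⟩ := hKc.exists_cthickening_subset_open (isOpen_analyticAt ℂ ψ) hKU
  have hcont : ContinuousOn ψ (Metric.cthickening r K) :=
    fun z hz => (hrU hz).continuousAt.continuousWithinAt
  obtain ⟨C, hC⟩ := (hKc.cthickening (r := r)).exists_bound_of_continuousOn hcont
  refine ⟨r, hr, C, fun p hp a ha ha1 => ?_⟩
  have hmem : (a * p : ℂ) ∈ Metric.cthickening r K := by
    refine Metric.mem_cthickening_of_dist_le _ ((a * p₀ : ℝ) : ℂ) _ _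
      ⟨a * p₀, ⟨by positivity, mul_le_of_le_one_left hp₀ ha1⟩, rfl⟩ ?_
    rw [dist_eq_norm, ofReal_mul, ← mul_sub, norm_mul, Complex.norm_of_nonneg ha]
    rw [Metric.mem_ball, dist_eq_norm] at hp
    nlinarith [norm_nonneg (p - p₀)]
  exact ⟨hrU hmem, hC _ hmem⟩

/-- The superposition `∑ w_m ψ(a_m p)` of rescaled copies of `ψ`. -/
def scaledSum (w a : ℕ → ℝ) (ψ : ℂ → ℂ) (p : ℂ) : ℂ := ∑' m, (w m : ℂ) * ψ (a m * p)

section scaledSum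

variable {w a : ℕ → ℝ} {ψ : ℂ → ℂ}

/-- The bound on `ψ (a m * p)` is uniform in `m`, so the Weierstrass test allows termwise
differentiation. A derivative only changes the weights from `w` to `w * a`, so the result is again a
`scaledSum` and can be iterated. -/
theorem scaledSum_aux (hw : Summable fun m => |w m|) (ha : ∀ m, 0 ≤ a m) (ha1 : ∀ m, a m ≤ 1)
    (hψ : ∀ t : ℝ, AnalyticAt ℂ ψ t) {p₀ : ℝ} (hp₀ : 0 ≤ p₀) :
    AnalyticAt ℂ (scaledSum w a ψ) p₀ ∧
      deriv (scaledSum w a ψ) =ᶠ[𝓝 (p₀ : ℂ)] scaledSum (fun m => w m * a m) a (deriv ψ) := by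
  obtain ⟨r, hr, C, hC⟩ := exists_ball_analyticAt_mul_and_bound hψ hp₀
  have hd : ∀ m, ∀ p ∈ Metric.ball (p₀ : ℂ) r, HasDerivAt (fun p : ℂ => (w m : ℂ) * ψ (a m * p))
      ((w m : ℂ) * (deriv ψ (a m * p) * a m)) p := by
    intro m p hp
    have h1 := ((hC p hp (a m) (ha m) (ha1 m)).1.differentiableAt).hasDerivAt
    have h2 : HasDerivAt (fun p : ℂ => (a m : ℂ) * p) (a m) p := by
      simpa using (hasDerivAt_id p).const_mul (a m : ℂ)
    exact (h1.comp p h2).const_mul _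
  have hdo : ∀ m, DifferentiableOn ℂ (fun p : ℂ => (w m : ℂ) * ψ (a m * p))
      (Metric.ball (p₀ : ℂ) r) :=
    fun m p hp => (hd m p hp).differentiableAt.differentiableWithinAt
  have hb : ∀ m, ∀ p ∈ Metric.ball (p₀ : ℂ) r, ‖(w m : ℂ) * ψ (a m * p)‖ ≤ |w m| * C := by
    intro m p hp
    rw [norm_mul, norm_real, Real.norm_eq_abs]
    gcongr
    exact (hC p hp (a m) (ha m) (ha1 m)).2
  have hu : Summable fun m => |w m| * C := hw.mul_right C
  have hmem : Metric.ball (p₀ : ℂ) r ∈ 𝓝 (p₀ : ℂ) := Metric.ball_mem_nhds _ hr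
  refine ⟨(differentiableOn_tsum_of_summable_norm hu hdo Metric.isOpen_ball hb).analyticAt hmem, ?_⟩
  filter_upwards [hmem] with p hp
  have h := (hasSum_deriv_of_summable_norm hu hdo Metric.isOpen_ball hb hp).tsum_eq
  rw [scaledSum]
  refine h.symm.trans (tsum_congr fun m => ?_)
  rw [(hd m p hp).deriv]
  push_cast
  ring

theorem analyticAt_scaledSum (hw : Summable fun m => |w m|) (ha : ∀ m, 0 ≤ a m)
    (ha1 : ∀ m, a m ≤ 1) (hψ : ∀ t : ℝ, AnalyticAt ℂ ψ t) {p₀ : ℝ} (hp₀ : 0 ≤ p₀) :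
    AnalyticAt ℂ (scaledSum w a ψ) p₀ :=
  (scaledSum_aux hw ha ha1 hψ hp₀).1

/-- At the origin all dilations have the same value, so the derivative of `ψ` factors out and only
the moment `∑ w a ^ n` of the weights is left. -/
theorem iteratedDeriv_scaledSum (hw : Summable fun m => |w m|) (ha : ∀ m, 0 ≤ a m)
    (ha1 : ∀ m, a m ≤ 1) (hψ : ∀ t : ℝ, AnalyticAt ℂ ψ t) (n : ℕ) :
    iteratedDeriv n (scaledSum w a ψ) 0 = (∑' m, (w m * a m ^ n : ℝ) : ℂ) * iteratedDeriv n ψ 0 := by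
  induction n generalizing w ψ with
  | zero => simp [scaledSum, tsum_mul_right]
  | succ n ih =>
    rw [iteratedDeriv_succ', iteratedDeriv_succ']
    have h := (scaledSum_aux hw ha ha1 hψ le_rfl).2
    rw [ofReal_zero] at h
    rw [h.iteratedDeriv_eq, ih (w := fun m => w m * a m) _ fun t => (hψ t).deriv]
    · congr 2
      ext m
      push_cast
      ring
    · refine hw.of_nonneg_of_le (fun _ => abs_nonneg _) fun m => ?_
      rw [abs_mul, abs_of_nonneg (ha m)]
      exact mul_le_of_le_one_right (abs_nonneg _) (ha1 m)

end scaledSum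

/-- The scaling factor `1 / (2 π (m + 1))`. -/
def scaleFactor (m : ℕ) : ℝ := 1 / (2 * Real.pi * (m + 1))

theorem scaleFactor_pos (m : ℕ) : 0 < scaleFactor m := by
  unfold scaleFactor
  positivity

theorem scaleFactor_le_one (m : ℕ) : scaleFactor m ≤ 1 := by
  unfold scaleFactor
  rw [div_le_one (by positivity)]
  nlinarith [Real.pi_gt_three, (Nat.cast_nonneg m : (0 : ℝ) ≤ m)]

theorem summable_scaleFactor_sq : Summable fun m => |scaleFactor m ^ 2| := by
  have h := ((summable_nat_add_iff 1).2 (Real.summable_one_div_nat_pow.2 one_lt_two)).mul_left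
    (1 / (2 * Real.pi) ^ 2)
  refine h.congr fun m => ?_
  rw [abs_of_nonneg (by positivity), scaleFactor]
  push_cast
  field_simp

/-- Euler's formula for `ζ(2k)`; the scale factors absorb the power of `2 π` in it. -/
theorem tsum_scaleFactor_pow {k : ℕ} (hk : k ≠ 0) :
    ∑' m, scaleFactor m ^ (2 * k) = (-1) ^ (k + 1) / 2 * (bernoulli (2 * k) : ℝ) / (2 * k)! := by
  have h := hasSum_zeta_nat hk
  have h1 := (hasSum_nat_add_iff' 1).2 h
  simp only [Finset.range_one, Finset.sum_singleton, Nat.cast_zero] at h1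
  rw [zero_pow (by omega), div_zero, sub_zero] at h1
  have h2 := (h1.mul_left (1 / (2 * Real.pi) ^ (2 * k))).tsum_eq
  have h3 : ∀ m, scaleFactor m ^ (2 * k) =
      1 / (2 * Real.pi) ^ (2 * k) * (1 / ((m + 1 : ℕ) : ℝ) ^ (2 * k)) := by
    intro m
    rw [scaleFactor, div_pow, mul_pow, one_pow]
    push_cast
    field_simp
  rw [tsum_congr h3, h2]
  have h4 : (2 : ℝ) ^ (2 * k - 1) = 2 ^ (2 * k) / 2 := by
    rw [eq_div_iff two_ne_zero, ← pow_succ]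
    congr 1
    omega
  rw [h4, mul_pow]
  field_simp

/-- `f'(1 + i t) + f'(1 - i t) - f'(i t) - f'(- i t)`. -/
def borelKernel (f : ℂ → ℂ) (t : ℂ) : ℂ :=
  deriv f (1 + I * t) + deriv f (1 - I * t) - deriv f (I * t) - deriv f (-(I * t))

/-- The Borel sum of the Euler-MacLaurin series. -/
def borelSum (f : ℂ → ℂ) : ℂ → ℂ :=
  scaledSum (fun m => scaleFactor m ^ 2) scaleFactor (borelKernel f)

theorem iteratedDeriv_comp_affine {g : ℂ → ℂ} (n : ℕ) (b c : ℂ) :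
    ∀ t, AnalyticAt ℂ g (b + c * t) →
      iteratedDeriv n (fun t => g (b + c * t)) t = c ^ n * iteratedDeriv n g (b + c * t) := by
  induction n generalizing g with
  | zero => simp
  | succ n ih =>
    intro t ht
    have hev : deriv (fun t => g (b + c * t)) =ᶠ[𝓝 t] fun t => c * deriv g (b + c * t) := by
      have hc : ContinuousAt (fun t => b + c * t) t := by fun_prop
      filter_upwards [hc.eventually ht.eventually_analyticAt] with s hs
      have h2 : HasDerivAt (fun t : ℂ => b + c * t) c s := by
        simpa using ((hasDerivAt_id s).const_mul c).const_add b
      exact (hs.differentiableAt.hasDerivAt.comp s h2).deriv.trans (mul_comm _ _)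
    rw [iteratedDeriv_succ', hev.iteratedDeriv_eq, iteratedDeriv_succ', iteratedDeriv_const_mul_field,
      ih t ht.deriv, pow_succ']
    ring

section Borel

variable {f : ℂ → ℂ} (h0 : ∀ t : ℝ, AnalyticAt ℂ f (t * I)) (h1 : ∀ t : ℝ, AnalyticAt ℂ f (1 + t * I))
include h0 h1

theorem analyticAt_borelKernel (t : ℝ) : AnalyticAt ℂ (borelKernel f) t := by
  have key : ∀ b c : ℂ, AnalyticAt ℂ f (b + c * t) →
      AnalyticAt ℂ (fun t => deriv f (b + c * t)) t := fun b c h =>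
    h.deriv.fun_comp (f := fun t => b + c * t) (by fun_prop)
  have e1 := key 1 I (by simpa [mul_comm] using h1 t)
  have e2 := key 1 (-I) (by simpa [mul_comm] using h1 (-t))
  have e3 := key 0 I (by simpa [mul_comm] using h0 t)
  have e4 := key 0 (-I) (by simpa [mul_comm] using h0 (-t))
  refine (((e1.add e2).sub e3).sub e4).congr (Eventually.of_forall fun s => ?_)
  simp [borelKernel, sub_eq_add_neg]

/-- The factor `I ^ n + (-I) ^ n` vanishes for odd `n`, so only the odd-order derivatives of `f`
survive, as in the Euler-MacLaurin series. -/
theorem iteratedDeriv_borelKernel_zero (n : ℕ) : iteratedDeriv n (borelKernel f) 0 =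
    (I ^ n + (-I) ^ n) * (iteratedDeriv (n + 1) f 1 - iteratedDeriv (n + 1) f 0) := by
  have a1 : AnalyticAt ℂ f 1 := by simpa using h1 0
  have a0 : AnalyticAt ℂ f 0 := by simpa using h0 0
  have key : ∀ b c : ℂ, AnalyticAt ℂ f b →
      ContDiffAt ℂ n (fun t => deriv f (b + c * t)) 0 ∧
      iteratedDeriv n (fun t => deriv f (b + c * t)) 0 = c ^ n * iteratedDeriv (n + 1) f b := by
    intro b c h
    have h' : AnalyticAt ℂ f (b + c * 0) := by simpa using h
    refine ⟨(h'.deriv.fun_comp (f := fun t => b + c * t) (by fun_prop)).contDiffAt, ?_⟩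
    rw [iteratedDeriv_comp_affine n b c 0 h'.deriv, iteratedDeriv_succ']
    simp
  have e : borelKernel f = (((fun t => deriv f (1 + I * t)) + fun t => deriv f (1 + (-I) * t)) -
      fun t => deriv f (0 + I * t)) - fun t => deriv f (0 + (-I) * t) := by
    ext s
    simp [borelKernel, sub_eq_add_neg]
  obtain ⟨c1, d1⟩ := key 1 I a1
  obtain ⟨c2, d2⟩ := key 1 (-I) a1
  obtain ⟨c3, d3⟩ := key 0 I a0
  obtain ⟨c4, d4⟩ := key 0 (-I) a0
  rw [e]
  generalize (fun t => deriv f (1 + I * t)) = k1 at *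
  generalize (fun t => deriv f (1 + (-I) * t)) = k2 at *
  generalize (fun t => deriv f (0 + I * t)) = k3 at *
  generalize (fun t => deriv f (0 + (-I) * t)) = k4 at *
  have c12 : ContDiffAt ℂ n (k1 + k2) 0 := c1.add c2
  have c123 : ContDiffAt ℂ n (k1 + k2 - k3) 0 := c12.sub c3
  rw [iteratedDeriv_sub c123 c4, iteratedDeriv_sub c12 c3,
    iteratedDeriv_add c1 c2, d1, d2, d3, d4]
  ring

/-- For `n = 2k` the moment of the weights is `∑ (2 π m) ^ (-2k-2)`, which gives the Bernoulli
number of index `2k + 2`. Its sign `(-1) ^ k` and its factor `1 / 2` cancel against `I ^ n + (-I) ^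
n = 2 (-1) ^ k`. -/
theorem isContinuationToHalfLine_borelSum :
    IsContinuationToHalfLine (borelSum f) (formalBorel (emSeries f)) := by
  have ha := fun m => (scaleFactor_pos m).le
  have hψ := analyticAt_borelKernel h0 h1
  refine ⟨?_, fun n => ?_⟩
  · rintro _ ⟨p, hp, rfl⟩
    exact analyticAt_scaledSum summable_scaleFactor_sq ha scaleFactor_le_one hψ hp
  · rw [borelSum, iteratedDeriv_scaledSum summable_scaleFactor_sq ha scaleFactor_le_one hψ,
      iteratedDeriv_borelKernel_zero h0 h1, formalBorel, emSeries, PowerSeries.coeff_mk,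
      PowerSeries.coeff_mk]
    congr 1
    rcases Nat.even_or_odd n with he | ho
    · rw [if_pos he.add_one]
      obtain ⟨k, rfl⟩ := he
      have hs := tsum_scaleFactor_pow (k := k + 1) (by omega)
      have hsum : (∑' m, ((scaleFactor m ^ 2 * scaleFactor m ^ (k + k) : ℝ) : ℂ)) =
          (-1) ^ k / 2 * (bernoulli (k + k + 1 + 1) : ℂ) / (k + k + 1 + 1)! := by
        rw [← ofReal_tsum]
        have : ∀ m, scaleFactor m ^ 2 * scaleFactor m ^ (k + k) = scaleFactor m ^ (2 * (k + 1)) :=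
          fun m => by ring
        rw [tsum_congr this, hs, show 2 * (k + 1) = k + k + 1 + 1 by ring]
        push_cast
        ring
      have hI : I ^ (k + k) + (-I) ^ (k + k) = 2 * (-1) ^ k := by
        rw [← two_mul, pow_mul, pow_mul, neg_sq, I_sq]
        ring
      have h2 : ((-1 : ℂ) ^ k) * (-1) ^ k = 1 := by rw [← mul_pow]; simp
      rw [hsum, hI]
      linear_combination ((bernoulli (k + k + 1 + 1) : ℂ) / (k + k + 1 + 1)! *
        (iteratedDeriv (k + k + 1) f 1 - iteratedDeriv (k + k + 1) f 0)) * h2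
    · rw [if_neg (by simpa [Nat.even_add_one] using ho), ho.neg_pow]
      simp

end Borel

/-! ### Fourier coefficients and the trapezoidal rule -/

/-- Two integrations by parts: the sine vanishes and the cosine is `1` at both ends. The gain of `1
/ n ^ 2` makes the series of coefficients summable. -/
theorem integral_mul_cos_two_pi {g g' g'' : ℝ → ℂ} (hg : ∀ y ∈ Set.Icc (0 : ℝ) 1, HasDerivAt g (g' y) y)
    (hg' : ∀ y ∈ Set.Icc (0 : ℝ) 1, HasDerivAt g' (g'' y) y)
    (hg'' : ContinuousOn g'' (Set.Icc 0 1)) {n : ℕ} (hn : n ≠ 0) :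
    ∫ y in (0 : ℝ)..1, g y * Real.cos (2 * Real.pi * n * y) =
      (g' 1 - g' 0 - ∫ y in (0 : ℝ)..1, g'' y * Real.cos (2 * Real.pi * n * y)) /
        (2 * Real.pi * n) ^ 2 := by
  set κ : ℝ := 2 * Real.pi * n with hκ
  have hκ0 : κ ≠ 0 := by positivity
  have hu : Set.uIcc (0 : ℝ) 1 = Set.Icc 0 1 := Set.uIcc_of_le zero_le_one
  have hsin : ∀ y, HasDerivAt (fun y : ℝ => ((Real.sin (κ * y) / κ : ℝ) : ℂ))
      ((Real.cos (κ * y) : ℝ) : ℂ) y := by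
    intro y
    have h := ((hasDerivAt_id y).const_mul κ).sin.div_const κ
    refine HasDerivAt.ofReal_comp (h.congr_deriv ?_)
    field_simp
    simp
  have hcos : ∀ y, HasDerivAt (fun y : ℝ => ((-Real.cos (κ * y) / κ ^ 2 : ℝ) : ℂ))
      ((Real.sin (κ * y) / κ : ℝ) : ℂ) y := by
    intro y
    have h := ((hasDerivAt_id y).const_mul κ).cos.neg.div_const (κ ^ 2)
    refine HasDerivAt.ofReal_comp (h.congr_deriv ?_)
    field_simp
    simp
  have hg'i : IntervalIntegrable g' volume 0 1 := by
    refine ContinuousOn.intervalIntegrable fun y hy => ?_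
    rw [hu] at hy
    exact (hg' y hy).continuousAt.continuousWithinAt
  have hg''i : IntervalIntegrable g'' volume 0 1 := by
    refine ContinuousOn.intervalIntegrable ?_
    rwa [hu]
  have e1 := intervalIntegral.integral_mul_deriv_eq_deriv_mul (a := 0) (b := 1) (u := g) (u' := g')
    (fun y hy => hg y (hu ▸ hy)) (fun y _ => hsin y) hg'i
    (Continuous.intervalIntegrable (by fun_prop) _ _)
  have e2 := intervalIntegral.integral_mul_deriv_eq_deriv_mul (a := 0) (b := 1) (u := g') (u' := g'')
    (fun y hy => hg' y (hu ▸ hy)) (fun y _ => hcos y) hg''i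
    (Continuous.intervalIntegrable (by fun_prop) _ _)
  have s1 : Real.sin (κ * 1) = 0 := by
    rw [hκ, mul_one, show 2 * Real.pi * n = ((2 * n : ℕ) : ℝ) * Real.pi by push_cast; ring]
    exact Real.sin_nat_mul_pi _
  have c1 : Real.cos (κ * 1) = 1 := by
    rw [hκ, mul_one, show 2 * Real.pi * n = (n : ℝ) * (2 * Real.pi) by ring]
    exact Real.cos_nat_mul_two_pi _
  rw [e1, e2, s1, c1]
  have e3 : ∫ y in (0 : ℝ)..1, g'' y * ((-Real.cos (κ * y) / κ ^ 2 : ℝ) : ℂ) =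
      -(∫ y in (0 : ℝ)..1, g'' y * Real.cos (κ * y)) / κ ^ 2 := by
    rw [← intervalIntegral.integral_neg, ← intervalIntegral.integral_div]
    refine intervalIntegral.integral_congr fun y _ => ?_
    push_cast
    ring
  rw [e3]
  have : (κ : ℂ) ≠ 0 := by exact_mod_cast hκ0
  have h5 : (2 * Real.pi * n : ℂ) = κ := by rw [hκ]; push_cast; ring
  rw [h5]
  simp
  field_simp
  ring

theorem hasSum_cos_div_sq {x : ℝ} (hx : x ∈ Set.Icc (0 : ℝ) 1) : HasSum (fun m : ℕ =>
    1 / ((m + 1 : ℕ) : ℝ) ^ 2 * Real.cos (2 * Real.pi * (m + 1 : ℕ) * x))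
    (Real.pi ^ 2 * (x ^ 2 - x + 1 / 6)) := by
  have h := (hasSum_nat_add_iff' 1).2 (hasSum_one_div_nat_pow_mul_cos one_ne_zero hx)
  simp only [Finset.range_one, Finset.sum_singleton, Nat.cast_zero] at h
  rw [zero_pow (by norm_num), div_zero, zero_mul, sub_zero] at h
  have hv : (Polynomial.map (algebraMap ℚ ℝ) (Polynomial.bernoulli (2 * 1))).eval x =
      x ^ 2 - x + 1 / 6 := by
    simp [Polynomial.bernoulli, Finset.sum_range_succ, bernoulli_one, bernoulli_two,
      Polynomial.map_monomial]
    ring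
  rw [hv] at h
  have e : (-1 : ℝ) ^ (1 + 1) * (2 * Real.pi) ^ (2 * 1) / 2 / (2 * 1)! * (x ^ 2 - x + 1 / 6) =
      Real.pi ^ 2 * (x ^ 2 - x + 1 / 6) := by
    simp only [mul_one, Nat.factorial_two]
    push_cast
    ring
  rw [e] at h
  exact h

/-- No pointwise convergence theorem for Fourier series is needed. Each coefficient is replaced by
its double integration by parts, the sum is taken under the integral of `g''`, where it becomes the
second Bernoulli polynomial, and two integrations by parts lead back to `g`. -/
theorem hasSum_integral_mul_cos_two_pi {g g' g'' : ℝ → ℂ}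
    (hg : ∀ y ∈ Set.Icc (0 : ℝ) 1, HasDerivAt g (g' y) y)
    (hg' : ∀ y ∈ Set.Icc (0 : ℝ) 1, HasDerivAt g' (g'' y) y)
    (hg'' : ContinuousOn g'' (Set.Icc 0 1)) :
    HasSum (fun m : ℕ => 2 * ∫ y in (0 : ℝ)..1, g y * Real.cos (2 * Real.pi * (m + 1 : ℕ) * y))
      ((g 0 + g 1) / 2 - ∫ y in (0 : ℝ)..1, g y) := by
  have hu : Set.uIcc (0 : ℝ) 1 = Set.Icc 0 1 := Set.uIcc_of_le zero_le_one
  have hgi : IntervalIntegrable g volume 0 1 := by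
    refine ContinuousOn.intervalIntegrable fun y hy => ?_
    rw [hu] at hy
    exact (hg y hy).continuousAt.continuousWithinAt
  have hg'i : IntervalIntegrable g' volume 0 1 := by
    refine ContinuousOn.intervalIntegrable fun y hy => ?_
    rw [hu] at hy
    exact (hg' y hy).continuousAt.continuousWithinAt
  have hg''i : IntervalIntegrable g'' volume 0 1 := by
    refine ContinuousOn.intervalIntegrable ?_
    rwa [hu]
  have hB := fun x hx => hasSum_cos_div_sq (x := x) hx
  have hI : HasSum (fun m : ℕ => ∫ y in (0 : ℝ)..1, g'' y *
      ((1 / ((m + 1 : ℕ) : ℝ) ^ 2 * Real.cos (2 * Real.pi * (m + 1 : ℕ) * y) : ℝ) : ℂ))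
      (∫ y in (0 : ℝ)..1, g'' y * ((Real.pi ^ 2 * (y ^ 2 - y + 1 / 6) : ℝ) : ℂ)) := by
    refine intervalIntegral.hasSum_integral_of_dominated_convergence
      (fun m y => ‖g'' y‖ * (1 / ((m + 1 : ℕ) : ℝ) ^ 2)) (fun m => ?_) (fun m => ?_) ?_ ?_ ?_
    · exact hg''i.def'.aestronglyMeasurable.mul
        (Continuous.aestronglyMeasurable (by fun_prop))
    · refine Eventually.of_forall fun y _ => ?_
      rw [norm_mul, norm_real, norm_mul]
      refine mul_le_mul_of_nonneg_left ?_ (norm_nonneg _)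
      rw [Real.norm_of_nonneg (by positivity)]
      exact mul_le_of_le_one_right (by positivity) (Real.abs_cos_le_one _)
    · exact Eventually.of_forall fun y _ =>
        ((summable_nat_add_iff 1).2 (Real.summable_one_div_nat_pow.2 one_lt_two)).mul_left _
    · simp_rw [tsum_mul_left]
      exact hg''i.norm.mul_const _
    · refine Eventually.of_forall fun y hy => ?_
      have hy' : y ∈ Set.Icc (0 : ℝ) 1 := by
        rw [Set.uIoc_of_le zero_le_one] at hy
        exact ⟨hy.1.le, hy.2⟩
      exact (hasSum_ofReal.2 (hB y hy')).mul_left (g'' y)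
  -- At `x = 0` the cosine series is `ζ(2)`, which sums the boundary terms `g' 1 - g' 0`.
  have hZ := hasSum_ofReal.2 (hB 0 ⟨le_rfl, zero_le_one⟩)
  have hS := ((hZ.mul_left (g' 1 - g' 0)).sub hI).mul_left (1 / (2 * (Real.pi : ℂ) ^ 2))
  have hpi : (Real.pi : ℂ) ≠ 0 := by exact_mod_cast Real.pi_ne_zero
  have p1 : ∀ y, HasDerivAt (fun y : ℝ => ((y ^ 2 - y + 1 / 6 : ℝ) : ℂ))
      ((2 * y - 1 : ℝ) : ℂ) y := by
    intro y
    refine HasDerivAt.ofReal_comp ?_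
    have h := (((hasDerivAt_id y).pow 2).sub (hasDerivAt_id y)).add_const (1 / 6)
    refine h.congr_deriv ?_
    simp
  have p2 : ∀ y, HasDerivAt (fun y : ℝ => ((2 * y - 1 : ℝ) : ℂ)) ((2 : ℝ) : ℂ) y := by
    intro y
    refine HasDerivAt.ofReal_comp ?_
    have h := ((hasDerivAt_id y).const_mul 2).sub_const 1
    refine h.congr_deriv ?_
    simp
  have e1 := intervalIntegral.integral_deriv_mul_eq_sub (a := 0) (b := 1) (u := g') (u' := g'')
    (fun y hy => hg' y (hu ▸ hy)) (fun y _ => p1 y) hg''i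
    (Continuous.intervalIntegrable (by fun_prop) _ _)
  have e2 := intervalIntegral.integral_deriv_mul_eq_sub (a := 0) (b := 1) (u := g) (u' := g')
    (fun y hy => hg y (hu ▸ hy)) (fun y _ => p2 y) hg'i
    (Continuous.intervalIntegrable (by fun_prop) _ _)
  have hc1 : Continuous fun y : ℝ => ((y ^ 2 - y + 1 / 6 : ℝ) : ℂ) := by fun_prop
  have hc2 : Continuous fun y : ℝ => ((2 * y - 1 : ℝ) : ℂ) := by fun_prop
  rw [intervalIntegral.integral_add (hg''i.mul_continuousOn hc1.continuousOn)
    (hg'i.mul_continuousOn hc2.continuousOn)] at e1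
  rw [intervalIntegral.integral_add (hg'i.mul_continuousOn hc2.continuousOn)
    (hgi.mul_const _), intervalIntegral.integral_mul_const] at e2
  have e3 : (∫ y in (0 : ℝ)..1, g'' y * ((Real.pi ^ 2 * (y ^ 2 - y + 1 / 6) : ℝ) : ℂ)) =
      Real.pi ^ 2 * ∫ y in (0 : ℝ)..1, g'' y * ((y ^ 2 - y + 1 / 6 : ℝ) : ℂ) := by
    rw [← intervalIntegral.integral_const_mul]
    refine intervalIntegral.integral_congr fun y _ => ?_
    push_cast
    ring
  rw [e3] at hS
  convert! hS using 1
  · ext m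
    rw [integral_mul_cos_two_pi hg hg' hg'' (Nat.succ_ne_zero m)]
    have e4 : (∫ y in (0 : ℝ)..1, g'' y *
        ((1 / ((m + 1 : ℕ) : ℝ) ^ 2 * Real.cos (2 * Real.pi * (m + 1 : ℕ) * y) : ℝ) : ℂ)) =
        1 / ((m + 1 : ℕ) : ℂ) ^ 2 *
          ∫ y in (0 : ℝ)..1, g'' y * Real.cos (2 * Real.pi * (m + 1 : ℕ) * y) := by
      rw [← intervalIntegral.integral_const_mul]
      refine intervalIntegral.integral_congr fun y _ => ?_
      push_cast
      ring
    rw [e4]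
    have hm : ((m + 1 : ℕ) : ℂ) ≠ 0 := by exact_mod_cast Nat.succ_ne_zero m
    simp
    push_cast at hm
    field_simp
  · generalize (∫ y in (0 : ℝ)..1, g'' y * ((y ^ 2 - y + 1 / 6 : ℝ) : ℂ)) = A at *
    generalize (∫ y in (0 : ℝ)..1, g' y * ((2 * y - 1 : ℝ) : ℂ)) = B at *
    generalize (∫ y in (0 : ℝ)..1, g y) = J at *
    push_cast at e1 e2 ⊢
    field_simp
    linear_combination 6 * e1 - 6 * e2

/-- The previous result is applied on each interval `[k/N, (k+1)/N]`, rescaled to unit length. By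
periodicity the `N` cosine integrals of frequency `m + 1` glue to one integral over `[0, 1]` of
frequency `(m + 1) N`, and the averages of end values add up to the trapezoidal sum. -/
theorem hasSum_fourier_eq_trapezoid {f : ℂ → ℂ} (hf : ∀ x ∈ Set.Icc (0 : ℝ) 1, AnalyticAt ℂ f x) {N : ℕ}
    (hN : 1 ≤ N) :
    HasSum (fun m : ℕ => (N : ℂ) *
        ((∫ x in (0 : ℝ)..1, f x * exp (2 * Real.pi * I * ((m + 1) * N : ℕ) * x)) +
          ∫ x in (0 : ℝ)..1, f x * exp (-(2 * Real.pi * I * ((m + 1) * N : ℕ) * x))))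
      (∑ k ∈ Finset.Icc 1 N, f (k / N) - (f 1 - f 0) / 2 - N * ∫ x in (0 : ℝ)..1, f x) := by
  have hN0 : (N : ℝ) ≠ 0 := by positivity
  have hNp : (0 : ℝ) < N := by positivity
  have hfc : ContinuousOn (fun x : ℝ => f x) (Set.Icc 0 1) := fun x hx =>
    ((hf x hx).continuousAt.comp continuous_ofReal.continuousAt).continuousWithinAt
  have hsub : ∀ k ∈ Finset.range N, ∀ y ∈ Set.Icc (0 : ℝ) 1, (k + y) / N ∈ Set.Icc (0 : ℝ) 1 := by
    intro k hk y hy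
    have : (k : ℝ) + 1 ≤ N := by exact_mod_cast Finset.mem_range.1 hk
    have hk0 : (0 : ℝ) ≤ k := k.cast_nonneg
    exact ⟨div_nonneg (by linarith [hy.1]) hNp.le, (div_le_one hNp).2 (by linarith [hy.2])⟩
  have hder : ∀ {h : ℂ → ℂ} {k : ℕ} {y : ℝ}, AnalyticAt ℂ h ((k + y) / N : ℝ) →
      HasDerivAt (fun y : ℝ => h ((k + y) / N : ℝ)) (deriv h ((k + y) / N : ℝ) * (1 / N : ℝ)) y := by
    intro h k y hh
    have h1 : HasDerivAt (fun y : ℝ => (((k + y) / N : ℝ) : ℂ)) ((1 / N : ℝ) : ℂ) y :=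
      HasDerivAt.ofReal_comp (((hasDerivAt_id y).const_add (k : ℝ)).div_const (N : ℝ))
    exact hh.differentiableAt.hasDerivAt.comp y h1
  have hpiece : ∀ k ∈ Finset.range N, HasSum (fun m : ℕ => 2 * ∫ y in (0 : ℝ)..1,
      f ((k + y) / N : ℝ) * Real.cos (2 * Real.pi * (m + 1 : ℕ) * y))
      ((f ((k + 0) / N : ℝ) + f ((k + 1) / N : ℝ)) / 2 - ∫ y in (0 : ℝ)..1, f ((k + y) / N : ℝ)) := by
    intro k hk
    refine hasSum_integral_mul_cos_two_pi
      (g'' := fun y => deriv (deriv f) ((k + y) / N : ℝ) * (1 / N : ℝ) * (1 / N : ℝ))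
      (fun y hy => hder (hf _ (hsub k hk y hy)))
      (fun y hy => (hder (hf _ (hsub k hk y hy)).deriv).mul_const _) fun y hy => ?_
    have h2 := (hder (hf _ (hsub k hk y hy)).deriv.deriv).continuousAt
    exact ((h2.mul continuousAt_const).mul continuousAt_const).continuousWithinAt
  have hsum := hasSum_sum hpiece
  have hci : ∀ G : ℝ → ℂ, ContinuousOn G (Set.Icc 0 1) →
      ∑ k ∈ Finset.range N, ∫ y in (0 : ℝ)..1, G ((k + y) / N) =
        N * ∫ x in (0 : ℝ)..1, G x := by
    intro G hG
    have hk : ∀ k ∈ Finset.range N, ∫ y in (0 : ℝ)..1, G ((k + y) / N) =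
        N * ∫ x in ((k : ℕ) : ℝ) / N..((k + 1 : ℕ) : ℝ) / N, G x := by
      intro k _
      have h := intervalIntegral.integral_comp_div_add (a := 0) (b := 1) G hN0 ((k : ℝ) / N)
      have h' : ∀ y : ℝ, G ((k + y) / N) = G (y / N + k / N) := fun y => by
        rw [add_div, add_comm]
      simp_rw [h', h]
      rw [real_smul]
      push_cast
      congr 2 <;> ring
    rw [Finset.sum_congr rfl hk, ← Finset.mul_sum,
      intervalIntegral.sum_integral_adjacent_intervals (a := fun k : ℕ => (k : ℝ) / N)]
    · simp [div_self hN0]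
    · intro k hk
      refine (hG.mono ?_).intervalIntegrable
      rw [Set.uIcc_of_le (by gcongr; simp)]
      have : ((k + 1 : ℕ) : ℝ) ≤ N := by exact_mod_cast hk
      exact Set.Icc_subset_Icc (by positivity) ((div_le_one hNp).2 this)
  convert! hsum using 1
  · ext m
    rw [← Finset.mul_sum]
    have hc := hci (fun x => f x * Real.cos (2 * Real.pi * ((m + 1) * N : ℕ) * x))
      (hfc.mul (Continuous.continuousOn (by fun_prop)))
    have hcos : ∀ (k : ℕ) (y : ℝ), Real.cos (2 * Real.pi * ((m + 1) * N : ℕ) * ((k + y) / N)) =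
        Real.cos (2 * Real.pi * (m + 1 : ℕ) * y) := by
      intro k y
      rw [← Real.cos_add_nat_mul_two_pi (2 * Real.pi * (m + 1 : ℕ) * y) ((m + 1) * k)]
      congr 1
      push_cast
      field_simp
      ring
    simp only [hcos] at hc
    rw [hc, ← intervalIntegral.integral_add, mul_left_comm]
    · congr 1
      rw [← intervalIntegral.integral_const_mul]
      refine intervalIntegral.integral_congr fun x _ => ?_
      simp only [ofReal_cos, Complex.cos]
      push_cast
      ring_nf
    all_goals
      refine ContinuousOn.intervalIntegrable ?_
      rw [Set.uIcc_of_le zero_le_one]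
      exact hfc.mul (Continuous.continuousOn (by fun_prop))
  · rw [Finset.sum_sub_distrib, hci (fun x => f x) hfc, sub_left_inj, ← Finset.sum_div,
      Finset.sum_add_distrib]
    have e1 : ∑ k ∈ Finset.range N, f ((k + 1) / N : ℝ) = ∑ k ∈ Finset.Icc 1 N, f (k / N) := by
      rw [Finset.range_eq_Ico, ← Finset.Ico_add_one_right_eq_Icc,
        ← Finset.sum_Ico_add' (fun k : ℕ => f (k / N)) 0 N 1]
      exact Finset.sum_congr rfl fun k _ => by push_cast; rfl
    have e2 := (Finset.sum_range_succ (fun k : ℕ => f (k / N : ℝ)) N).symm.trans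
      (Finset.sum_range_succ' (fun k : ℕ => f (k / N : ℝ)) N)
    push_cast at e1 e2 ⊢
    simp only [add_zero]
    rw [e1] at e2 ⊢
    rw [div_self (by exact_mod_cast hN0), zero_div] at e2
    linear_combination -e2 / 2

/-! ### The Laplace transform of the Borel sum -/

/-- `f(1 + i t) - f(1 - i t) - f(i t) + f(- i t)`. -/
def edgeDiff (f : ℂ → ℂ) (t : ℝ) : ℂ :=
  f (1 + t * I) - f (1 - t * I) - f (t * I) + f (-(t * I))

theorem integral_exp_neg_mul_le {a T : ℝ} (ha : 0 < a) : ∫ t in (0 : ℝ)..T, Real.exp (-(a * t)) ≤ 1 / a := by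
  have hd : ∀ t, HasDerivAt (fun t => -Real.exp (-(a * t)) / a) (Real.exp (-(a * t))) t := by
    intro t
    refine ((((hasDerivAt_id t).const_mul a).neg.exp.neg).div_const a).congr_deriv ?_
    field_simp
    simp
  rw [intervalIntegral.integral_eq_sub_of_hasDerivAt (fun t _ => hd t)
    (Continuous.intervalIntegrable (by fun_prop) _ _)]
  have := Real.exp_pos (-(a * T))
  rw [← sub_div]
  gcongr
  simp
  linarith

/-- Half of the exponential rate pays for the factor `t`. The factor `1 / a` gained here, with
another one from integration, gives the summable bound in `laplace_borelSum`. -/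
theorem mul_exp_neg_two_mul_le {a t : ℝ} (ha : 0 < a) :
    t * Real.exp (-(2 * a * t)) ≤ 1 / a * Real.exp (-(a * t)) := by
  have h1 : a * t ≤ Real.exp (a * t) := by linarith [Real.add_one_le_exp (a * t)]
  have h2 : Real.exp (-(2 * a * t)) = Real.exp (-(a * t)) * Real.exp (-(a * t)) := by
    rw [← Real.exp_add]; ring_nf
  have h3 : Real.exp (a * t) * Real.exp (-(a * t)) = 1 := by rw [← Real.exp_add]; simp
  rw [h2, div_mul_eq_mul_div, le_div_iff₀ ha]
  have h4 := mul_le_mul_of_nonneg_right h1 (by positivity :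
    0 ≤ Real.exp (-(a * t)) * Real.exp (-(a * t)))
  rw [← mul_assoc (Real.exp (a * t)), h3] at h4
  linarith

section

variable {f : ℂ → ℂ} (h0 : ∀ t : ℝ, AnalyticAt ℂ f (t * I)) (h1 : ∀ t : ℝ, AnalyticAt ℂ f (1 + t * I))
include h0 h1

/-- The kernel is a derivative up to the factor `I`. This allows integrals of `f'` to be traded for
integrals of `f`, the function whose growth is controlled. -/
theorem hasDerivAt_edgeDiff (t : ℝ) : HasDerivAt (edgeDiff f) (I * borelKernel f t) t := by
  have key : ∀ b c : ℂ, AnalyticAt ℂ f (b + c * t) →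
      HasDerivAt (fun t : ℝ => f (b + c * t)) (deriv f (b + c * t) * c) t := by
    intro b c h
    have h2 : HasDerivAt (fun t : ℝ => b + c * (t : ℂ)) c t := by
      simpa using ((hasDerivAt_id t).ofReal_comp.const_mul c).const_add b
    exact h.differentiableAt.hasDerivAt.comp t h2
  have e1 := key 1 I (by simpa [mul_comm] using h1 t)
  have e2 := key 1 (-I) (by simpa [mul_comm] using h1 (-t))
  have e3 := key 0 I (by simpa [mul_comm] using h0 t)
  have e4 := key 0 (-I) (by simpa [mul_comm] using h0 (-t))
  refine ((((e1.sub e2).sub e3).add e4).congr_deriv ?_).congr_of_eventuallyEq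
    (Eventually.of_forall fun s => ?_)
  · simp only [borelKernel, zero_add, neg_mul, ← sub_eq_add_neg]
    ring_nf
  · simp [edgeDiff, sub_eq_add_neg, mul_comm]

theorem continuous_borelKernel : Continuous fun t : ℝ => borelKernel f t :=
  continuous_iff_continuousAt.2 fun t =>
    (analyticAt_borelKernel h0 h1 t).continuousAt.comp continuous_ofReal.continuousAt

theorem continuous_edgeDiff : Continuous (edgeDiff f) :=
  continuous_iff_continuousAt.2 fun t => (hasDerivAt_edgeDiff h0 h1 t).continuousAt

/-- The factor `t` is available because `edgeDiff f` vanishes at `0`. Without it the integrals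
against `e ^ (-2 π n t)` would only be `O(1 / n)`. -/
theorem exists_edgeDiff_le (hg : ∃ R, ∀ t : ℝ, R ≤ t → ‖edgeDiff f t‖ ≤ Real.exp (2 * Real.pi * t)) :
    ∃ C, 0 ≤ C ∧ ∀ t : ℝ, 0 ≤ t → ‖edgeDiff f t‖ ≤ C * (t * Real.exp (2 * Real.pi * t)) := by
  obtain ⟨R, hR⟩ := hg
  set R' := max R 1
  obtain ⟨C, hC⟩ := (isCompact_Icc (a := (0 : ℝ)) (b := R')).exists_bound_of_continuousOn
    (continuous_borelKernel h0 h1).continuousOn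
  have hR'1 : 1 ≤ R' := le_max_right _ _
  have hC0 : 0 ≤ C := (norm_nonneg _).trans (hC 0 ⟨le_rfl, by linarith⟩)
  refine ⟨C + 1, by linarith, fun t ht => ?_⟩
  have he : 1 ≤ Real.exp (2 * Real.pi * t) := Real.one_le_exp (by positivity)
  rcases le_total t R' with htR | htR
  · have h := (convex_Icc (0 : ℝ) R').norm_image_sub_le_of_norm_hasDerivWithin_le
      (f := edgeDiff f) (C := C) (x := 0) (y := t)
      (fun s _ => (hasDerivAt_edgeDiff h0 h1 s).hasDerivWithinAt)
      (fun s hs => by simpa using hC s hs) ⟨le_rfl, by linarith⟩ ⟨ht, htR⟩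
    have hz : edgeDiff f 0 = 0 := by simp [edgeDiff]
    rw [hz, sub_zero, sub_zero, Real.norm_of_nonneg ht] at h
    have : t ≤ t * Real.exp (2 * Real.pi * t) := le_mul_of_one_le_right ht he
    nlinarith
  · have h := hR t ((le_max_left _ _).trans htR)
    have : Real.exp (2 * Real.pi * t) ≤ t * Real.exp (2 * Real.pi * t) :=
      le_mul_of_one_le_left (by positivity) (hR'1.trans htR)
    nlinarith

/-- Integration by parts followed by `t = s p`; the boundary term at `0` vanishes with `edgeDiff f
0`. For `s = scaleFactor m` the new rate `N / s` is `2 π (m + 1) N`. -/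
theorem integral_exp_mul_borelKernel (N : ℕ) {s : ℝ} (hs : 0 < s) (P : ℝ) :
    ∫ p in (0 : ℝ)..P, exp (-(N * p)) * ((s ^ 2 : ℝ) * borelKernel f (s * p)) =
      -I * s * (exp (-(N * P)) * edgeDiff f (s * P)) -
        I * N * ∫ t in (0 : ℝ)..(s * P), exp (-(N / s * t)) * edgeDiff f t := by
  have hd : ∀ p : ℝ, HasDerivAt (fun p : ℝ => edgeDiff f (s * p)) ((s : ℂ) * (I * borelKernel f ((s : ℂ) * p))) p := by
    intro p
    have h := (hasDerivAt_edgeDiff h0 h1 (s * p)).scomp p ((hasDerivAt_id p).const_mul s)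
    refine h.congr_deriv ?_
    simp
  have hE : ∀ p : ℝ, HasDerivAt (fun p : ℝ => exp (-(N * p))) (-N * exp (-(N * p))) p := by
    intro p
    have h := ((hasDerivAt_id p).ofReal_comp.const_mul (N : ℂ)).neg.cexp
    refine h.congr_deriv ?_
    simp
    ring
  have hc := (continuous_borelKernel h0 h1).comp (continuous_const_mul s)
  have hc' : Continuous fun p : ℝ => borelKernel f (s * p) := by
    refine hc.congr fun p => ?_
    simp
  have hce := continuous_edgeDiff h0 h1
  have hparts := intervalIntegral.integral_mul_deriv_eq_deriv_mul (a := 0) (b := P)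
    (fun p _ => hE p) (fun p _ => hd p)
    (Continuous.intervalIntegrable (by fun_prop) _ _)
    (Continuous.intervalIntegrable (by fun_prop) _ _)
  have hz : edgeDiff f (s * 0) = 0 := by simp [edgeDiff]
  have hs0 : (s : ℂ) ≠ 0 := by exact_mod_cast hs.ne'
  have hsub := intervalIntegral.integral_comp_mul_left (a := 0) (b := P)
    (fun t => exp (-(N / s * t)) * edgeDiff f t) hs.ne'
  have e1 : ∫ p in (0 : ℝ)..P, exp (-(N * p)) * ((s ^ 2 : ℝ) * borelKernel f (s * p)) =
      -I * s * ∫ p in (0 : ℝ)..P, exp (-(N * p)) * ((s : ℂ) * (I * borelKernel f (s * p))) := by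
    rw [← intervalIntegral.integral_const_mul]
    refine intervalIntegral.integral_congr fun p _ => ?_
    push_cast
    linear_combination (exp (-(N * p)) * s ^ 2 * borelKernel f (s * p)) * I_sq
  have e2 : ∫ p in (0 : ℝ)..P, -N * exp (-(N * p)) * edgeDiff f (s * p) =
      -N * ∫ p in (0 : ℝ)..P, exp (-(N / s * ((s * p : ℝ) : ℂ))) * edgeDiff f (s * p) := by
    rw [← intervalIntegral.integral_const_mul]
    refine intervalIntegral.integral_congr fun p _ => ?_
    have : (N / s * ((s * p : ℝ) : ℂ)) = N * p := by
      push_cast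
      field_simp
    simp only [this]
    ring
  rw [e1, hparts, hz, e2, hsub, mul_zero, mul_zero, real_smul]
  generalize (∫ t in (0 : ℝ)..(s * P), exp (-(N / s * t)) * edgeDiff f t) = J
  push_cast
  field_simp
  ring

theorem hasSum_truncatedLaplace_borelSum (N : ℕ) {P : ℝ} (hP : 0 ≤ P) :
    HasSum (fun m => ∫ p in (0 : ℝ)..P, exp (-(N * p)) *
      ((scaleFactor m ^ 2 : ℝ) * borelKernel f (scaleFactor m * p)))
      (truncatedLaplace (fun p => borelSum f p) N P) := by
  have hc := continuous_borelKernel h0 h1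
  obtain ⟨C, hC⟩ := (isCompact_Icc (a := (0 : ℝ)) (b := P)).exists_bound_of_continuousOn
    hc.continuousOn
  have hc' : ∀ m, Continuous fun p : ℝ => borelKernel f (scaleFactor m * p) := fun m =>
    (hc.comp (continuous_const_mul (scaleFactor m))).congr fun p => by simp
  have hb : ∀ m, ∀ p ∈ Set.Icc (0 : ℝ) P, ‖exp (-(N * p)) *
      ((scaleFactor m ^ 2 : ℝ) * borelKernel f (scaleFactor m * p))‖ ≤
      |scaleFactor m ^ 2| * C := by
    intro m p hp
    have h1 : ‖exp (-(N * p : ℂ))‖ ≤ 1 := by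
      rw [norm_exp, Real.exp_le_one_iff]
      simp only [neg_re, mul_re, natCast_re, ofReal_re, natCast_im, ofReal_im]
      have := mul_nonneg (Nat.cast_nonneg N : (0 : ℝ) ≤ N) hp.1
      linarith
    have h2 := hC (scaleFactor m * p) ⟨mul_nonneg (scaleFactor_pos m).le hp.1,
      (mul_le_of_le_one_left hp.1 (scaleFactor_le_one m)).trans hp.2⟩
    rw [ofReal_mul] at h2
    rw [norm_mul, norm_mul, norm_real, Real.norm_eq_abs]
    calc _ ≤ 1 * (|scaleFactor m ^ 2| * C) := by gcongr
      _ = _ := one_mul _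
  have hmem : ∀ {p : ℝ}, p ∈ Set.uIoc 0 P → p ∈ Set.Icc 0 P := fun hp => by
    rw [Set.uIoc_of_le hP] at hp
    exact ⟨hp.1.le, hp.2⟩
  have hs := summable_scaleFactor_sq.mul_right C
  refine intervalIntegral.hasSum_integral_of_dominated_convergence
    (fun m _ => |scaleFactor m ^ 2| * C) (fun m => ?_) (fun m => ?_) ?_ ?_ ?_
  · have := hc' m
    exact Continuous.aestronglyMeasurable (by fun_prop)
  · exact Eventually.of_forall fun p hp => hb m p (hmem hp)
  · exact Eventually.of_forall fun p _ => hs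
  · exact intervalIntegrable_const
  · refine Eventually.of_forall fun p hp => ?_
    have h := (Summable.of_norm_bounded hs fun m => hb m p (hmem hp)).hasSum
    rw [tsum_mul_left] at h
    exact h

/-- Dominated convergence for series as `P → ∞`. For `m ≥ 1` the frequency `n = (m + 1) N` is at
least `2`, so the weight beats the growth of `edgeDiff f` and the terms are `O(1 / (m + 1) ^ 2)`
uniformly in `P`. For `m = 0` and `N = 1` the rates cancel and only the assumed convergence is
available; this one term is treated apart. -/
theorem laplace_borelSum
    (hg : ∀ ε : ℝ, 0 < ε → ∃ R, ∀ t : ℝ, R ≤ t → ‖edgeDiff f t‖ ≤ ε * Real.exp (2 * Real.pi * t))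
    {N : ℕ} (hN : 1 ≤ N) {Φ : ℕ → ℂ}
    (hΦ : ∀ n : ℕ, 1 ≤ n → Tendsto (fun T : ℝ => ∫ t in (0 : ℝ)..T,
      exp (-(2 * Real.pi * n * t)) * edgeDiff f t) atTop (𝓝 (Φ n))) :
    LaplaceConverges (fun p : ℝ => borelSum f p) N ∧
      HasSum (fun m : ℕ => -I * N * Φ ((m + 1) * N)) (laplace (fun p : ℝ => borelSum f p) N) := by
  have hN0 : (1 : ℝ) ≤ N := by exact_mod_cast hN
  set A : ℝ → ℕ → ℂ := fun P m => ∫ p in (0 : ℝ)..P, exp (-(N * p)) *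
      ((scaleFactor m ^ 2 : ℝ) * borelKernel f (scaleFactor m * p)) with hA
  have hrate : ∀ m : ℕ, (N : ℂ) / scaleFactor m = 2 * Real.pi * ((m + 1) * N : ℕ) := by
    intro m
    rw [scaleFactor]
    push_cast
    field_simp
  have hAeq : ∀ P m, A P m = -I * scaleFactor m * (exp (-(N * P)) * edgeDiff f (scaleFactor m * P)) -
        I * N * ∫ t in (0 : ℝ)..(scaleFactor m * P),
          exp (-(2 * Real.pi * ((m + 1) * N : ℕ) * t)) * edgeDiff f t := by
    intro P m
    rw [hA, ← hrate]
    exact integral_exp_mul_borelKernel h0 h1 N (scaleFactor_pos m) P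
  have hlin : ∀ m, Tendsto (fun P : ℝ => scaleFactor m * P) atTop atTop := fun m =>
    tendsto_id.const_mul_atTop (scaleFactor_pos m)
  have hnormE : ∀ n : ℕ, ∀ t : ℝ, ‖exp (-(2 * Real.pi * n * t : ℂ))‖ =
      Real.exp (-(2 * Real.pi * n * t)) := by
    intro n t
    rw [show (-(2 * Real.pi * n * t) : ℂ) = ((-(2 * Real.pi * n * t) : ℝ) : ℂ) by push_cast; ring,
      ← ofReal_exp, norm_real, Real.norm_of_nonneg (Real.exp_pos _).le]
  have hNP : ∀ m : ℕ, ∀ P : ℝ, exp (-(N * P : ℂ)) =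
      exp (-(2 * Real.pi * ((m + 1) * N : ℕ) * ((scaleFactor m * P : ℝ) : ℂ))) := by
    intro m P
    congr 2
    rw [← hrate]
    have : (scaleFactor m : ℂ) ≠ 0 := by exact_mod_cast (scaleFactor_pos m).ne'
    push_cast
    field_simp
  -- The little-o is essential here: for `n = 1` the weight exactly balances `e ^ (2 π T)`.
  have hbdry : ∀ n : ℕ, 1 ≤ n → Tendsto (fun T : ℝ => exp (-(2 * Real.pi * n * (T : ℂ))) *
      edgeDiff f T) atTop (𝓝 0) := by
    intro n hn
    rw [Metric.tendsto_atTop]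
    intro ε hε
    obtain ⟨R, hR⟩ := hg (ε / 2) (by linarith)
    refine ⟨max R 0, fun T hT => ?_⟩
    have hT0 : 0 ≤ T := (le_max_right _ _).trans hT
    rw [dist_zero_right, norm_mul, hnormE]
    have hn' : (1 : ℝ) ≤ n := by exact_mod_cast hn
    calc _ ≤ Real.exp (-(2 * Real.pi * 1 * T)) * (ε / 2 * Real.exp (2 * Real.pi * T)) := by
            gcongr
            exact hR T ((le_max_left _ _).trans hT)
      _ = ε / 2 := by
          rw [mul_left_comm, ← Real.exp_add]
          simp
      _ < ε := by linarith
  have hlim : ∀ m, Tendsto (A · m) atTop (𝓝 (-I * N * Φ ((m + 1) * N))) := by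
    intro m
    have hn : 1 ≤ (m + 1) * N := Nat.mul_pos m.succ_pos hN
    have t1 := ((hbdry _ hn).comp (hlin m)).const_mul (-I * scaleFactor m)
    have t2 := ((hΦ _ hn).comp (hlin m)).const_mul (I * N)
    have t3 := t1.sub t2
    rw [mul_zero, zero_sub, ← neg_mul, ← neg_mul] at t3
    refine t3.congr fun P => ?_
    rw [hAeq, hNP m]
    rfl
  obtain ⟨C, hC0, hC⟩ := exists_edgeDiff_le h0 h1 (by simpa using hg 1 one_pos)
  have hmain : ∀ m : ℕ, m ≠ 0 → ∀ P : ℝ, 0 ≤ P →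
      ‖A P m‖ ≤ (C + N * C) * (1 / ((m + 1 : ℕ) : ℝ) ^ 2) := by
    intro m hm P hP
    set n : ℕ := (m + 1) * N with hn
    have hm1 : (1 : ℝ) ≤ m := by exact_mod_cast Nat.one_le_iff_ne_zero.2 hm
    have hnm : (m + 1 : ℝ) ≤ n := by
      rw [hn]
      push_cast
      exact le_mul_of_one_le_right (by positivity) hN0
    -- Here `2 a` is the net decay rate of `e ^ (-2 π n t) e ^ (2 π t)`.
    set a : ℝ := Real.pi * (n - 1) with ha
    have ham : (m + 1 : ℝ) ≤ a := by nlinarith [Real.pi_gt_three]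
    have ha0 : 0 < a := by linarith
    have hpt : ∀ t : ℝ, 0 ≤ t → ‖exp (-(2 * Real.pi * n * t : ℂ)) * edgeDiff f t‖ ≤
        C * (1 / a * Real.exp (-(a * t))) := by
      intro t ht
      rw [norm_mul, hnormE]
      calc _ ≤ Real.exp (-(2 * Real.pi * n * t)) * (C * (t * Real.exp (2 * Real.pi * t))) := by
            gcongr
            exact hC t ht
        _ = C * (t * Real.exp (-(2 * a * t))) := by
            have : Real.exp (-(2 * a * t)) =
                Real.exp (-(2 * Real.pi * n * t)) * Real.exp (2 * Real.pi * t) := by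
              rw [← Real.exp_add, ha]
              ring_nf
            rw [this]
            ring
        _ ≤ _ := mul_le_mul_of_nonneg_left (mul_exp_neg_two_mul_le ha0) hC0
    have hT : 0 ≤ scaleFactor m * P := mul_nonneg (scaleFactor_pos m).le hP
    have hma : 1 / a ≤ 1 / (m + 1) := by gcongr
    have hsm : scaleFactor m ≤ 1 / (m + 1) := by
      rw [scaleFactor]
      gcongr
      nlinarith [Real.pi_gt_three]
    have hm0 : (0 : ℝ) < m + 1 := by linarith
    have b1 : ‖-I * scaleFactor m * (exp (-(N * P)) * edgeDiff f (scaleFactor m * P))‖ ≤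
        1 / (m + 1) * (C * (1 / (m + 1))) := by
      rw [hNP m, norm_mul, norm_mul, norm_neg, norm_I, one_mul, norm_real,
        Real.norm_of_nonneg (scaleFactor_pos m).le]
      refine mul_le_mul hsm ((hpt _ hT).trans ?_) (norm_nonneg _) (by positivity)
      gcongr
      calc 1 / a * Real.exp (-(a * (scaleFactor m * P))) ≤ 1 / a * 1 := by
            gcongr
            rw [Real.exp_le_one_iff, neg_nonpos]
            positivity
        _ ≤ _ := by rwa [mul_one]
    have b2 : ‖I * N * ∫ t in (0 : ℝ)..(scaleFactor m * P),
          exp (-(2 * Real.pi * n * t)) * edgeDiff f t‖ ≤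
        N * (C * (1 / (m + 1) * (1 / (m + 1)))) := by
      rw [norm_mul, norm_mul, norm_I, one_mul, Complex.norm_natCast]
      gcongr
      have h := intervalIntegral.norm_integral_le_of_norm_le (μ := volume) hT
        (f := fun t : ℝ => exp (-(2 * Real.pi * n * t)) * edgeDiff f t)
        (Eventually.of_forall fun t ht => hpt t ht.1.le)
        (Continuous.intervalIntegrable (by fun_prop) _ _)
      refine h.trans ?_
      rw [intervalIntegral.integral_const_mul, intervalIntegral.integral_const_mul]
      gcongr
      · exact intervalIntegral.integral_nonneg hT fun _ _ => (Real.exp_pos _).le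
      · exact (integral_exp_neg_mul_le ha0).trans hma
    rw [hAeq]
    refine (norm_sub_le _ _).trans ((add_le_add b1 b2).trans (le_of_eq ?_))
    push_cast
    field_simp
  -- The exceptional term converges, so for large `P` it is bounded by the norm of its limit plus
  -- one.
  have hb1 : ∀ᶠ P in atTop, ‖A P 0‖ ≤ ‖-I * N * Φ ((0 + 1) * N)‖ + 1 :=
    (hlim 0).norm.eventually (eventually_le_nhds (lt_add_one _))
  set L := ‖-I * N * Φ ((0 + 1) * N)‖ + 1 with hL
  have hL0 : 0 ≤ L := by positivity
  set bd : ℕ → ℝ := fun m => (C + N * C) * (1 / ((m + 1 : ℕ) : ℝ) ^ 2) + if m = 0 then L else 0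
  have hbd : Summable bd :=
    (((summable_nat_add_iff 1).2 (Real.summable_one_div_nat_pow.2 one_lt_two)).mul_left _).add
      (summable_of_ne_finset_zero (s := {0}) fun m hm => if_neg (by simpa using hm))
  have hbound : ∀ᶠ P in atTop, ∀ m, ‖A P m‖ ≤ bd m := by
    filter_upwards [hb1, eventually_ge_atTop 0] with P hP1 hP m
    have hnn : 0 ≤ (C + N * C) * (1 / ((m + 1 : ℕ) : ℝ) ^ 2) := by positivity
    by_cases hm : m = 0
    · subst hm
      simp only [bd, if_true]
      linarith
    · simp only [bd, if_neg hm, add_zero]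
      exact hmain m hm P hP
  have htend := tendsto_tsum_of_dominated_convergence hbd hlim hbound
  have htl : Tendsto (truncatedLaplace (fun p => borelSum f p) N) atTop
      (𝓝 (∑' m : ℕ, -I * N * Φ ((m + 1) * N))) := by
    refine htend.congr' ?_
    filter_upwards [eventually_ge_atTop 0] with P hP
    exact (hasSum_truncatedLaplace_borelSum h0 h1 N hP).tsum_eq
  have hsumm : Summable fun m : ℕ => -I * N * Φ ((m + 1) * N) :=
    Summable.of_norm_bounded hbd fun m =>
      le_of_tendsto (hlim m).norm (hbound.mono fun P hP => hP m)
  refine ⟨⟨fun P hP => ?_, _, htl⟩, ?_⟩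
  · refine ContinuousOn.intervalIntegrable ?_
    rw [Set.uIcc_of_le hP.le]
    refine ContinuousOn.mul (Continuous.continuousOn (by fun_prop)) fun p hp => ?_
    have ha := (isContinuationToHalfLine_borelSum h0 h1).1 p ⟨p, hp.1, rfl⟩
    exact (ha.continuousAt.comp continuous_ofReal.continuousAt).continuousWithinAt
  · rw [laplace, htl.limUnder_eq]
    exact hsumm.hasSum

end

/-! ### Functions with one-sided analytic extensions to a vertical line -/

/-- `gL` and `gR` are analytic extensions of `k` to `w` from the left and from the right of the
vertical line through `w`. -/
def IsSideExt (k gL gR : ℂ → ℂ) (w : ℂ) : Prop :=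
  AnalyticAt ℂ gL w ∧ AnalyticAt ℂ gR w ∧
    ∀ᶠ z in 𝓝 w, (z.re < w.re → k z = gL z) ∧ (w.re < z.re → k z = gR z)

theorem IsSideExt.eventually_vertical {k gL gR : ℂ → ℂ} {c : ℂ} {s : ℝ}
    (h : IsSideExt k gL gR (c + s * I)) : ∀ᶠ t : ℝ in 𝓝 s, IsSideExt k gL gR (c + t * I) := by
  have hc : ContinuousAt (fun t : ℝ => c + t * I) s := by fun_prop
  filter_upwards [hc.eventually h.1.eventually_analyticAt, hc.eventually h.2.1.eventually_analyticAt,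
    hc.eventually (eventually_eventually_nhds.2 h.2.2)] with t h1 h2 h3
  refine ⟨h1, h2, h3.mono fun z hz => ?_⟩
  simpa using hz

theorem IsSideExt.congr {k k' gL gR : ℂ → ℂ} {w : ℂ} (h : IsSideExt k gL gR w)
    (hk : ∀ᶠ z in 𝓝 w, z.re ≠ w.re → k' z = k z) : IsSideExt k' gL gR w := by
  refine ⟨h.1, h.2.1, ?_⟩
  filter_upwards [h.2.2, hk] with z hz hz'
  exact ⟨fun hlt => (hz' hlt.ne).trans (hz.1 hlt), fun hlt => (hz' hlt.ne').trans (hz.2 hlt)⟩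

theorem IsSideExt.tendsto_sub {k gL gR : ℂ → ℂ} {w : ℂ} (h : IsSideExt k gL gR w) :
    Tendsto (fun δ : ℝ => k (w + δ) - k (w - δ)) (𝓝[>] 0) (𝓝 (gR w - gL w)) := by
  have hR : Tendsto (fun δ : ℝ => w + δ) (𝓝[>] 0) (𝓝 w) := by
    have : ContinuousAt (fun δ : ℝ => w + δ) 0 := by fun_prop
    simpa [ContinuousAt] using this.mono_left nhdsWithin_le_nhds
  have hL : Tendsto (fun δ : ℝ => w - δ) (𝓝[>] 0) (𝓝 w) := by
    have : ContinuousAt (fun δ : ℝ => w - δ) 0 := by fun_prop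
    simpa [ContinuousAt] using this.mono_left nhdsWithin_le_nhds
  refine ((h.2.1.continuousAt.tendsto.comp hR).sub (h.1.continuousAt.tendsto.comp hL)).congr' ?_
  filter_upwards [hR.eventually h.2.2, hL.eventually h.2.2, self_mem_nhdsWithin] with δ h1 h2 hδ
  rw [Set.mem_Ioi] at hδ
  simp only [Function.comp_apply]
  rw [h1.2 (by simpa using hδ), h2.1 (by simpa using hδ)]

/-- From a point of the upward ray, the rotation by `-δ` leads to the right of the line and the
rotation by `δ` to the left, so the variation is the right extension minus the left one. -/
theorem IsSideExt.variation_eq {k gL gR : ℂ → ℂ} {c : ℂ} {s : ℝ} (hs : 0 < s)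
    (h : IsSideExt k gL gR (c + s * I)) :
    variation k c (s * I) = gR (c + s * I) - gL (c + s * I) := by
  refine Tendsto.limUnder_eq ?_
  have hcont : ∀ σ : ℂ, Tendsto (fun δ : ℝ => c + s * I * exp (σ * (δ * I))) (𝓝[>] 0)
      (𝓝 (c + s * I)) := by
    intro σ
    have : ContinuousAt (fun δ : ℝ => c + s * I * exp (σ * (δ * I))) 0 := by fun_prop
    simpa [ContinuousAt] using this.mono_left nhdsWithin_le_nhds
  have hR := hcont (-1)
  have hL := hcont 1
  simp only [neg_mul, one_mul] at hR hL
  refine ((h.2.1.continuousAt.tendsto.comp hR).sub (h.1.continuousAt.tendsto.comp hL)).congr' ?_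
  filter_upwards [hR.eventually h.2.2, hL.eventually h.2.2,
    Ioo_mem_nhdsGT Real.pi_pos] with δ h1 h2 hδ
  have hsin : 0 < s * Real.sin δ := mul_pos hs (Real.sin_pos_of_mem_Ioo hδ)
  have e1 : (c + s * I * exp (-(δ * I))).re = c.re + s * Real.sin δ := by
    rw [← neg_mul, ← ofReal_neg, exp_mul_I]
    simp [mul_assoc, sin_ofReal_re]
  have e2 : (c + s * I * exp (δ * I)).re = c.re - s * Real.sin δ := by
    rw [exp_mul_I]
    simp [mul_assoc, sub_eq_add_neg, sin_ofReal_re]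
  simp only [Function.comp_apply]
  rw [h1.2 (by rw [e1]; simpa using hsin), h2.1 (by rw [e2]; simpa using hsin)]

/-- Rotations may be replaced by horizontal displacements, the form in which the variation arises
from vertical integrals at `Re c ± δ`. -/
theorem IsSideExt.tendsto_variation {k gL gR : ℂ → ℂ} {c : ℂ} {s : ℝ} (hs : 0 < s)
    (h : IsSideExt k gL gR (c + s * I)) :
    Tendsto (fun δ : ℝ => k (c + s * I + δ) - k (c + s * I - δ)) (𝓝[>] 0)
      (𝓝 (variation k c (s * I))) := by
  rw [h.variation_eq hs]
  exact h.tendsto_sub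

theorem IsSideExt.mul_analyticAt {k gL gR e : ℂ → ℂ} {w : ℂ} (h : IsSideExt k gL gR w)
    (he : AnalyticAt ℂ e w) :
    IsSideExt (fun z => k z * e z) (fun z => gL z * e z) (fun z => gR z * e z) w := by
  refine ⟨h.1.mul he, h.2.1.mul he, h.2.2.mono fun z hz => ⟨fun hlt => ?_, fun hlt => ?_⟩⟩
  · exact congrArg (· * e z) (hz.1 hlt)
  · exact congrArg (· * e z) (hz.2 hlt)

theorem AnalyticAt.isSideExt {k : ℂ → ℂ} {w : ℂ} (h : AnalyticAt ℂ k w) : IsSideExt k k k w :=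
  ⟨h, h, Eventually.of_forall fun _ => ⟨fun _ => rfl, fun _ => rfl⟩⟩

theorem AnalyticAt.tendsto_sub {k : ℂ → ℂ} {w : ℂ} (h : AnalyticAt ℂ k w) :
    Tendsto (fun δ : ℝ => k (w + δ) - k (w - δ)) (𝓝[>] 0) (𝓝 0) := by
  simpa using h.isSideExt.tendsto_sub

theorem IsSideExt.tendsto_variation_mul {k gL gR e : ℂ → ℂ} {c : ℂ} {s : ℝ} (hs : 0 < s)
    (h : IsSideExt k gL gR (c + s * I)) (he : AnalyticAt ℂ e (c + s * I)) :
    Tendsto (fun δ : ℝ => k (c + s * I + δ) * e (c + s * I + δ) -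
      k (c + s * I - δ) * e (c + s * I - δ)) (𝓝[>] 0)
      (𝓝 (variation k c (s * I) * e (c + s * I))) := by
  rw [h.variation_eq hs, sub_mul]
  exact (h.mul_analyticAt he).tendsto_sub

theorem IsSideExt.deriv {k k₁ gL gR : ℂ → ℂ} {w : ℂ} (h : IsSideExt k gL gR w)
    (hd : ∀ᶠ z in 𝓝 w, z.re ≠ w.re → HasDerivAt k (k₁ z) z) :
    IsSideExt k₁ (_root_.deriv gL) (_root_.deriv gR) w := by
  refine ⟨h.1.deriv, h.2.1.deriv, ?_⟩
  filter_upwards [hd, eventually_eventually_nhds.2 h.2.2] with z hz hev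
  constructor
  · intro hlt
    have : k =ᶠ[𝓝 z] gL := by
      filter_upwards [hev, (isOpen_lt continuous_re continuous_const).mem_nhds hlt] with y hy hy'
      exact hy.1 hy'
    rw [← this.deriv_eq, (hz hlt.ne).deriv]
  · intro hlt
    have : k =ᶠ[𝓝 z] gR := by
      filter_upwards [hev, (isOpen_lt continuous_const continuous_re).mem_nhds hlt] with y hy hy'
      exact hy.2 hy'
    rw [← this.deriv_eq, (hz hlt.ne').deriv]

theorem IsSideExt.hasDerivAt_variation {k k₁ gL gR : ℂ → ℂ} {c : ℂ} {s : ℝ} (hs : 0 < s)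
    (h : IsSideExt k gL gR (c + s * I))
    (hd : ∀ᶠ z in 𝓝 (c + s * I), z.re ≠ c.re → HasDerivAt k (k₁ z) z) :
    HasDerivAt (fun t : ℝ => variation k c (t * I)) (I * variation k₁ c (s * I)) s := by
  have h₁ : IsSideExt k₁ (_root_.deriv gL) (_root_.deriv gR) (c + s * I) := h.deriv (by simpa using hd)
  rw [h₁.variation_eq hs]
  have hl : HasDerivAt (fun t : ℝ => c + (t : ℂ) * I) I s := by
    simpa using ((hasDerivAt_id s).ofReal_comp.mul_const I).const_add c
  have hR := h.2.1.differentiableAt.hasDerivAt.comp s hl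
  have hL := h.1.differentiableAt.hasDerivAt.comp s hl
  refine ((hR.sub hL).congr_deriv (by ring)).congr_of_eventuallyEq ?_
  filter_upwards [h.eventually_vertical, lt_mem_nhds hs] with t ht ht0
  exact ht.variation_eq ht0

/-- A function with analytic derivative extending to `g₁` on one side of the vertical line
through `w` extends analytically as well. -/
theorem exists_analyticAt_of_deriv {k k₁ g₁ : ℂ → ℂ} {w : ℂ} {H : Set ℂ} (hH : Convex ℝ H)
    (hHo : IsOpen H) (hg₁ : AnalyticAt ℂ g₁ w) (hk₁ : ∀ᶠ z in 𝓝 w, z ∈ H → k₁ z = g₁ z)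
    (hd : ∀ᶠ z in 𝓝 w, z ∈ H → HasDerivAt k (k₁ z) z) :
    ∃ g, AnalyticAt ℂ g w ∧ ∀ᶠ z in 𝓝 w, z ∈ H → k z = g z := by
  obtain ⟨r, hr, hball⟩ := Metric.eventually_nhds_iff_ball.1
    (hg₁.eventually_analyticAt.and (hk₁.and hd))
  have hdiff : DifferentiableOn ℂ g₁ (Metric.ball w r) := fun z hz =>
    (hball z hz).1.differentiableAt.differentiableWithinAt
  obtain ⟨P, hP⟩ := hdiff.isExactOn_ball
  have hPa : AnalyticAt ℂ P w := by
    refine (show DifferentiableOn ℂ P (Metric.ball w r) from fun z hz =>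
      (hP z hz).differentiableAt.differentiableWithinAt).analyticAt (Metric.ball_mem_nhds w hr)
  rcases (Metric.ball w r ∩ H).eq_empty_or_nonempty with he | ⟨z₀, hz₀⟩
  · refine ⟨P, hPa, ?_⟩
    filter_upwards [Metric.ball_mem_nhds w hr] with z hz hzH
    exact absurd (show z ∈ Metric.ball w r ∩ H from ⟨hz, hzH⟩) (by simp [he])
  · refine ⟨fun z => P z + (k z₀ - P z₀), hPa.add analyticAt_const, ?_⟩
    have hconv : Convex ℝ (Metric.ball w r ∩ H) := (convex_ball w r).inter hH
    have hconst : ∀ z ∈ Metric.ball w r ∩ H, k z - P z = k z₀ - P z₀ := fun z hz =>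
      (Metric.isOpen_ball.inter hHo).is_const_of_deriv_eq_zero (𝕜 := ℂ)
      (f := fun z => k z - P z) hconv.isPreconnected
      (fun z hz => (((hball z hz.1).2.2 hz.2).sub (hP z hz.1)).differentiableAt.differentiableWithinAt)
      (fun z hz => by
        have := ((hball z hz.1).2.2 hz.2).sub (hP z hz.1)
        rw [(hball z hz.1).2.1 hz.2, sub_self] at this
        exact this.deriv) hz hz₀
    filter_upwards [Metric.ball_mem_nhds w hr] with z hz hzH
    linear_combination hconst z ⟨hz, hzH⟩

theorem convex_re_lt (x : ℝ) : Convex ℝ {z : ℂ | z.re < x} :=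
  convex_halfSpace_lt reLm.isLinear x

theorem convex_lt_re (x : ℝ) : Convex ℝ {z : ℂ | x < z.re} :=
  convex_halfSpace_gt reLm.isLinear x

/-- Primitives inherit one-sided extensions: on each side they differ from a primitive of the
extension by a constant. -/
theorem IsSideExt.exists_of_deriv {k k₁ gL gR : ℂ → ℂ} {w : ℂ} (h : IsSideExt k₁ gL gR w)
    (hd : ∀ᶠ z in 𝓝 w, z.re ≠ w.re → HasDerivAt k (k₁ z) z) : ∃ gL' gR', IsSideExt k gL' gR' w := by
  obtain ⟨g, hg, hg'⟩ := exists_analyticAt_of_deriv (convex_re_lt w.re)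
    (isOpen_lt continuous_re continuous_const) h.1 (h.2.2.mono fun z hz => hz.1)
    (hd.mono fun z hz hlt => hz (ne_of_lt hlt))
  obtain ⟨g', hgr, hgr'⟩ := exists_analyticAt_of_deriv (convex_lt_re w.re)
    (isOpen_lt continuous_const continuous_re) h.2.1 (h.2.2.mono fun z hz => hz.2)
    (hd.mono fun z hz hlt => hz (ne_of_gt hlt))
  exact ⟨g, g', hg, hgr, hg'.and hgr'⟩

theorem IsSideExt.exists_bound {k gL gR : ℂ → ℂ} {w : ℂ} (h : IsSideExt k gL gR w) :
    ∃ C, ∀ᶠ z in 𝓝 w, z.re ≠ w.re → ‖k z‖ ≤ C := by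
  refine ⟨max (‖gL w‖ + 1) (‖gR w‖ + 1), ?_⟩
  filter_upwards [h.2.2, h.1.continuousAt.norm.eventually (eventually_le_nhds (lt_add_one _)),
    h.2.1.continuousAt.norm.eventually (eventually_le_nhds (lt_add_one _))] with z hz h1 h2 hne
  rcases hne.lt_or_gt with hlt | hlt
  · rw [hz.1 hlt]
    exact h1.trans (le_max_left _ _)
  · rw [hz.2 hlt]
    exact h2.trans (le_max_right _ _)

/-! ### Power bounds near the tip of a vertical slit -/

/-- `k(c + u) = O(‖u‖ ^ (-b))` for small `u` off the upward vertical ray. -/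
def SlitBound (k : ℂ → ℂ) (c : ℂ) (b : ℝ) : Prop :=
  ∃ C r : ℝ, 0 < r ∧ ∀ u : ℂ, ‖u‖ < r → ¬(u.re = 0 ∧ 0 ≤ u.im) → ‖k (c + u)‖ ≤ C * ‖u‖ ^ (-b)

theorem SlitBound.exists_le_one {k : ℂ → ℂ} {c : ℂ} {b : ℝ} (h : SlitBound k c b) :
    ∃ C r : ℝ, 0 ≤ C ∧ 0 < r ∧ r ≤ 1 ∧
      ∀ u : ℂ, ‖u‖ < r → ¬(u.re = 0 ∧ 0 ≤ u.im) → ‖k (c + u)‖ ≤ C * ‖u‖ ^ (-b) := by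
  obtain ⟨C, r, hr, h⟩ := h
  refine ⟨max C 0, min r 1, le_max_right _ _, lt_min hr one_pos, min_le_right _ _, fun u hu hu' => ?_⟩
  refine (h u (hu.trans_le (min_le_left _ _)) hu').trans ?_
  gcongr
  exact le_max_left _ _

theorem SlitBound.mono {k : ℂ → ℂ} {c : ℂ} {b b' : ℝ} (h : SlitBound k c b) (hb : b ≤ b') :
    SlitBound k c b' := by
  obtain ⟨C, r, hC, hr, hr1, h⟩ := h.exists_le_one
  refine ⟨C, r, hr, fun u hu hu' => (h u hu hu').trans ?_⟩
  have hu0 : 0 < ‖u‖ := norm_pos_iff.2 fun h0 => hu' (by simp [h0])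
  gcongr C * ?_
  exact Real.rpow_le_rpow_of_exponent_ge hu0 (hu.le.trans hr1) (by linarith)

theorem SlitBound.congr {k k' : ℂ → ℂ} {c : ℂ} {b r : ℝ} (h : SlitBound k c b) (hr : 0 < r)
    (hk : ∀ u : ℂ, ‖u‖ < r → ¬(u.re = 0 ∧ 0 ≤ u.im) → k' (c + u) = k (c + u)) :
    SlitBound k' c b := by
  obtain ⟨C, r', hr', h⟩ := h
  refine ⟨C, min r' r, lt_min hr' hr, fun u hu hu' => ?_⟩
  rw [hk u (hu.trans_le (min_le_right _ _)) hu']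
  exact h u (hu.trans_le (min_le_left _ _)) hu'

/-- The map `w ↦ -I * exp w` sends the strip `|Im w| < π` into the plane slit along the upward ray.
It replaces the slit disc by a convex domain, where the mean value inequality applies. -/
theorem slit_neg_I_mul_exp {w : ℂ} (h1 : -Real.pi < w.im) (h2 : w.im < Real.pi) :
    ¬((-I * exp w).re = 0 ∧ 0 ≤ (-I * exp w).im) := by
  rintro ⟨hre, him⟩
  simp only [neg_mul, neg_re, neg_im, mul_re, mul_im, I_re, I_im, exp_re, exp_im, zero_mul, one_mul,
    zero_sub, neg_neg, zero_add] at hre him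
  have he := Real.exp_pos w.re
  have hs : Real.sin w.im = 0 := by
    rcases mul_eq_zero.1 hre with h | h
    · exact absurd h he.ne'
    · exact h
  have h0 : w.im = 0 := by
    rwa [Real.sin_eq_zero_iff_of_lt_of_lt h1 h2] at hs
  rw [h0, Real.cos_zero] at him
  linarith

/-- Integration gains one power, up to an arbitrarily small loss. In the coordinate `u = -I * exp w`
the derivative is `k₁ (c + u) * u = O(‖u‖ ^ (-(b - 1)))`, and the path from a fixed point to `w` has
length at most `log (ρ / ‖u‖) + π`, a logarithm which costs only `‖u‖ ^ (-ε)`. -/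
theorem SlitBound.of_hasDerivAt {k k₁ : ℂ → ℂ} {c : ℂ} {b b' r₀ : ℝ} (h : SlitBound k₁ c b)
    (hb : 1 ≤ b) (hbb' : b - 1 < b') (hr₀ : 0 < r₀)
    (hd : ∀ u : ℂ, ‖u‖ < r₀ → ¬(u.re = 0 ∧ 0 ≤ u.im) → HasDerivAt k (k₁ (c + u)) (c + u)) :
    SlitBound k c b' := by
  obtain ⟨C, r₁, hC, hr₁, hr₁1, h⟩ := h.exists_le_one
  set ρ := min r₁ r₀ / 2 with hρ
  have hρ0 : 0 < ρ := by positivity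
  have hρ1 : ρ < r₁ := by have := min_le_left r₁ r₀; linarith
  have hρ2 : ρ < r₀ := by have := min_le_right r₁ r₀; linarith
  set ε := b' - (b - 1) with hε
  have hε0 : 0 < ε := by linarith
  set K := ‖k (c + -I * exp (Real.log ρ))‖ with hK
  refine ⟨K + C * (1 / ε + Real.pi), ρ, hρ0, fun u hu hu' => ?_⟩
  have hu0 : u ≠ 0 := fun h0 => hu' (by simp [h0])
  have hun : 0 < ‖u‖ := norm_pos_iff.2 hu0
  have hIu : I * u ≠ 0 := mul_ne_zero I_ne_zero hu0
  -- The principal logarithm of `I * u` has its cut exactly where `u` is on the upward ray, whence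
  -- `|Im w| < π`.
  set w := log (I * u) with hw
  have hexp : -I * exp w = u := by
    rw [hw, exp_log hIu, ← mul_assoc, neg_mul, I_mul_I]
    simp
  have hwre : w.re = Real.log ‖u‖ := by rw [hw, log_re, norm_mul, norm_I, one_mul]
  have hwim1 : -Real.pi < w.im := neg_pi_lt_log_im _
  have hwim2 : w.im < Real.pi := by
    refine (log_im_le_pi _).lt_of_ne fun heq => hu' ?_
    rw [log_im, arg_eq_pi_iff] at heq
    simp only [mul_re, mul_im, I_re, I_im, zero_mul, one_mul, zero_sub, zero_add] at heq
    exact ⟨heq.2, by linarith [heq.1]⟩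
  set B : Set ℂ := {z | w.re ≤ z.re} ∩ {z | z.re ≤ Real.log ρ} ∩ ({z | -Real.pi < z.im} ∩
    {z | z.im < Real.pi}) with hB
  have hBconv : Convex ℝ B :=
    ((convex_halfSpace_ge reLm.isLinear _).inter (convex_halfSpace_le reLm.isLinear _)).inter
      ((convex_halfSpace_gt imLm.isLinear _).inter (convex_halfSpace_lt imLm.isLinear _))
  have hlog : w.re ≤ Real.log ρ := by
    rw [hwre]
    exact Real.log_le_log hun hu.le
  have hnorm : ∀ z : ℂ, ‖-I * exp z‖ = Real.exp z.re := fun z => by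
    rw [norm_mul, norm_neg, norm_I, one_mul, norm_exp]
  have hsmall : ∀ z ∈ B, ‖-I * exp z‖ ≤ ρ := by
    intro z hz
    rw [hnorm, ← Real.exp_log hρ0]
    exact Real.exp_le_exp.2 hz.1.2
  have hder : ∀ z ∈ B, HasDerivWithinAt (fun z => k (c + -I * exp z))
      (k₁ (c + -I * exp z) * (-I * exp z)) B z := by
    intro z hz
    have h1 := hd (-I * exp z) ((hsmall z hz).trans_lt hρ2) (slit_neg_I_mul_exp hz.2.1 hz.2.2)
    have h2 : HasDerivAt (fun z => c + -I * exp z) (-I * exp z) z :=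
      ((Complex.hasDerivAt_exp z).const_mul (-I)).const_add c
    exact (h1.comp z h2).hasDerivWithinAt
  -- Since `b ≥ 1`, the bound is worst at the smallest modulus in the rectangle, which is `‖u‖`.
  have hbound : ∀ z ∈ B, ‖k₁ (c + -I * exp z) * (-I * exp z)‖ ≤ C * ‖u‖ ^ (-(b - 1)) := by
    intro z hz
    have h1 := h (-I * exp z) ((hsmall z hz).trans_lt hρ1) (slit_neg_I_mul_exp hz.2.1 hz.2.2)
    have hz0 : 0 < ‖-I * exp z‖ := by rw [hnorm]; exact Real.exp_pos _
    have hle : ‖u‖ ≤ ‖-I * exp z‖ := by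
      rw [hnorm, ← Real.exp_log hun, ← hwre]
      exact Real.exp_le_exp.2 hz.1.1
    rw [norm_mul]
    calc _ ≤ C * ‖-I * exp z‖ ^ (-b) * ‖-I * exp z‖ := by gcongr
      _ = C * ‖-I * exp z‖ ^ (-(b - 1)) := by
        rw [mul_assoc, ← Real.rpow_add_one hz0.ne']
        ring_nf
      _ ≤ _ := by
        gcongr C * ?_
        exact Real.rpow_le_rpow_of_nonpos hun hle (by linarith)
  have hmem1 : ((Real.log ρ : ℝ) : ℂ) ∈ B := by
    refine ⟨⟨?_, ?_⟩, ?_, ?_⟩ <;> simp [hlog, Real.pi_pos]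
  have hmem2 : w ∈ B := ⟨⟨le_refl w.re, hlog⟩, hwim1, hwim2⟩
  have hmvt := hBconv.norm_image_sub_le_of_norm_hasDerivWithin_le hder hbound hmem1 hmem2
  rw [hexp] at hmvt
  have hdist : ‖w - (Real.log ρ : ℝ)‖ ≤ 1 / ε * ‖u‖ ^ (-ε) + Real.pi := by
    refine (norm_le_abs_re_add_abs_im _).trans ?_
    simp only [sub_re, ofReal_re, sub_im, ofReal_im, sub_zero]
    refine add_le_add ?_ (abs_le.2 ⟨hwim1.le, hwim2.le⟩)
    rw [abs_sub_comm, abs_of_nonneg (by linarith), hwre, ← Real.log_div hρ0.ne' hun.ne']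
    refine (Real.log_le_rpow_div (by positivity) hε0).trans ?_
    rw [Real.div_rpow hρ0.le hun.le, Real.rpow_neg hun.le, div_div, div_eq_mul_one_div,
      one_div_mul_eq_div, div_eq_mul_inv _ ε, ← one_div]
    have : ρ ^ ε ≤ 1 := Real.rpow_le_one hρ0.le (by linarith) hε0.le
    have hp : 0 < ‖u‖ ^ ε := Real.rpow_pos_of_pos hun _
    calc ρ ^ ε * (1 / (‖u‖ ^ ε * ε)) ≤ 1 * (1 / (‖u‖ ^ ε * ε)) := by gcongr
      _ = _ := by field_simp
  have hu1 : ‖u‖ ≤ 1 := by linarith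
  have hone : 1 ≤ ‖u‖ ^ (-ε) := Real.one_le_rpow_of_pos_of_le_one_of_nonpos hun hu1 (by linarith)
  have hone' : 1 ≤ ‖u‖ ^ (-b') := Real.one_le_rpow_of_pos_of_le_one_of_nonpos hun hu1 (by linarith)
  have hsplit : ‖u‖ ^ (-b') = ‖u‖ ^ (-(b - 1)) * ‖u‖ ^ (-ε) := by
    rw [← Real.rpow_add hun]
    congr 1
    rw [hε]
    ring
  have hpi := Real.pi_pos
  calc ‖k (c + u)‖ ≤ K + ‖k (c + u) - k (c + -I * exp (Real.log ρ))‖ := by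
        rw [hK]
        linarith [norm_le_insert' (k (c + u)) (k (c + -I * exp (Real.log ρ)))]
    _ ≤ K * ‖u‖ ^ (-b') + C * ‖u‖ ^ (-(b - 1)) * (1 / ε * ‖u‖ ^ (-ε) + Real.pi * ‖u‖ ^ (-ε)) := by
        refine add_le_add (le_mul_of_one_le_right (norm_nonneg _) hone') (hmvt.trans ?_)
        gcongr
        refine hdist.trans ?_
        gcongr
        exact le_mul_of_one_le_right hpi.le hone
    _ = _ := by
        rw [hsplit]
        ring

/-! ### Primitives of `o(e ^ (2 π s))` -/

/-- Comparison with `(ε / 2) e ^ (2 π s)`, whose derivative `ε π e ^ (2 π s)` exceeds the bound `ε e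
^ (2 π s)` on `g`. The initial value is absorbed by the other `ε / 2`. -/
theorem isLittleO_exp_of_hasDerivAt {D g : ℝ → ℂ} {s₀ : ℝ} (hD : ∀ s, s₀ < s → HasDerivAt D (g s) s)
    (hg : g =o[atTop] fun s => Real.exp (2 * Real.pi * s)) :
    D =o[atTop] fun s => Real.exp (2 * Real.pi * s) := by
  rw [Asymptotics.isLittleO_iff] at hg ⊢
  intro ε hε
  have hpi := Real.pi_gt_three
  obtain ⟨R, hR⟩ := eventually_atTop.1 (hg (c := ε) hε)
  set R' := max R (s₀ + 1)
  have hlim : Tendsto (fun s => ε / 2 * Real.exp (2 * Real.pi * s)) atTop atTop :=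
    (Real.tendsto_exp_atTop.comp (tendsto_id.const_mul_atTop (by positivity))).const_mul_atTop
      (by positivity)
  filter_upwards [eventually_ge_atTop R', hlim.eventually_ge_atTop ‖D R'‖] with s hs hs'
  have hpos : ∀ t, R' ≤ t → s₀ < t := fun t ht => by
    have := (le_max_right R (s₀ + 1)).trans ht
    linarith
  have hB : ∀ x, HasDerivAt (fun t => ‖D R'‖ + ε / 2 * (Real.exp (2 * Real.pi * t)
      - Real.exp (2 * Real.pi * R'))) (ε * Real.pi * Real.exp (2 * Real.pi * x)) x := by
    intro x
    have h := ((((hasDerivAt_id x).const_mul (2 * Real.pi)).exp.sub_const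
      (Real.exp (2 * Real.pi * R'))).const_mul (ε / 2)).const_add ‖D R'‖
    refine h.congr_deriv ?_
    simp
    ring
  have h := image_norm_le_of_norm_deriv_right_le_deriv_boundary (f := D) (f' := g) (a := R') (b := s)
    (fun t ht => (hD t (hpos t ht.1)).continuousAt.continuousWithinAt)
    (fun t ht => (hD t (hpos t ht.1)).hasDerivWithinAt)
    (B := fun t => ‖D R'‖ + ε / 2 * (Real.exp (2 * Real.pi * t) - Real.exp (2 * Real.pi * R')))
    (by simp) hB (fun t ht => by
      refine (hR t ((le_max_left _ _).trans ht.1)).trans ?_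
      rw [Real.norm_of_nonneg (Real.exp_pos _).le]
      gcongr
      nlinarith) ⟨hs, le_rfl⟩
  rw [Real.norm_of_nonneg (Real.exp_pos _).le]
  have := Real.exp_pos (2 * Real.pi * R')
  nlinarith

/-! ### The upper half of the cut strip -/

/-- The union of the upward vertical rays from the points of `Λ`. -/
def upCuts (Λ : Finset ℂ) : Set ℂ := {z | ∃ c ∈ Λ, z.re = c.re ∧ c.im ≤ z.im}

/-- The part of the open strip in the closed upper half plane, off the cuts. -/
def openUpper (Λ : Finset ℂ) : Set ℂ := {z | 0 < z.re ∧ z.re < 1 ∧ 0 ≤ z.im ∧ z ∉ upCuts Λ}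

/-- The part of the closed strip in the closed upper half plane, off the cuts. -/
def closedUpper (Λ : Finset ℂ) : Set ℂ := {z | 0 ≤ z.re ∧ z.re ≤ 1 ∧ 0 ≤ z.im ∧ z ∉ upCuts Λ}

/-- The assumptions on the upper half of the strip: `f` is the `M`-th derivative of `F`, with
controlled singularities and growth. -/
structure UpperStrip (f F : ℂ → ℂ) (Λ : Finset ℂ) (M : ℕ) : Prop where
  re_pos : ∀ c ∈ Λ, 0 < c.re
  re_lt : ∀ c ∈ Λ, c.re < 1
  im_pos : ∀ c ∈ Λ, 0 < c.im
  re_inj : ∀ c ∈ Λ, ∀ c' ∈ Λ, c.re = c'.re → c = c'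
  analyticAt_f : ∀ z ∈ closedUpper Λ, AnalyticAt ℂ f z
  analyticAt_F : ∀ z ∈ openUpper Λ, AnalyticAt ℂ F z
  iteratedDeriv_eq : ∀ z ∈ openUpper Λ, iteratedDeriv M F z = f z
  growth : ∀ ε : ℝ, 0 < ε → ∃ R : ℝ, ∀ z ∈ closedUpper Λ, R ≤ z.im →
    ‖f z‖ ≤ ε * Real.exp (2 * Real.pi * z.im)
  sideExt : ∀ c ∈ Λ, ∀ s : ℝ, 0 < s → ∃ gL gR, IsSideExt f gL gR (c + s * I)
  slitBound : ∀ c ∈ Λ, ∃ b : ℝ, b < M + 1 ∧ SlitBound f c b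
  integrable : ∀ c ∈ Λ, IntegrableOn
    (fun s : ℝ => variation f c (s * I) * exp (-(2 * Real.pi * s))) (Set.Ioi 1)

theorem intervalIntegrable_abs_sub_rpow {r : ℝ} (hr : -1 < r) (a x y : ℝ) :
    IntervalIntegrable (fun t : ℝ => |t - a| ^ r) volume x y := by
  have h0 : ∀ z : ℝ, IntervalIntegrable (fun t : ℝ => |t| ^ r) volume 0 z := by
    have hpos : ∀ z : ℝ, 0 ≤ z → IntervalIntegrable (fun t : ℝ => |t| ^ r) volume 0 z := by
      intro z hz
      refine (intervalIntegral.intervalIntegrable_rpow' (a := 0) (b := z) hr).congr fun t ht => ?_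
      rw [Set.uIoc_of_le hz] at ht
      rw [abs_of_pos ht.1]
    intro z
    rcases le_total 0 z with hz | hz
    · exact hpos z hz
    · have h := (hpos (-z) (by linarith)).comp_mul_left (c := -1)
      simpa using h
  have h := ((h0 (x - a)).symm.trans (h0 (y - a))).comp_sub_right a
  simpa using h

namespace UpperStrip

variable {f F : ℂ → ℂ} {Λ : Finset ℂ} {M : ℕ}

/-- As real parts are distinct, the other cuts stay at a positive horizontal distance; only the line
through `c` itself has to be avoided. -/
theorem eventually_mem_openUpper (h : UpperStrip f F Λ M) {c w : ℂ} (hc : c ∈ Λ) (hw : w.re = c.re)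
    (hw' : 0 < w.im) : ∀ᶠ z in 𝓝 w, z.re ≠ c.re → z ∈ openUpper Λ := by
  have hcont := continuous_re.continuousAt (x := w)
  have hother : ∀ᶠ z in 𝓝 w, ∀ c' ∈ Λ, c' ≠ c → z.re ≠ c'.re := by
    refine (Finset.eventually_all Λ).2 fun c' hc' => ?_
    by_cases hcc : c' = c
    · exact Eventually.of_forall fun _ hne => absurd hcc hne
    · have : w.re ≠ c'.re := fun heq => hcc (h.re_inj c' hc' c hc (by rw [← heq, hw]))
      exact (hcont.eventually_ne this).mono fun z hz _ => hz
  filter_upwards [hother, hcont.eventually (lt_mem_nhds (hw ▸ h.re_pos c hc)),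
    hcont.eventually (gt_mem_nhds (hw ▸ h.re_lt c hc)),
    continuous_im.continuousAt.eventually (lt_mem_nhds hw')] with z h1 h2 h3 h4 hne
  refine ⟨h2, h3, h4.le, ?_⟩
  rintro ⟨c', hc', hre, -⟩
  by_cases hcc : c' = c
  · exact hne (hcc ▸ hre)
  · exact h1 c' hc' hcc hre

theorem openUpper_subset : openUpper Λ ⊆ closedUpper Λ := fun _ hz =>
  ⟨hz.1.le, hz.2.1.le, hz.2.2.1, hz.2.2.2⟩

theorem hasDerivAt (h : UpperStrip f F Λ M) (j : ℕ) {z : ℂ} (hz : z ∈ openUpper Λ) :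
    HasDerivAt (iteratedDeriv j F) (iteratedDeriv (j + 1) F z) z := by
  have := ((h.analyticAt_F z hz).iterated_deriv j).differentiableAt
  rw [← iteratedDeriv_eq_iterate] at this
  rw [iteratedDeriv_succ]
  exact this.hasDerivAt

section cut

variable (h : UpperStrip f F Λ M) {c : ℂ} (hc : c ∈ Λ)
include h hc

theorem eventually_mem_openUpper_cut {s : ℝ} (hs : 0 < s) :
    ∀ᶠ z in 𝓝 (c + s * I), z.re ≠ c.re → z ∈ openUpper Λ :=
  h.eventually_mem_openUpper hc (by simp) (by simpa using add_pos (h.im_pos c hc) hs)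

/-- Descending induction from `F ^ (M) = f`, each lower derivative being a primitive of the next
one. -/
theorem exists_isSideExt {j : ℕ} (hj : j ≤ M) {s : ℝ} (hs : 0 < s) :
    ∃ gL gR, IsSideExt (iteratedDeriv j F) gL gR (c + s * I) := by
  have hev := h.eventually_mem_openUpper_cut hc hs
  induction hj using Nat.decreasingInduction with
  | self =>
    obtain ⟨gL, gR, hg⟩ := h.sideExt c hc s hs
    refine ⟨gL, gR, hg.congr ?_⟩
    filter_upwards [hev] with z hz hne
    exact h.iteratedDeriv_eq z (hz (by simpa using hne))
  | of_succ j hj ih =>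
    obtain ⟨gL, gR, hg⟩ := ih
    refine hg.exists_of_deriv ?_
    filter_upwards [hev] with z hz hne
    exact h.hasDerivAt j (hz (by simpa using hne))

theorem variation_iteratedDeriv {s : ℝ} (hs : 0 < s) :
    variation (iteratedDeriv M F) c (s * I) = variation f c (s * I) := by
  obtain ⟨gL, gR, hg⟩ := h.sideExt c hc s hs
  rw [hg.variation_eq hs]
  refine IsSideExt.variation_eq hs (hg.congr ?_)
  filter_upwards [h.eventually_mem_openUpper_cut hc hs] with z hz hne
  exact h.iteratedDeriv_eq z (hz (by simpa using hne))

theorem continuousAt_variation {j : ℕ} (hj : j ≤ M) {s : ℝ} (hs : 0 < s) :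
    ContinuousAt (fun s : ℝ => variation (iteratedDeriv j F) c (s * I)) s := by
  obtain ⟨gL, gR, hg⟩ := h.exists_isSideExt hc hj hs
  have hcont : ContinuousAt (fun t : ℝ => c + t * I) s := by fun_prop
  refine ((hg.2.1.continuousAt.comp (f := fun t : ℝ => c + t * I) hcont).sub
    (hg.1.continuousAt.comp (f := fun t : ℝ => c + t * I) hcont)).congr_of_eventuallyEq ?_
  filter_upwards [hg.eventually_vertical, lt_mem_nhds hs] with t ht ht0
  exact ht.variation_eq ht0

theorem hasDerivAt_variation {j : ℕ} (hj : j < M) {s : ℝ} (hs : 0 < s) :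
    HasDerivAt (fun s : ℝ => variation (iteratedDeriv j F) c (s * I))
      (I * variation (iteratedDeriv (j + 1) F) c (s * I)) s := by
  obtain ⟨gL, gR, hg⟩ := h.exists_isSideExt hc hj.le hs
  refine hg.hasDerivAt_variation hs ?_
  filter_upwards [h.eventually_mem_openUpper_cut hc hs] with z hz hne
  exact h.hasDerivAt j (hz hne)

/-- For `j = M` the growth of `f` passes to the one-sided limits. Below, each variation is a
primitive of the next one up to the factor `I`, and primitives preserve the little-o. -/
theorem isLittleO_variation {j : ℕ} (hj : j ≤ M) :
    (fun s : ℝ => variation (iteratedDeriv j F) c (s * I)) =o[atTop]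
      fun s => Real.exp (2 * Real.pi * s) := by
  induction hj using Nat.decreasingInduction with
  | self =>
    rw [Asymptotics.isLittleO_iff]
    intro ε hε
    -- The `2` accounts for the two sides of the cut, the exponential for heights measured from `c`
    -- rather than from the real axis.
    have hpos : 0 < ε / (2 * Real.exp (2 * Real.pi * c.im)) := by positivity
    obtain ⟨R, hR⟩ := h.growth _ hpos
    filter_upwards [eventually_ge_atTop R, eventually_gt_atTop 0] with s hsR hs
    obtain ⟨gL, gR, hg⟩ := h.sideExt c hc s hs
    rw [h.variation_iteratedDeriv hc hs]
    refine le_of_tendsto (hg.tendsto_variation hs).norm ?_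
    have hev := h.eventually_mem_openUpper_cut hc hs
    have hR' : Tendsto (fun δ : ℝ => c + s * I + δ) (𝓝[>] 0) (𝓝 (c + s * I)) := by
      have : ContinuousAt (fun δ : ℝ => c + s * I + δ) 0 := by fun_prop
      simpa [ContinuousAt] using this.mono_left nhdsWithin_le_nhds
    have hL' : Tendsto (fun δ : ℝ => c + s * I - δ) (𝓝[>] 0) (𝓝 (c + s * I)) := by
      have : ContinuousAt (fun δ : ℝ => c + s * I - δ) 0 := by fun_prop
      simpa [ContinuousAt] using this.mono_left nhdsWithin_le_nhds
    filter_upwards [hR'.eventually hev, hL'.eventually hev, self_mem_nhdsWithin] with δ h1 h2 hδ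
    have hδ' : δ ≠ 0 := (Set.mem_Ioi.1 hδ).ne'
    have hbd : ∀ z ∈ openUpper Λ, z.im = c.im + s →
        ‖f z‖ ≤ ε / 2 * Real.exp (2 * Real.pi * s) := by
      intro z hz him
      refine (hR z (openUpper_subset hz) (by rw [him]; linarith [h.im_pos c hc])).trans (le_of_eq ?_)
      rw [him, mul_add, Real.exp_add]
      field_simp
    have b1 := hbd _ (h1 (by simpa using hδ')) (by simp)
    have b2 := hbd _ (h2 (by simpa using hδ')) (by simp)
    rw [Real.norm_of_nonneg (Real.exp_pos _).le]
    refine (norm_sub_le _ _).trans ?_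
    linarith
  | of_succ j hj ih =>
    refine isLittleO_exp_of_hasDerivAt (s₀ := 0) (fun s hs => h.hasDerivAt_variation hc hj hs) ?_
    exact ih.const_mul_left I

/-- The strict inequality `b < j + 1` survives each integration from `j + 1` down to `j`, since the
loss can be taken as small as needed. At `j = 0` it says that `F` is integrable at the tip along a
vertical line. -/
theorem exists_slitBound : ∃ b : ℝ, 0 ≤ b ∧ b < 1 ∧ SlitBound F c b := by
  have hcim := h.im_pos c hc
  obtain ⟨r, hr, hball⟩ := Metric.eventually_nhds_iff_ball.1
    (h.eventually_mem_openUpper hc rfl hcim)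
  have hslit : ∀ u : ℂ, ‖u‖ < min r (min c.im (min c.re (1 - c.re))) →
      ¬(u.re = 0 ∧ 0 ≤ u.im) → c + u ∈ openUpper Λ := by
    intro u hu hu'
    have hur : ‖u‖ < r := hu.trans_le (min_le_left _ _)
    by_cases hre : u.re = 0
    · have him : u.im < 0 := not_le.1 fun hle => hu' ⟨hre, hle⟩
      have h1 : ‖u‖ < c.im := hu.trans_le ((min_le_right _ _).trans (min_le_left _ _))
      have h2 := (abs_le.1 (abs_im_le_norm u)).1
      refine ⟨by simpa [hre] using h.re_pos c hc, by simpa [hre] using h.re_lt c hc,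
        by simp only [add_im]; linarith, ?_⟩
      rintro ⟨c', hc', e1, e2⟩
      simp only [add_re, hre, add_zero] at e1
      rw [← h.re_inj c hc c' hc' e1, add_im] at e2
      linarith
    · exact hball (c + u) (by simpa [dist_eq_norm] using hur) (by simpa using hre)
  set r' := min r (min c.im (min c.re (1 - c.re))) with hr'
  have hr'0 : 0 < r' := lt_min hr (lt_min hcim (lt_min (h.re_pos c hc) (by linarith [h.re_lt c hc])))
  have key : ∀ j ≤ M, ∃ b : ℝ, b < j + 1 ∧ SlitBound (iteratedDeriv j F) c b := by
    intro j hj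
    induction hj using Nat.decreasingInduction with
    | self =>
      obtain ⟨b, hb, hbd⟩ := h.slitBound c hc
      exact ⟨b, hb, hbd.congr hr'0 fun u hu hu' => h.iteratedDeriv_eq _ (hslit u hu hu')⟩
    | of_succ j hj ih =>
      obtain ⟨b, hb, hbd⟩ := ih
      push_cast at hb
      -- The exponent is first raised to at least `1`, as `SlitBound.of_hasDerivAt` requires.
      have hb1 : max b 1 < j + 1 + 1 := max_lt hb (by linarith [(Nat.cast_nonneg j : (0 : ℝ) ≤ j)])
      obtain ⟨b', h1, h2⟩ := exists_between (show max b 1 - 1 < j + 1 by linarith)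
      exact ⟨b', h2, (hbd.mono (le_max_left b 1)).of_hasDerivAt (le_max_right b 1) h1 hr'0
        fun u hu hu' => h.hasDerivAt j (hslit u hu hu')⟩
  obtain ⟨b, hb, hbd⟩ := key 0 (Nat.zero_le M)
  rw [iteratedDeriv_zero] at hbd
  exact ⟨max b 0, le_max_right _ _, max_lt (by simpa using hb) one_pos, hbd.mono (le_max_left _ _)⟩

theorem variation_le_of_slitBound {b C r : ℝ}
    (hbd : ∀ u : ℂ, ‖u‖ < r → ¬(u.re = 0 ∧ 0 ≤ u.im) → ‖F (c + u)‖ ≤ C * ‖u‖ ^ (-b)) {s : ℝ}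
    (hs : 0 < s) (hsr : s < r) : ‖variation F c (s * I)‖ ≤ 2 * C * s ^ (-b) := by
  obtain ⟨gL, gR, hg⟩ := h.exists_isSideExt hc (Nat.zero_le M) hs
  rw [iteratedDeriv_zero] at hg
  have hcont : ∀ σ : ℂ, Tendsto (fun δ : ℝ => s * I + σ * δ) (𝓝[>] 0) (𝓝 (s * I)) := by
    intro σ
    have : ContinuousAt (fun δ : ℝ => s * I + σ * δ) 0 := by fun_prop
    simpa [ContinuousAt] using this.mono_left nhdsWithin_le_nhds
  have hn : ‖(s * I : ℂ)‖ = s := by simp [abs_of_pos hs]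
  have hlim : ∀ σ : ℂ, Tendsto (fun δ : ℝ => C * ‖s * I + σ * δ‖ ^ (-b)) (𝓝[>] 0)
      (𝓝 (C * s ^ (-b))) := by
    intro σ
    have := ((hcont σ).norm.rpow_const (p := -b) (Or.inl (by rw [hn]; exact hs.ne'))).const_mul C
    rwa [hn] at this
  have hsmall : ∀ σ : ℂ, ∀ᶠ δ : ℝ in 𝓝[>] 0, ‖s * I + σ * δ‖ < r := by
    intro σ
    have := (hcont σ).norm
    rw [hn] at this
    exact this.eventually (gt_mem_nhds hsr)
  have hsum := (hlim 1).add (hlim (-1))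
  rw [← two_mul, ← mul_assoc] at hsum
  refine le_of_tendsto_of_tendsto (hg.tendsto_variation hs).norm hsum ?_
  filter_upwards [hsmall 1, hsmall (-1), self_mem_nhdsWithin] with δ h1 h2 hδ
  have hδ' : δ ≠ 0 := (Set.mem_Ioi.1 hδ).ne'
  have b1 := hbd _ h1 (by simp [hδ'])
  have b2 := hbd _ h2 (by simp [hδ'])
  have e1 : c + (s * I + 1 * δ) = c + s * I + δ := by ring
  have e2 : c + (s * I + -1 * δ) = c + s * I - δ := by ring
  rw [e1] at b1
  rw [e2] at b2
  exact (norm_sub_le _ _).trans (add_le_add b1 b2)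

theorem intervalIntegrable_variation (P : ℝ) (hP : 0 < P) :
    IntervalIntegrable (fun s : ℝ => variation F c (s * I)) volume 0 P := by
  obtain ⟨b, hb0, hb1, hsb⟩ := h.exists_slitBound hc
  obtain ⟨C, r, hC, hr, -, hbd⟩ := hsb.exists_le_one
  have hcont : ContinuousOn (fun s : ℝ => variation F c (s * I)) (Set.Ioi 0) := fun s hs => by
    have := h.continuousAt_variation hc (Nat.zero_le M) hs
    rw [iteratedDeriv_zero] at this
    exact this.continuousWithinAt
  set q := min (r / 2) P with hq
  have hq0 : 0 < q := lt_min (by linarith) hP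
  have hqP : q ≤ P := min_le_right _ _
  have hqr : q < r := (min_le_left _ _).trans_lt (by linarith)
  have h1 : IntervalIntegrable (fun s : ℝ => variation F c (s * I)) volume 0 q := by
    have hdom := (intervalIntegral.intervalIntegrable_rpow' (a := 0) (b := q)
      (by linarith : -1 < -b)).const_mul (2 * C)
    refine hdom.mono_fun ?_ ?_
    · refine (hcont.mono ?_).aestronglyMeasurable measurableSet_uIoc
      rw [Set.uIoc_of_le hq0.le]
      exact fun s hs => hs.1
    · refine (ae_restrict_iff' measurableSet_uIoc).2 (Eventually.of_forall fun s hs => ?_)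
      rw [Set.uIoc_of_le hq0.le] at hs
      exact (h.variation_le_of_slitBound hc hbd hs.1 (hs.2.trans_lt hqr)).trans (le_abs_self _)
  refine h1.trans (hcont.mono fun s hs => ?_).intervalIntegrable
  rw [Set.uIcc_of_le hqP] at hs
  exact hq0.trans_le hs.1

end cut

end UpperStrip

/-! ### Jumps of vertical integrals -/

/-- `∫ k(z) e ^ (κ z) dz` along the vertical segment from `x` to `x + i T`. -/
def vertInt (k : ℂ → ℂ) (κ : ℂ) (T x : ℝ) : ℂ :=
  I * ∫ t in (0 : ℝ)..T, k (x + t * I) * exp (κ * (x + t * I))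

/-- The jump across the cut at `c` of the integral of `F ^ (j) e ^ (κ z)` along a vertical segment
which ends at height `S` above `c`. -/
def jumpInt (F : ℂ → ℂ) (c κ : ℂ) : ℕ → ℝ → ℂ
  | 0, S => I * ∫ s in (0 : ℝ)..S, variation F c (s * I) * exp (κ * (c + s * I))
  | j + 1, S => variation (iteratedDeriv j F) c (S * I) * exp (κ * (c + S * I)) -
      κ * jumpInt F c κ j S

namespace UpperStrip

variable {f F : ℂ → ℂ} {Λ : Finset ℂ} {M : ℕ}

theorem mem_openUpper_of_re_ne {x t : ℝ} (hx : 0 < x) (hx' : x < 1) (ht : 0 ≤ t)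
    (hne : ∀ c ∈ Λ, c.re ≠ x) : (x + t * I : ℂ) ∈ openUpper Λ := by
  refine ⟨by simpa using hx, by simpa using hx', by simpa using ht, ?_⟩
  rintro ⟨c, hc, hre, -⟩
  exact hne c hc (by simpa using hre.symm)

/-- Integration by parts along the segment. The recursion is that of `jumpInt`, except for the
boundary term on the real axis, which has no jump because the cuts do not reach the axis. -/
theorem vertInt_iteratedDeriv_succ (h : UpperStrip f F Λ M) (j : ℕ) (κ : ℂ) {x T : ℝ} (hx : 0 < x)
    (hx' : x < 1) (hT : 0 ≤ T) (hne : ∀ c ∈ Λ, c.re ≠ x) :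
    vertInt (iteratedDeriv (j + 1) F) κ T x =
      iteratedDeriv j F (x + T * I) * exp (κ * (x + T * I)) - iteratedDeriv j F x * exp (κ * x) -
        κ * vertInt (iteratedDeriv j F) κ T x := by
  have hmem : ∀ t ∈ Set.uIcc 0 T, (x + t * I : ℂ) ∈ openUpper Λ := by
    intro t ht
    rw [Set.uIcc_of_le hT] at ht
    exact mem_openUpper_of_re_ne hx hx' ht.1 hne
  have hline : ∀ t : ℝ, HasDerivAt (fun t : ℝ => (x + t * I : ℂ)) I t := by
    intro t
    simpa using ((hasDerivAt_id t).ofReal_comp.mul_const I).const_add (x : ℂ)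
  have hE : ∀ t : ℝ, HasDerivAt (fun t : ℝ => exp (κ * (x + t * I)))
      (κ * I * exp (κ * (x + t * I))) t := by
    intro t
    refine ((hline t).const_mul κ).cexp.congr_deriv ?_
    ring
  have hk : ∀ i, ∀ t ∈ Set.uIcc 0 T, HasDerivAt (fun t : ℝ => iteratedDeriv i F (x + t * I))
      (iteratedDeriv (i + 1) F (x + t * I) * I) t := fun i t ht =>
    HasDerivAt.comp (h₂ := iteratedDeriv i F) t (h.hasDerivAt i (hmem t ht)) (hline t)
  have hcont : ∀ i, ContinuousOn (fun t : ℝ => iteratedDeriv i F (x + t * I)) (Set.uIcc 0 T) :=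
    fun i t ht => (hk i t ht).continuousAt.continuousWithinAt
  have hi : ∀ i, IntervalIntegrable
      (fun t : ℝ => iteratedDeriv i F (x + t * I) * exp (κ * (x + t * I))) volume 0 T :=
    fun i => ((hcont i).mul (Continuous.continuousOn (by fun_prop))).intervalIntegrable
  have hint := intervalIntegral.integral_eq_sub_of_hasDerivAt
    (fun t ht => ((hk j t ht).mul (hE t)).congr_deriv
      (show _ = I * (iteratedDeriv (j + 1) F (x + t * I) * exp (κ * (x + t * I))) +
        κ * I * (iteratedDeriv j F (x + t * I) * exp (κ * (x + t * I))) by ring))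
    (((hi (j + 1)).const_mul I).add ((hi j).const_mul (κ * I)))
  rw [intervalIntegral.integral_add ((hi (j + 1)).const_mul I) ((hi j).const_mul (κ * I)),
    intervalIntegral.integral_const_mul, intervalIntegral.integral_const_mul] at hint
  simp only [Pi.mul_apply, ofReal_zero, zero_mul, add_zero] at hint
  rw [vertInt, vertInt]
  linear_combination hint

section cut

variable (h : UpperStrip f F Λ M) {c : ℂ} (hc : c ∈ Λ)
include h hc

/-- This dominates the vertical integrals near the cut, uniformly in `δ`. By compactness it is a
local question: below the tip `F` is analytic, above it the one-sided extensions are bounded, and at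
the tip the slit bound applies with `‖z - c‖ ≥ |Im (z - c)|`. -/
theorem exists_bound_near_line {b : ℝ} (hb0 : 0 ≤ b) (hsb : SlitBound F c b) (T : ℝ) :
    ∃ C δ₀ : ℝ, 0 < δ₀ ∧ ∀ t ∈ Set.Icc 0 T, t ≠ c.im → ∀ δ : ℝ, δ ≠ 0 → |δ| < δ₀ →
      ‖F (c.re + δ + t * I)‖ ≤ C * (1 + |t - c.im| ^ (-b)) := by
  have hnn : ∀ t : ℝ, 0 ≤ |t - c.im| ^ (-b) := fun t => by positivity
  have hcim := h.im_pos c hc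
  suffices hloc : ∀ t ∈ Set.Icc (0 : ℝ) T, ∃ C : ℝ, ∀ᶠ z in 𝓝 (c.re + t * I : ℂ), z.re ≠ c.re →
      z.im ≠ c.im → ‖F z‖ ≤ C * (1 + |z.im - c.im| ^ (-b)) by
    refine (isCompact_Icc (a := (0 : ℝ)) (b := T)).induction_on
      (p := fun s => ∃ C δ₀ : ℝ, 0 < δ₀ ∧ ∀ t ∈ s, t ≠ c.im → ∀ δ : ℝ, δ ≠ 0 → |δ| < δ₀ →
      ‖F (c.re + δ + t * I)‖ ≤ C * (1 + |t - c.im| ^ (-b))) ?_ ?_ ?_ ?_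
    · exact ⟨0, 1, one_pos, by simp⟩
    · rintro s t hst ⟨C, δ₀, hδ₀, H⟩
      exact ⟨C, δ₀, hδ₀, fun u hu => H u (hst hu)⟩
    · rintro s t ⟨C, δ₀, hδ₀, H⟩ ⟨C', δ₀', hδ₀', H'⟩
      refine ⟨max C C', min δ₀ δ₀', lt_min hδ₀ hδ₀', fun u hu hne δ hδ hδlt => ?_⟩
      have := hnn u
      rcases hu with hu | hu
      · refine (H u hu hne δ hδ (hδlt.trans_le (min_le_left _ _))).trans ?_
        gcongr
        exact le_max_left _ _
      · refine (H' u hu hne δ hδ (hδlt.trans_le (min_le_right _ _))).trans ?_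
        gcongr
        exact le_max_right _ _
    · intro t ht
      obtain ⟨C, hC⟩ := hloc t ht
      obtain ⟨ρ, hρ, hball⟩ := Metric.eventually_nhds_iff_ball.1 hC
      refine ⟨Metric.ball t (ρ / 2), mem_nhdsWithin_of_mem_nhds (Metric.ball_mem_nhds _ (by linarith)),
        C, ρ / 2, by linarith, fun u hu hne δ hδ hδlt => ?_⟩
      have hm : (c.re + δ + u * I : ℂ) ∈ Metric.ball (c.re + t * I : ℂ) ρ := by
        rw [Metric.mem_ball, dist_eq_norm] at hu ⊢
        have e : (c.re + δ + u * I - (c.re + t * I) : ℂ) = (δ : ℝ) + ((u - t : ℝ) : ℂ) * I := by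
          push_cast
          ring
        rw [e]
        refine (norm_add_le _ _).trans_lt ?_
        rw [norm_mul, norm_I, mul_one, norm_real, norm_real, Real.norm_eq_abs, Real.norm_eq_abs]
        rw [Real.norm_eq_abs] at hu
        linarith
      have := hball _ hm (by simpa using hδ) (by simpa using hne)
      simpa using this
  intro t ht
  rcases lt_trichotomy t c.im with hlt | heq | hgt
  · have hmem : (c.re + t * I : ℂ) ∈ openUpper Λ := by
      refine ⟨by simpa using h.re_pos c hc, by simpa using h.re_lt c hc, by simpa using ht.1, ?_⟩
      rintro ⟨c', hc', hre, him⟩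
      rw [h.re_inj c hc c' hc' (by simpa using hre)] at hlt
      simp at him
      linarith
    refine ⟨‖F (c.re + t * I)‖ + 1, ?_⟩
    filter_upwards [(h.analyticAt_F _ hmem).continuousAt.norm.eventually
      (eventually_le_nhds (lt_add_one _))] with z hz _ _
    refine hz.trans (le_mul_of_one_le_right (by positivity) ?_)
    linarith [hnn z.im]
  · obtain ⟨C, r, hC, hr, -, hbd⟩ := hsb.exists_le_one
    refine ⟨C, ?_⟩
    have hcc : (c.re + t * I : ℂ) = c := by rw [heq, re_add_im]
    rw [hcc]
    filter_upwards [Metric.ball_mem_nhds c hr] with z hz hne him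
    rw [Metric.mem_ball, dist_eq_norm] at hz
    have h1 := hbd (z - c) hz (by simp [sub_eq_zero, hne])
    rw [add_sub_cancel] at h1
    refine h1.trans ?_
    have habs : 0 < |z.im - c.im| := abs_pos.2 (sub_ne_zero.2 him)
    have h2 : ‖z - c‖ ^ (-b) ≤ |z.im - c.im| ^ (-b) :=
      Real.rpow_le_rpow_of_nonpos habs (by simpa using abs_im_le_norm (z - c)) (by linarith)
    gcongr
    linarith
  · have e : (c.re + t * I : ℂ) = c + ((t - c.im : ℝ) : ℂ) * I := by
      apply Complex.ext <;> simp
    obtain ⟨gL, gR, hg⟩ := h.exists_isSideExt hc (Nat.zero_le M) (sub_pos.2 hgt)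
    rw [iteratedDeriv_zero] at hg
    obtain ⟨C, hC⟩ := hg.exists_bound
    refine ⟨max C 0, ?_⟩
    rw [e]
    filter_upwards [hC] with z hz hne _
    refine (hz (by simpa using hne)).trans ((le_max_left C 0).trans
      (le_mul_of_one_le_right (le_max_right _ _) ?_))
    linarith [hnn z.im]

theorem eventually_ne_re : ∀ᶠ δ : ℝ in 𝓝[>] 0,
    (∀ c' ∈ Λ, c'.re ≠ c.re + δ) ∧ (∀ c' ∈ Λ, c'.re ≠ c.re - δ) ∧
      0 < c.re - δ ∧ c.re + δ < 1 := by
  have hR : Tendsto (fun δ : ℝ => c.re + δ) (𝓝[>] 0) (𝓝 c.re) := by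
    have : ContinuousAt (fun δ : ℝ => c.re + δ) 0 := by fun_prop
    simpa [ContinuousAt] using this.mono_left nhdsWithin_le_nhds
  have hL : Tendsto (fun δ : ℝ => c.re - δ) (𝓝[>] 0) (𝓝 c.re) := by
    have : ContinuousAt (fun δ : ℝ => c.re - δ) 0 := by fun_prop
    simpa [ContinuousAt] using this.mono_left nhdsWithin_le_nhds
  refine Eventually.and ?_ (Eventually.and ?_ (Eventually.and ?_ ?_))
  · refine (Finset.eventually_all Λ).2 fun c' hc' => ?_
    by_cases hcc : c' = c
    · subst hcc
      filter_upwards [self_mem_nhdsWithin] with δ hδ heq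
      have := Set.mem_Ioi.1 hδ
      linarith
    · exact (hR.eventually_ne fun heq => hcc (h.re_inj c' hc' c hc heq.symm)).mono
        fun δ hδ => hδ.symm
  · refine (Finset.eventually_all Λ).2 fun c' hc' => ?_
    by_cases hcc : c' = c
    · subst hcc
      filter_upwards [self_mem_nhdsWithin] with δ hδ heq
      have := Set.mem_Ioi.1 hδ
      linarith
    · exact (hL.eventually_ne fun heq => hcc (h.re_inj c' hc' c hc heq.symm)).mono
        fun δ hδ => hδ.symm
  · exact hL.eventually (lt_mem_nhds (h.re_pos c hc))
  · exact hR.eventually (gt_mem_nhds (h.re_lt c hc))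

/-- Dominated convergence, the majorant being integrable because `b < 1`. The difference of the two
integrands tends to `0` below the tip and to the variation above it. -/
theorem tendsto_vertInt_jump_zero (κ : ℂ) {S : ℝ} (hS : 0 < S) :
    Tendsto (fun δ : ℝ => vertInt F κ (c.im + S) (c.re + δ) - vertInt F κ (c.im + S) (c.re - δ))
      (𝓝[>] 0) (𝓝 (jumpInt F c κ 0 S)) := by
  have hcim := h.im_pos c hc
  obtain ⟨b, hb0, hb1, hsb⟩ := h.exists_slitBound hc
  set T := c.im + S with hT
  have hT0 : 0 ≤ T := by linarith
  obtain ⟨C, δ₀, hδ₀, hbd⟩ := h.exists_bound_near_line hc hb0 hsb T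
  set K : ℝ → ℝ → ℂ := fun x t => F (x + t * I) * exp (κ * (x + t * I)) with hK
  have hcontK : ∀ x, 0 < x → x < 1 → (∀ c' ∈ Λ, c'.re ≠ x) → ContinuousOn (K x) (Set.uIcc 0 T) := by
    intro x hx hx' hne t ht
    rw [Set.uIcc_of_le hT0] at ht
    have h1 := (h.analyticAt_F _ (mem_openUpper_of_re_ne hx hx' ht.1 hne)).continuousAt
    have h2 : ContinuousAt (fun t : ℝ => (x + t * I : ℂ)) t := by fun_prop
    have h3 : ContinuousAt (fun t : ℝ => exp (κ * (x + t * I))) t := by fun_prop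
    exact ((h1.comp (f := fun t : ℝ => (x + t * I : ℂ)) h2).mul h3).continuousWithinAt
  obtain ⟨B, hB⟩ := ((isCompact_Icc (a := (0 : ℝ)) (b := 1)).prod
    (isCompact_Icc (a := (0 : ℝ)) (b := T))).exists_bound_of_continuousOn
    (f := fun p : ℝ × ℝ => exp (κ * (p.1 + p.2 * I))) (Continuous.continuousOn (by fun_prop))
  have hev := h.eventually_ne_re hc
  set G : ℝ → ℂ := fun t => if t ≤ c.im then 0 else
    variation F c ((t - c.im : ℝ) * I) * exp (κ * (c + (t - c.im : ℝ) * I)) with hG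
  have hlim : Tendsto (fun δ : ℝ => ∫ t in (0 : ℝ)..T, (K (c.re + δ) t - K (c.re - δ) t)) (𝓝[>] 0)
      (𝓝 (∫ t in (0 : ℝ)..T, G t)) := by
    refine intervalIntegral.tendsto_integral_filter_of_dominated_convergence
      (fun t => 2 * (C * (1 + |t - c.im| ^ (-b)) * B)) ?_ ?_ ?_ ?_
    · filter_upwards [hev, self_mem_nhdsWithin] with δ ⟨h1, h2, h3, h4⟩ hδ
      have hδ := Set.mem_Ioi.1 hδ
      refine (((hcontK _ (by linarith) h4 h1).sub (hcontK _ h3 (by linarith) h2)).mono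
        Set.uIoc_subset_uIcc).aestronglyMeasurable measurableSet_uIoc
    · filter_upwards [hev, self_mem_nhdsWithin, nhdsWithin_le_nhds (gt_mem_nhds hδ₀)] with
        δ ⟨h1, h2, h3, h4⟩ hδ hδlt
      have hδ := Set.mem_Ioi.1 hδ
      filter_upwards [(measure_eq_zero_iff_ae_notMem.1 (measure_singleton c.im) :
        ∀ᵐ t : ℝ, t ∉ ({c.im} : Set ℝ))] with t htne ht
      rw [Set.uIoc_of_le hT0] at ht
      have ht' : t ∈ Set.Icc 0 T := ⟨ht.1.le, ht.2⟩
      have b1 := hbd t ht' htne δ hδ.ne' (by rwa [abs_of_pos hδ])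
      have b2 := hbd t ht' htne (-δ) (neg_ne_zero.2 hδ.ne') (by rwa [abs_neg, abs_of_pos hδ])
      have e1 := hB (c.re + δ, t) ⟨⟨by linarith, h4.le⟩, ht'⟩
      have e2 := hB (c.re - δ, t) ⟨⟨h3.le, by linarith⟩, ht'⟩
      refine (norm_sub_le _ _).trans ?_
      rw [two_mul]
      refine add_le_add ?_ ?_
      · simp only [hK, norm_mul]
        push_cast at e1 ⊢
        exact mul_le_mul b1 e1 (norm_nonneg _) ((norm_nonneg _).trans b1)
      · simp only [hK, norm_mul]
        push_cast [← sub_eq_add_neg] at e2 b2 ⊢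
        exact mul_le_mul b2 e2 (norm_nonneg _) ((norm_nonneg _).trans b2)
    · exact (((intervalIntegrable_const (c := (1 : ℝ))).add
        (intervalIntegrable_abs_sub_rpow (by linarith : -1 < -b) c.im 0 T)).const_mul C).mul_const B
        |>.const_mul 2
    · filter_upwards [(measure_eq_zero_iff_ae_notMem.1 (measure_singleton c.im) :
        ∀ᵐ t : ℝ, t ∉ ({c.im} : Set ℝ))] with t htne ht
      rw [Set.uIoc_of_le hT0] at ht
      have hE : ∀ w : ℂ, AnalyticAt ℂ (fun z => exp (κ * z)) w := fun w => by fun_prop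
      rcases lt_or_gt_of_ne (show t ≠ c.im from htne) with hlt | hgt
      · have hmem : (c.re + t * I : ℂ) ∈ openUpper Λ := by
          refine ⟨by simpa using h.re_pos c hc, by simpa using h.re_lt c hc, by simpa using ht.1.le, ?_⟩
          rintro ⟨c', hc', hre, him⟩
          rw [h.re_inj c hc c' hc' (by simpa using hre)] at hlt
          simp at him
          linarith
        have := ((h.analyticAt_F _ hmem).mul (hE _)).tendsto_sub
        simp only [hG, if_pos hlt.le]
        refine this.congr fun δ => ?_
        simp only [hK, Pi.mul_apply]
        push_cast
        ring_nf
      · obtain ⟨gL, gR, hg⟩ := h.exists_isSideExt hc (Nat.zero_le M) (sub_pos.2 hgt)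
        rw [iteratedDeriv_zero] at hg
        have := hg.tendsto_variation_mul (sub_pos.2 hgt) (hE _)
        simp only [hG, if_neg hgt.not_ge]
        refine this.congr fun δ => ?_
        have e : c + ((t - c.im : ℝ) : ℂ) * I = c.re + t * I := by
          apply Complex.ext <;> simp
        simp only [hK, e]
        push_cast
        ring_nf
  have hshift := (h.intervalIntegrable_variation hc S hS).mul_continuousOn
    (g := fun s : ℝ => exp (κ * (c + s * I))) (Continuous.continuousOn (by fun_prop))
  have hi2 := hshift.comp_sub_right c.im
  rw [zero_add, add_comm S, ← hT] at hi2
  have hG2 : Set.EqOn G (fun t => variation F c ((t - c.im : ℝ) * I) *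
      exp (κ * (c + (t - c.im : ℝ) * I))) (Set.uIoc c.im T) := fun t ht => by
    rw [Set.uIoc_of_le (by linarith)] at ht
    simp only [hG, if_neg ht.1.not_ge]
  have hG1 : Set.EqOn (fun _ => (0 : ℂ)) G (Set.uIcc 0 c.im) := fun t ht => by
    rw [Set.uIcc_of_le hcim.le] at ht
    simp only [hG, if_pos ht.2]
  have hGint : ∫ t in (0 : ℝ)..T, G t =
      ∫ s in (0 : ℝ)..S, variation F c (s * I) * exp (κ * (c + s * I)) := by
    rw [← intervalIntegral.integral_add_adjacent_intervals (b := c.im)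
      ((intervalIntegrable_const (c := (0 : ℂ))).congr (hG1.mono Set.uIoc_subset_uIcc))
      (hi2.congr hG2.symm), ← intervalIntegral.integral_congr hG1,
      intervalIntegral.integral_congr_ae (Eventually.of_forall fun t ht => hG2 ht)]
    have := intervalIntegral.integral_comp_sub_right (a := c.im) (b := T)
      (fun s : ℝ => variation F c (s * I) * exp (κ * (c + s * I))) c.im
    rw [this, sub_self, hT, add_sub_cancel_left]
    simp
  rw [hGint] at hlim
  refine (hlim.const_mul I).congr' ?_
  filter_upwards [hev, self_mem_nhdsWithin] with δ ⟨h1, h2, h3, h4⟩ hδ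
  have hδ := Set.mem_Ioi.1 hδ
  rw [intervalIntegral.integral_sub (hcontK _ (by linarith) h4 h1).intervalIntegrable
    (hcontK _ h3 (by linarith) h2).intervalIntegrable, mul_sub]
  rfl

/-- Higher derivatives of `F` need not be integrable at the tip, so dominated convergence is not
available for them; their jumps follow from that of `F` by integration by parts at `Re c ± δ`, where
the lines avoid the singularity. Only the boundary term at the top jumps. -/
theorem tendsto_vertInt_jump (κ : ℂ) {S : ℝ} (hS : 0 < S) {j : ℕ} (hj : j ≤ M) :
    Tendsto (fun δ : ℝ => vertInt (iteratedDeriv j F) κ (c.im + S) (c.re + δ) -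
      vertInt (iteratedDeriv j F) κ (c.im + S) (c.re - δ))
      (𝓝[>] 0) (𝓝 (jumpInt F c κ j S)) := by
  induction j with
  | zero =>
    rw [iteratedDeriv_zero]
    exact h.tendsto_vertInt_jump_zero hc κ hS
  | succ j ih =>
    have hE : ∀ w : ℂ, AnalyticAt ℂ (fun z => exp (κ * z)) w := fun w => by fun_prop
    have hcim := h.im_pos c hc
    obtain ⟨gL, gR, hg⟩ := h.exists_isSideExt hc (Nat.le_of_succ_le hj) hS
    have t1 := hg.tendsto_variation_mul hS (hE _)
    have hmem : (c.re : ℂ) ∈ openUpper Λ := by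
      refine ⟨by simpa using h.re_pos c hc, by simpa using h.re_lt c hc, by simp, ?_⟩
      rintro ⟨c', hc', -, him⟩
      simp at him
      linarith [h.im_pos c' hc']
    have han : AnalyticAt ℂ (iteratedDeriv j F) c.re := by
      rw [iteratedDeriv_eq_iterate]
      exact (h.analyticAt_F _ hmem).iterated_deriv j
    have t2 := (han.mul (hE _)).tendsto_sub
    have t3 := (t1.sub t2).sub ((ih (Nat.le_of_succ_le hj)).const_mul κ)
    rw [sub_zero] at t3
    refine t3.congr' ?_
    filter_upwards [h.eventually_ne_re hc, self_mem_nhdsWithin] with δ ⟨h1, h2, h3, h4⟩ hδ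
    have hδ := Set.mem_Ioi.1 hδ
    have e : c + (S : ℂ) * I = c.re + (c.im + S : ℝ) * I := by
      apply Complex.ext <;> simp
    rw [h.vertInt_iteratedDeriv_succ j κ (by linarith) h4 (by linarith) h1,
      h.vertInt_iteratedDeriv_succ j κ h3 (by linarith) (by linarith) h2, e]
    simp only [Pi.mul_apply]
    push_cast
    rw [add_right_comm (c.re : ℂ) (((c.im : ℂ) + S) * I), ← sub_add_eq_add_sub (c.re : ℂ)]
    ring

end cut

end UpperStrip

/-- A function which is constant off finitely many points varies by the sum of its jumps. -/
theorem sub_eq_sum_of_jumps {W : ℝ → ℂ} {Λ : Finset ℂ} {J : ℂ → ℂ} (h0 : ∀ c ∈ Λ, 0 < c.re)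
    (h1 : ∀ c ∈ Λ, c.re < 1) (hinj : ∀ c ∈ Λ, ∀ c' ∈ Λ, c.re = c'.re → c = c')
    (hconst : ∀ x y, 0 ≤ x → x ≤ y → y ≤ 1 → (∀ c ∈ Λ, ¬(x ≤ c.re ∧ c.re ≤ y)) → W x = W y)
    (hjump : ∀ c ∈ Λ, Tendsto (fun δ : ℝ => W (c.re + δ) - W (c.re - δ)) (𝓝[>] 0) (𝓝 (J c))) :
    W 1 - W 0 = ∑ c ∈ Λ, J c := by
  classical
  -- Induction on the number of jumps to the left of `b`; the rightmost of them is removed.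
  suffices key : ∀ n : ℕ, ∀ b : ℝ, 0 ≤ b → b ≤ 1 → (∀ c ∈ Λ, c.re ≠ b) →
      (Λ.filter fun c => c.re < b).card = n → W b - W 0 = ∑ c ∈ Λ with c.re < b, J c by
    have := key _ 1 zero_le_one le_rfl (fun c hc => (h1 c hc).ne) rfl
    rwa [Finset.filter_true_of_mem h1] at this
  intro n
  induction n with
  | zero =>
    intro b hb hb1 hne hcard
    rw [Finset.card_eq_zero] at hcard
    rw [hcard, Finset.sum_empty, sub_eq_zero]
    refine (hconst 0 b le_rfl hb hb1 fun c hc hcc => ?_).symm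
    have : c ∈ Λ.filter fun c => c.re < b := Finset.mem_filter.2 ⟨hc, hcc.2.lt_of_ne (hne c hc)⟩
    simp [hcard] at this
  | succ n ih =>
    intro b hb hb1 hne hcard
    obtain ⟨c₀, hc₀, hmax⟩ := Finset.exists_max_image (Λ.filter fun c => c.re < b) re
      (Finset.card_pos.1 (by omega))
    obtain ⟨hc₀Λ, hc₀b⟩ := Finset.mem_filter.1 hc₀
    have hother : ∀ c ∈ Λ, c ≠ c₀ → c.re < b → c.re < c₀.re := fun c hc hcc hcb =>
      (hmax c (Finset.mem_filter.2 ⟨hc, hcb⟩)).lt_of_ne fun heq => hcc (hinj c hc c₀ hc₀Λ heq)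
    have hev1 : ∀ᶠ δ : ℝ in 𝓝[>] 0, ∀ c ∈ Λ, c ≠ c₀ → c.re < b → c.re < c₀.re - δ := by
      refine (Finset.eventually_all Λ).2 fun c hc => ?_
      by_cases hcc : c ≠ c₀ ∧ c.re < b
      · have := hother c hc hcc.1 hcc.2
        filter_upwards [nhdsWithin_le_nhds (gt_mem_nhds (sub_pos.2 this))] with δ hδ _ _
        linarith
      · exact Eventually.of_forall fun δ h2 h3 => absurd ⟨h2, h3⟩ hcc
    have hev2 : ∀ᶠ δ : ℝ in 𝓝[>] 0, δ < b - c₀.re :=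
      nhdsWithin_le_nhds (gt_mem_nhds (sub_pos.2 hc₀b))
    have hev3 : ∀ᶠ δ : ℝ in 𝓝[>] 0, δ < c₀.re := nhdsWithin_le_nhds (gt_mem_nhds (h0 c₀ hc₀Λ))
    -- For small `δ` the increment across `c₀` does not depend on `δ`, so it equals its limit `J
    -- c₀`.
    have hval : ∀ᶠ δ : ℝ in 𝓝[>] 0, W (c₀.re + δ) - W (c₀.re - δ) =
        W b - W 0 - ∑ c ∈ (Λ.filter fun c => c.re < b).erase c₀, J c := by
      filter_upwards [hev1, hev2, hev3, self_mem_nhdsWithin] with δ e1 e2 e3 hδ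
      have hδ := Set.mem_Ioi.1 hδ
      have hset : (Λ.filter fun c => c.re < c₀.re - δ) = (Λ.filter fun c => c.re < b).erase c₀ := by
        ext c
        simp only [Finset.mem_filter, Finset.mem_erase]
        constructor
        · rintro ⟨hc, hlt⟩
          exact ⟨fun heq => by rw [heq] at hlt; linarith, hc, by linarith⟩
        · rintro ⟨hcc, hc, hlt⟩
          exact ⟨hc, e1 c hc hcc hlt⟩
      have hw1 : W (c₀.re + δ) = W b := by
        refine hconst _ _ (by linarith [h0 c₀ hc₀Λ]) (by linarith) hb1 fun c hc hcc => ?_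
        have hlt := hcc.2.lt_of_ne (hne c hc)
        by_cases hcc0 : c = c₀
        · rw [hcc0] at hcc
          linarith [hcc.1]
        · have := e1 c hc hcc0 hlt
          linarith [hcc.1]
      have hw2 := ih (c₀.re - δ) (by linarith) (by linarith) (fun c hc heq => by
        by_cases hcc0 : c = c₀
        · rw [hcc0] at heq
          linarith
        · have := e1 c hc hcc0 (by linarith)
          linarith) (by
        rw [hset, Finset.card_erase_of_mem hc₀, hcard]
        rfl)
      rw [hset] at hw2
      rw [hw1]
      linear_combination -hw2
    have := tendsto_nhds_unique ((hjump c₀ hc₀Λ).congr' hval) tendsto_const_nhds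
    rw [← Finset.add_sum_erase _ _ hc₀, this]
    ring

/-! ### Contour deformation in the upper half strip -/

theorem exp_two_pi_mul_vertical (n : ℕ) (z : ℂ) (t : ℝ) : exp (2 * Real.pi * I * n * (z + t * I)) =
    exp (2 * Real.pi * I * n * z) * exp (-(2 * Real.pi * n * t)) := by
  rw [← Complex.exp_add]
  congr 1
  linear_combination (2 * Real.pi * n * t) * I_sq

theorem norm_exp_two_pi_mul (n : ℕ) (z : ℂ) :
    ‖exp (2 * Real.pi * I * n * z)‖ = Real.exp (-(2 * Real.pi * n * z.im)) := by
  rw [norm_exp]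
  congr 1
  simp

namespace UpperStrip

variable {f F : ℂ → ℂ} {Λ : Finset ℂ} {M : ℕ}

section cut

variable (h : UpperStrip f F Λ M) {c : ℂ} (hc : c ∈ Λ)
include h hc

/-- The contributions of the two terms of the recursion cancel except for one, so the derivative
involves only the variation of `F ^ (j)`. For `j = M` this is the variation of `f`, to which the
integrability hypothesis applies. -/
theorem hasDerivAt_jumpInt (κ : ℂ) {S : ℝ} (hS : 0 < S) {j : ℕ} (hj : j ≤ M) :
    HasDerivAt (jumpInt F c κ j)
      (I * (variation (iteratedDeriv j F) c (S * I) * exp (κ * (c + S * I)))) S := by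
  have hline : HasDerivAt (fun t : ℝ => c + (t : ℂ) * I) I S := by
    simpa using ((hasDerivAt_id S).ofReal_comp.mul_const I).const_add c
  have hE : HasDerivAt (fun t : ℝ => exp (κ * (c + t * I))) (κ * I * exp (κ * (c + S * I))) S := by
    refine (hline.const_mul κ).cexp.congr_deriv ?_
    ring
  induction j with
  | zero =>
    rw [iteratedDeriv_zero]
    have hcont : ∀ s : ℝ, 0 < s →
        ContinuousAt (fun s : ℝ => variation F c (s * I) * exp (κ * (c + s * I))) s := by
      intro s hs
      have h1 := h.continuousAt_variation hc (Nat.zero_le M) hs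
      rw [iteratedDeriv_zero] at h1
      exact h1.mul (by fun_prop)
    have hmeas : StronglyMeasurableAtFilter
        (fun s : ℝ => variation F c (s * I) * exp (κ * (c + s * I))) (𝓝 S) volume :=
      ContinuousOn.stronglyMeasurableAtFilter isOpen_Ioi
        (fun s hs => (hcont s hs).continuousWithinAt) S (Set.mem_Ioi.2 hS)
    exact (intervalIntegral.integral_hasDerivAt_right
      ((h.intervalIntegrable_variation hc S hS).mul_continuousOn
        (Continuous.continuousOn (by fun_prop))) hmeas (hcont S hS)).const_mul I
  | succ j ih =>
    refine (((h.hasDerivAt_variation hc hj hS).mul hE).sub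
      ((ih (Nat.le_of_succ_le hj)).const_mul κ)).congr_deriv ?_
    ring

/-- The derivative in `S` is integrable: `e ^ (-2 π n S)` is `e ^ (-2 π S)`, the weight of the
hypothesis, times `e ^ (-2 π (n - 1) S) ≤ 1`. -/
theorem exists_tendsto_jumpInt {n : ℕ} (hn : 1 ≤ n) :
    ∃ J, Tendsto (jumpInt F c (2 * Real.pi * I * n) M) atTop (𝓝 J) := by
  have hn1 : (1 : ℝ) ≤ n := by exact_mod_cast hn
  refine ⟨_, tendsto_limUnder_of_hasDerivAt_of_integrableOn_Ioi (a := 1)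
    (fun S hS => h.hasDerivAt_jumpInt hc _ (zero_lt_one.trans hS) le_rfl) ?_⟩
  set C := ‖exp (2 * Real.pi * I * n * c)‖
  have hint := h.integrable c hc
  have hcongr : Set.EqOn (fun S : ℝ => I * (exp (2 * Real.pi * I * n * c) *
      exp (-(2 * Real.pi * (n - 1) * S)) * (variation f c (S * I) * exp (-(2 * Real.pi * S)))))
      (fun S : ℝ => I * (variation (iteratedDeriv M F) c (S * I) *
      exp (2 * Real.pi * I * n * (c + S * I)))) (Set.Ioi 1) := by
    intro S hS
    simp only
    rw [h.variation_iteratedDeriv hc (zero_lt_one.trans hS), exp_two_pi_mul_vertical,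
      show (-(2 * Real.pi * n * S) : ℂ) = -(2 * Real.pi * (n - 1) * S) + -(2 * Real.pi * S) by ring,
      Complex.exp_add]
    ring
  refine IntegrableOn.congr_fun ?_ hcongr measurableSet_Ioi
  refine Integrable.const_mul ?_ I
  refine (hint.norm.const_mul C).mono' ?_ ?_
  · exact (Continuous.aestronglyMeasurable (by fun_prop)).mul hint.aestronglyMeasurable
  · refine (ae_restrict_iff' measurableSet_Ioi).2 (Eventually.of_forall fun S hS => ?_)
    rw [norm_mul, norm_mul]
    refine mul_le_mul_of_nonneg_right (mul_le_of_le_one_right (norm_nonneg _) ?_) (norm_nonneg _)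
    have hS : 1 < S := hS
    have : (-(2 * Real.pi * (n - 1) * S) : ℂ) = ((-(2 * Real.pi * (n - 1) * S) : ℝ) : ℂ) := by
      push_cast
      ring
    rw [this, ← ofReal_exp, norm_real, Real.norm_of_nonneg (Real.exp_pos _).le,
      Real.exp_le_one_iff, neg_nonpos]
    have : (0 : ℝ) ≤ n - 1 := by linarith
    have := Real.pi_pos
    positivity

theorem tendsto_variation_mul_exp {n : ℕ} (hn : 1 ≤ n) {j : ℕ} (hj : j ≤ M) :
    Tendsto (fun S : ℝ => variation (iteratedDeriv j F) c (S * I) *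
      exp (2 * Real.pi * I * n * (c + S * I))) atTop (𝓝 0) := by
  have hn1 : (1 : ℝ) ≤ n := by exact_mod_cast hn
  rw [Metric.tendsto_atTop']
  intro ε hε
  obtain ⟨R, hR⟩ := eventually_atTop.1
    ((Asymptotics.isLittleO_iff.1 (h.isLittleO_variation hc hj)) (half_pos hε))
  refine ⟨max R 0, fun S hS => ?_⟩
  have hS0 : 0 < S := (le_max_right _ _).trans_lt hS
  have hb := hR S ((le_max_left _ _).trans hS.le)
  rw [Real.norm_of_nonneg (Real.exp_pos _).le] at hb
  rw [dist_zero_right, norm_mul, norm_exp_two_pi_mul]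
  have him : (c + S * I : ℂ).im = c.im + S := by simp
  have hpi := Real.pi_pos
  have hcim := h.im_pos c hc
  calc _ ≤ ε / 2 * Real.exp (2 * Real.pi * S) * Real.exp (-(2 * Real.pi * S)) := by
        refine mul_le_mul hb (Real.exp_le_exp.2 ?_) (Real.exp_pos _).le (by positivity)
        rw [him]
        have : S ≤ n * (c.im + S) := by nlinarith
        nlinarith
    _ = ε / 2 := by
        rw [mul_assoc, ← Real.exp_add]
        simp
    _ < ε := by linarith

/-- The recursion of `jumpInt` is run backwards from its limit at level `M`. The boundary terms tend
to `0`, so each descent divides the limit by `-κ`, and level `0` is the integral of the variation of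
`F`. -/
theorem exists_tendsto_integral_variation {n : ℕ} (hn : 1 ≤ n) :
    ∃ L, Tendsto (fun S : ℝ => ∫ s in (0 : ℝ)..S, exp (-(2 * Real.pi * n * s)) *
        variation F c (s * I)) atTop (𝓝 L) ∧
      Tendsto (jumpInt F c (2 * Real.pi * I * n) M) atTop
        (𝓝 (I * (-(2 * Real.pi * I * n)) ^ M * exp (2 * Real.pi * I * n * c) * L)) := by
  obtain ⟨J, hJ⟩ := h.exists_tendsto_jumpInt hc hn
  set κ : ℂ := 2 * Real.pi * I * n with hκ
  have hκ0 : κ ≠ 0 := by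
    have : (n : ℂ) ≠ 0 := by exact_mod_cast (by omega : n ≠ 0)
    have h2 : (Real.pi : ℂ) ≠ 0 := by exact_mod_cast Real.pi_ne_zero
    simp [hκ, this, h2]
  have hpow : (-κ) ^ M ≠ 0 := pow_ne_zero _ (neg_ne_zero.2 hκ0)
  have hE0 : exp (κ * c) ≠ 0 := exp_ne_zero _
  have hall : ∀ j ≤ M, Tendsto (jumpInt F c κ j) atTop (𝓝 ((-κ) ^ j * (J / (-κ) ^ M))) := by
    intro j hj
    induction hj using Nat.decreasingInduction with
    | self => rwa [mul_div_cancel₀ _ hpow]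
    | of_succ j hj ih =>
      have := ((h.tendsto_variation_mul_exp hc hn hj.le).sub ih).div_const κ
      have e : (0 - (-κ) ^ (j + 1) * (J / (-κ) ^ M)) / κ = (-κ) ^ j * (J / (-κ) ^ M) := by
        rw [pow_succ]
        field_simp
        ring
      rw [e] at this
      refine this.congr fun S => ?_
      rw [jumpInt, ← hκ]
      field_simp
      ring
  have h0 := hall 0 (Nat.zero_le M)
  rw [pow_zero, one_mul] at h0
  refine ⟨-I * exp (-(κ * c)) * (J / (-κ) ^ M), ?_, ?_⟩
  · refine (h0.const_mul (-I * exp (-(κ * c)))).congr fun S => ?_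
    rw [jumpInt, ← mul_assoc, mul_right_comm (-I), neg_mul, I_mul_I, neg_neg, one_mul,
      ← intervalIntegral.integral_const_mul]
    refine intervalIntegral.integral_congr fun s _ => ?_
    rw [hκ, exp_two_pi_mul_vertical, mul_left_comm, ← mul_assoc (exp (-(2 * Real.pi * I * n * c))),
      ← Complex.exp_add, neg_add_cancel, Complex.exp_zero, one_mul, mul_comm]
  · convert! hJ using 2
    rw [Complex.exp_neg]
    field_simp
    linear_combination -J * I_sq

end cut

theorem ae_mem_closedUpper (Λ : Finset ℂ) {T : ℝ} (hT : 0 ≤ T) :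
    ∀ᵐ x : ℝ, x ∈ Set.Icc (0 : ℝ) 1 → (x + T * I : ℂ) ∈ closedUpper Λ := by
  have hfin : (re '' (Λ : Set ℂ)).Finite := Λ.finite_toSet.image _
  filter_upwards [measure_eq_zero_iff_ae_notMem.1 (hfin.measure_zero volume)] with x hx hx'
  refine ⟨by simpa using hx'.1, by simpa using hx'.2, by simpa using hT, ?_⟩
  rintro ⟨c, hc, hre, -⟩
  exact hx ⟨c, hc, by simpa using hre.symm⟩

/-- The horizontal segment may cross cuts, but only at finitely many points; elsewhere on it `f` is
continuous and bounded. -/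
theorem intervalIntegrable_horizontal (h : UpperStrip f F Λ M) {T B : ℝ} (hT : 0 ≤ T)
    (hB : ∀ z ∈ closedUpper Λ, z.im = T → ‖f z‖ ≤ B) (κ : ℂ) :
    IntervalIntegrable (fun x : ℝ => f (x + T * I) * exp (κ * (x + T * I))) volume 0 1 := by
  have hfin : (re '' (Λ : Set ℂ)).Finite := Λ.finite_toSet.image _
  obtain ⟨K, hK⟩ := (isCompact_Icc (a := (0 : ℝ)) (b := 1)).exists_bound_of_continuousOn
    (f := fun x : ℝ => exp (κ * (x + T * I))) (Continuous.continuousOn (by fun_prop))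
  refine (intervalIntegrable_const (c := B * K)).mono_fun ?_ ?_
  · have hae : (Set.uIoc 0 1 \ (re '' (Λ : Set ℂ)) : Set ℝ) =ᵐ[volume] Set.uIoc (0 : ℝ) 1 :=
      sdiff_null_ae_eq_self (hfin.measure_zero volume)
    rw [← Measure.restrict_congr_set hae]
    refine ContinuousOn.aestronglyMeasurable (fun x hx => ?_)
      (measurableSet_uIoc.diff hfin.measurableSet)
    rw [Set.uIoc_of_le zero_le_one] at hx
    have hmem : (x + T * I : ℂ) ∈ closedUpper Λ := by
      refine ⟨by simpa using hx.1.1.le, by simpa using hx.1.2, by simpa using hT, ?_⟩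
      rintro ⟨c, hc, hre, -⟩
      exact hx.2 ⟨c, hc, by simpa using hre.symm⟩
    have h1 : ContinuousAt (fun x : ℝ => (x + T * I : ℂ)) x := by fun_prop
    have h2 : ContinuousAt (fun x : ℝ => exp (κ * (x + T * I))) x := by fun_prop
    exact ((ContinuousAt.comp (g := f) (f := fun x : ℝ => (x + T * I : ℂ))
      (h.analyticAt_f _ hmem).continuousAt h1).mul
      h2).continuousWithinAt
  · refine (ae_restrict_iff' measurableSet_uIoc).2 ?_
    filter_upwards [ae_mem_closedUpper Λ hT] with x hx hx'
    rw [Set.uIoc_of_le zero_le_one] at hx'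
    have hmem := Set.Ioc_subset_Icc_self hx'
    rw [norm_mul]
    refine le_trans ?_ (le_abs_self _)
    have hb := hB _ (hx hmem) (by simp)
    exact mul_le_mul hb (hK x hmem) (norm_nonneg _) ((norm_nonneg _).trans hb)

theorem continuousOn_vertical (h : UpperStrip f F Λ M) (κ : ℂ) {T x : ℝ} (hT : 0 ≤ T) (hx : 0 ≤ x)
    (hx' : x ≤ 1) (hne : ∀ c ∈ Λ, c.re ≠ x) :
    ContinuousOn (fun t : ℝ => f (x + t * I) * exp (κ * (x + t * I))) (Set.uIcc 0 T) := by
  intro t ht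
  rw [Set.uIcc_of_le hT] at ht
  have hmem : (x + t * I : ℂ) ∈ closedUpper Λ := by
    refine ⟨by simpa using hx, by simpa using hx', by simpa using ht.1, ?_⟩
    rintro ⟨c, hc, hre, -⟩
    exact hne c hc (by simpa using hre.symm)
  have h1 : ContinuousAt (fun t : ℝ => (x + t * I : ℂ)) t := by fun_prop
  have h2 : ContinuousAt (fun t : ℝ => exp (κ * (x + t * I))) t := by fun_prop
  exact ((ContinuousAt.comp (g := f) (f := fun t : ℝ => (x + t * I : ℂ))
    (h.analyticAt_f _ hmem).continuousAt h1).mul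
    h2).continuousWithinAt

theorem continuousOn_bottom (h : UpperStrip f F Λ M) (κ : ℂ) :
    ContinuousOn (fun x : ℝ => f x * exp (κ * x)) (Set.Icc 0 1) := by
  intro x hx
  have hmem : (x : ℂ) ∈ closedUpper Λ := by
    refine ⟨by simpa using hx.1, by simpa using hx.2, by simp, ?_⟩
    rintro ⟨c, hc, -, him⟩
    simp only [ofReal_im] at him
    linarith [h.im_pos c hc]
  have h2 : ContinuousAt (fun x : ℝ => exp (κ * x)) x := by fun_prop
  exact ((ContinuousAt.comp (g := f) (h.analyticAt_f _ hmem).continuousAt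
    continuous_ofReal.continuousAt).mul h2).continuousWithinAt

/-- Let `W x` be the vertical integral at abscissa `x` plus the bottom minus the top integral over
`[0, x]`. Cauchy's theorem on rectangles makes `W` constant between cuts. The horizontal part is
continuous in `x`, so the jumps of `W` are those of the vertical integral, and no contour has to be
wrapped around a cut. -/
theorem contour_identity (h : UpperStrip f F Λ M) (κ : ℂ) {T B : ℝ} (hT : 0 < T)
    (hTc : ∀ c ∈ Λ, c.im < T) (hB : ∀ z ∈ closedUpper Λ, z.im = T → ‖f z‖ ≤ B) :
    vertInt f κ T 1 - vertInt f κ T 0 + (∫ x in (0 : ℝ)..1, f x * exp (κ * x)) -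
      (∫ x in (0 : ℝ)..1, f (x + T * I) * exp (κ * (x + T * I))) =
      ∑ c ∈ Λ, jumpInt F c κ M (T - c.im) := by
  have hbot : IntervalIntegrable (fun x : ℝ => f x * exp (κ * x)) volume 0 1 := by
    refine ContinuousOn.intervalIntegrable ?_
    rw [Set.uIcc_of_le zero_le_one]
    exact h.continuousOn_bottom κ
  have htop := h.intervalIntegrable_horizontal hT.le hB κ
  set q : ℝ → ℂ := fun x => f x * exp (κ * x) - f (x + T * I) * exp (κ * (x + T * I)) with hq
  have hqi : IntervalIntegrable q volume 0 1 := hbot.sub htop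
  set W : ℝ → ℂ := fun x => vertInt f κ T x + ∫ s in (0 : ℝ)..x, q s with hW
  have hsub : ∀ {x y : ℝ}, 0 ≤ x → x ≤ y → y ≤ 1 → Set.uIcc x y ⊆ Set.uIcc 0 1 := by
    intro x y hx hxy hy
    rw [Set.uIcc_of_le hxy, Set.uIcc_of_le zero_le_one]
    exact Set.Icc_subset_Icc hx hy
  have main := sub_eq_sum_of_jumps (W := W) (J := fun c => jumpInt F c κ M (T - c.im))
    h.re_pos h.re_lt h.re_inj ?_ ?_
  · rw [← main, hW]
    simp only [intervalIntegral.integral_same]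
    rw [intervalIntegral.integral_sub hbot htop]
    ring
  · intro x y hx hxy hy hne
    have hdiff : DifferentiableOn ℂ (fun z => f z * exp (κ * z))
        (Set.uIcc (x : ℂ).re (y + T * I : ℂ).re ×ℂ Set.uIcc (x : ℂ).im (y + T * I : ℂ).im) := by
      intro z hz
      have h1 : x ≤ z.re ∧ z.re ≤ y := by
        have := hz.1
        simpa [Set.uIcc_of_le hxy] using this
      have h2 : 0 ≤ z.im ∧ z.im ≤ T := by
        have := hz.2
        simpa [Set.uIcc_of_le hT.le] using this
      have hmem : z ∈ closedUpper Λ := by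
        refine ⟨hx.trans h1.1, h1.2.trans hy, h2.1, ?_⟩
        rintro ⟨c, hc, hre, -⟩
        exact hne c hc (hre ▸ h1)
      exact ((h.analyticAt_f z hmem).differentiableAt.mul
        (by fun_prop : DifferentiableAt ℂ (fun z => exp (κ * z)) z)).differentiableWithinAt
    have hrect := integral_boundary_rect_eq_zero_of_differentiableOn _ _ _ hdiff
    simp only [ofReal_re, ofReal_im, add_re, add_im, mul_re, mul_im, I_re, I_im, mul_zero, mul_one,
      sub_zero, add_zero, zero_add, ofReal_zero, zero_mul, smul_eq_mul] at hrect
    have hadd := intervalIntegral.integral_add_adjacent_intervals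
      (hqi.mono_set (hsub le_rfl hx (hxy.trans hy))) (hqi.mono_set (hsub hx hxy hy))
    have hsp := intervalIntegral.integral_sub (hbot.mono_set (hsub hx hxy hy))
      (htop.mono_set (hsub hx hxy hy))
    simp only [hW, vertInt]
    rw [← hadd, hq, hsp]
    linear_combination -hrect
  · intro c hc
    have hj := h.tendsto_vertInt_jump hc κ (sub_pos.2 (hTc c hc)) le_rfl
    rw [add_sub_cancel] at hj
    have hcr := h.re_pos c hc
    have hcr' := h.re_lt c hc
    have hQ : ContinuousAt (fun x => ∫ s in (0 : ℝ)..x, q s) c.re := by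
      refine (intervalIntegral.continuousOn_primitive_interval' hqi Set.left_mem_uIcc).continuousAt ?_
      rw [Set.uIcc_of_le zero_le_one]
      exact Icc_mem_nhds hcr hcr'
    have hR : Tendsto (fun δ : ℝ => c.re + δ) (𝓝[>] 0) (𝓝 c.re) := by
      have : ContinuousAt (fun δ : ℝ => c.re + δ) 0 := by fun_prop
      simpa [ContinuousAt] using this.mono_left nhdsWithin_le_nhds
    have hL : Tendsto (fun δ : ℝ => c.re - δ) (𝓝[>] 0) (𝓝 c.re) := by
      have : ContinuousAt (fun δ : ℝ => c.re - δ) 0 := by fun_prop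
      simpa [ContinuousAt] using this.mono_left nhdsWithin_le_nhds
    have ht := hj.add ((hQ.tendsto.comp hR).sub (hQ.tendsto.comp hL))
    rw [sub_self, add_zero] at ht
    refine ht.congr' ?_
    have hvert : ∀ x : ℝ, 0 < x → x < 1 → (∀ c ∈ Λ, c.re ≠ x) →
        vertInt (iteratedDeriv M F) κ T x = vertInt f κ T x := by
      intro x hx hx' hne
      simp only [vertInt]
      congr 1
      refine intervalIntegral.integral_congr fun t ht => ?_
      rw [Set.uIcc_of_le hT.le] at ht
      rw [h.iteratedDeriv_eq _ (mem_openUpper_of_re_ne hx hx' ht.1 hne)]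
    filter_upwards [h.eventually_ne_re hc, self_mem_nhdsWithin] with δ ⟨h1, h2, h3, h4⟩ hδ
    have hδ := Set.mem_Ioi.1 hδ
    rw [hvert _ (by linarith) h4 h1, hvert _ h3 (by linarith) h2]
    simp only [hW, Function.comp_apply]
    ring

theorem tendsto_top (h : UpperStrip f F Λ M) {n : ℕ} (hn : 1 ≤ n) :
    Tendsto (fun T : ℝ => ∫ x in (0 : ℝ)..1, f (x + T * I) *
      exp (2 * Real.pi * I * n * (x + T * I))) atTop (𝓝 0) := by
  have hn1 : (1 : ℝ) ≤ n := by exact_mod_cast hn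
  rw [Metric.tendsto_atTop']
  intro ε hε
  obtain ⟨R, hR⟩ := h.growth (ε / 2) (half_pos hε)
  refine ⟨max R 0, fun T hT => ?_⟩
  have hT0 : 0 < T := (le_max_right _ _).trans_lt hT
  rw [dist_zero_right]
  have hb := intervalIntegral.norm_integral_le_of_norm_le_const_ae (a := 0) (b := 1) (C := ε / 2)
    (f := fun x : ℝ => f (x + T * I) * exp (2 * Real.pi * I * n * (x + T * I))) (by
      filter_upwards [ae_mem_closedUpper Λ hT0.le] with x hx hx'
      rw [Set.uIoc_of_le zero_le_one] at hx'
      have h1 := hR _ (hx (Set.Ioc_subset_Icc_self hx')) (by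
        simpa using (le_max_left _ _).trans hT.le)
      rw [norm_mul, norm_exp_two_pi_mul]
      have him : (x + T * I : ℂ).im = T := by simp
      rw [him] at h1 ⊢
      have hpi := Real.pi_pos
      calc _ ≤ ε / 2 * Real.exp (2 * Real.pi * T) * Real.exp (-(2 * Real.pi * T)) := by
            refine mul_le_mul h1 (Real.exp_le_exp.2 ?_) (Real.exp_pos _).le (by positivity)
            have : T ≤ n * T := le_mul_of_one_le_left hT0.le hn1
            nlinarith
        _ = ε / 2 := by
            rw [mul_assoc, ← Real.exp_add]
            simp)
  rw [sub_zero, abs_one, mul_one] at hb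
  linarith

/-- The contour identity as `T → ∞`. Convergence of the side integral is a conclusion: every other
term has a limit. This matters for `n = 1`, where absolute convergence is not known. -/
theorem tendsto_integral_sides (h : UpperStrip f F Λ M) {n : ℕ} (hn : 1 ≤ n) {J : ℂ → ℂ}
    (hJ : ∀ c ∈ Λ, Tendsto (jumpInt F c (2 * Real.pi * I * n) M) atTop (𝓝 (J c))) :
    Tendsto (fun T : ℝ => ∫ t in (0 : ℝ)..T, exp (-(2 * Real.pi * n * t)) *
        (f (1 + t * I) - f (t * I))) atTop
      (𝓝 (I * ((∫ x in (0 : ℝ)..1, f x * exp (2 * Real.pi * I * n * x)) - ∑ c ∈ Λ, J c))) := by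
  set κ : ℂ := 2 * Real.pi * I * n with hκ
  have hsum : Tendsto (fun T : ℝ => ∑ c ∈ Λ, jumpInt F c κ M (T - c.im)) atTop
      (𝓝 (∑ c ∈ Λ, J c)) :=
    tendsto_finsetSum _ fun c hc => (hJ c hc).comp (tendsto_atTop_add_const_right _ _ tendsto_id)
  have hlim := (((tendsto_const_nhds (x := ∫ x in (0 : ℝ)..1, f x * exp (κ * x))).sub
    (h.tendsto_top hn)).sub hsum).const_mul I
  rw [sub_zero] at hlim
  refine hlim.congr' ?_
  obtain ⟨R, hR⟩ := h.growth 1 one_pos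
  filter_upwards [eventually_ge_atTop R, eventually_gt_atTop 0,
    (Finset.eventually_all Λ).2 fun c _ => eventually_gt_atTop c.im] with T hTR hT hTc
  rw [← h.contour_identity κ hT hTc (B := 1 * Real.exp (2 * Real.pi * T)) fun z hz him => by
    rw [← him]
    exact hR z hz (him ▸ hTR)]
  have hi : ∀ x : ℝ, 0 ≤ x → x ≤ 1 → (∀ c ∈ Λ, c.re ≠ x) → IntervalIntegrable
      (fun t : ℝ => f (x + t * I) * exp (κ * (x + t * I))) volume 0 T := fun x hx hx' hne =>
    (h.continuousOn_vertical κ hT.le hx hx' hne).intervalIntegrable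
  have h1 := hi 1 zero_le_one le_rfl fun c hc => (h.re_lt c hc).ne
  have h0 := hi 0 le_rfl zero_le_one fun c hc => (h.re_pos c hc).ne'
  have hdiff : ∫ t in (0 : ℝ)..T, exp (-(2 * Real.pi * n * t)) * (f (1 + t * I) - f (t * I)) =
      (∫ t in (0 : ℝ)..T, f ((1 : ℝ) + t * I) * exp (κ * ((1 : ℝ) + t * I))) -
        ∫ t in (0 : ℝ)..T, f ((0 : ℝ) + t * I) * exp (κ * ((0 : ℝ) + t * I)) := by
    rw [← intervalIntegral.integral_sub h1 h0]
    refine intervalIntegral.integral_congr fun t _ => ?_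
    have e1 : exp (κ * (1 : ℝ)) = 1 := by
      rw [hκ, Complex.exp_eq_one_iff]
      exact ⟨n, by push_cast; ring⟩
    rw [hκ, exp_two_pi_mul_vertical, exp_two_pi_mul_vertical, ← hκ, e1]
    simp
    ring
  rw [hdiff]
  simp only [vertInt]
  linear_combination (-(∫ t in (0 : ℝ)..T, f ((1 : ℝ) + t * I) * exp (κ * ((1 : ℝ) + t * I))) +
        ∫ t in (0 : ℝ)..T, f ((0 : ℝ) + t * I) * exp (κ * ((0 : ℝ) + t * I))) * I_sq

end UpperStrip

/-! ### Cut rays -/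

theorem outDir_of_pos {c : ℂ} (hc : 0 < c.im) : outDir c = I := if_pos hc

theorem outDir_of_neg {c : ℂ} (hc : c.im < 0) : outDir c = -I := if_neg hc.not_gt

theorem mem_cutRay_of_pos {c z : ℂ} (hc : 0 < c.im) : z ∈ cutRay c ↔ z.re = c.re ∧ c.im ≤ z.im := by
  rw [cutRay, outDir_of_pos hc]
  constructor
  · rintro ⟨s, hs, rfl⟩
    simpa using hs
  · rintro ⟨h1, h2⟩
    refine ⟨z.im - c.im, sub_nonneg.2 h2, ?_⟩
    apply Complex.ext <;> simp [h1]

theorem mem_cutRay_of_neg {c z : ℂ} (hc : c.im < 0) : z ∈ cutRay c ↔ z.re = c.re ∧ z.im ≤ c.im := by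
  rw [cutRay, outDir_of_neg hc]
  constructor
  · rintro ⟨s, hs, rfl⟩
    simpa using hs
  · rintro ⟨h1, h2⟩
    refine ⟨c.im - z.im, sub_nonneg.2 h2, ?_⟩
    apply Complex.ext <;> simp [h1]

theorem re_eq_of_mem_cutRay {c z : ℂ} (hc : c.im ≠ 0) (h : z ∈ cutRay c) : z.re = c.re := by
  rcases hc.lt_or_gt with hc | hc
  · exact ((mem_cutRay_of_neg hc).1 h).1
  · exact ((mem_cutRay_of_pos hc).1 h).1

theorem ofReal_notMem_cutRay {c : ℂ} (hc : c.im ≠ 0) (x : ℝ) : (x : ℂ) ∉ cutRay c := by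
  intro h
  rcases hc.lt_or_gt with hc | hc
  · have := ((mem_cutRay_of_neg hc).1 h).2
    simp only [ofReal_im] at this
    linarith
  · have := ((mem_cutRay_of_pos hc).1 h).2
    simp only [ofReal_im] at this
    linarith

theorem isClosed_cutRay {c : ℂ} (hc : c.im ≠ 0) : IsClosed (cutRay c) := by
  rcases hc.lt_or_gt with hc | hc
  · have : cutRay c = {z : ℂ | z.re = c.re} ∩ {z | z.im ≤ c.im} := by
      ext z
      exact mem_cutRay_of_neg hc
    rw [this]
    exact (isClosed_eq continuous_re continuous_const).inter
      (isClosed_le continuous_im continuous_const)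
  · have : cutRay c = {z : ℂ | z.re = c.re} ∩ {z | c.im ≤ z.im} := by
      ext z
      exact mem_cutRay_of_pos hc
    rw [this]
    exact (isClosed_eq continuous_re continuous_const).inter
      (isClosed_le continuous_const continuous_im)

theorem isOpen_openCutStrip {Λ : Finset ℂ} (him : ∀ c ∈ Λ, c.im ≠ 0) : IsOpen (openCutStrip Λ) := by
  have : openCutStrip Λ = ({z : ℂ | 0 < z.re} ∩ {z | z.re < 1}) ∩ ⋂ c ∈ Λ, (cutRay c)ᶜ := by
    ext z
    simp [openCutStrip, and_assoc]
  rw [this]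
  refine ((isOpen_lt continuous_const continuous_re).inter
    (isOpen_lt continuous_re continuous_const)).inter ?_
  exact isOpen_biInter_finset fun c hc => (isClosed_cutRay (him c hc)).isOpen_compl

theorem openCutStrip_subset (Λ : Finset ℂ) : openCutStrip Λ ⊆ cutStrip Λ := fun _ hz =>
  ⟨hz.1.le, hz.2.1.le, hz.2.2⟩

/-! ### Primitives on the open cut strip -/

/-- Cuts point away from the real axis, so a vertical segment from the axis to a point off the cuts
meets none of them. -/
theorem vertical_mem_openCutStrip {Λ : Finset ℂ} (him : ∀ c ∈ Λ, c.im ≠ 0) {z w : ℂ}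
    (hz : z ∈ openCutStrip Λ) (hre : w.re = z.re) (hw : w.im ∈ Set.uIcc 0 z.im) :
    w ∈ openCutStrip Λ := by
  refine ⟨hre ▸ hz.1, hre ▸ hz.2.1, fun c hc hwc => hz.2.2 c hc ?_⟩
  rw [Set.mem_uIcc] at hw
  rcases (him c hc).lt_or_gt with hneg | hpos
  · rw [mem_cutRay_of_neg hneg] at hwc ⊢
    refine ⟨hre ▸ hwc.1, ?_⟩
    rcases hw with hw | hw <;> linarith [hwc.2, hw.1, hw.2]
  · rw [mem_cutRay_of_pos hpos] at hwc ⊢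
    refine ⟨hre ▸ hwc.1, ?_⟩
    rcases hw with hw | hw <;> linarith [hwc.2, hw.1, hw.2]

/-- The primitive integrates from `1 / 2` along the real axis and then vertically. Cauchy's theorem
on the rectangle from the axis to height `Im z`, between the abscissas of `z` and of a nearby `w`,
reduces its increment to a wedge integral inside a disc around `z`. -/
theorem exists_primitive_openCutStrip {Λ : Finset ℂ} (him : ∀ c ∈ Λ, c.im ≠ 0) {f : ℂ → ℂ}
    (hf : AnalyticOnNhd ℂ f (openCutStrip Λ)) :
    ∃ g, ∀ z ∈ openCutStrip Λ, HasDerivAt g (f z) z := by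
  set p : ℂ := ((1 / 2 : ℝ) : ℂ) with hp
  have hreal : ∀ x : ℝ, 0 < x → x < 1 → (x : ℂ) ∈ openCutStrip Λ := fun x hx hx' =>
    ⟨by simpa using hx, by simpa using hx', fun c hc => ofReal_notMem_cutRay (him c hc) x⟩
  refine ⟨fun z => wedgeIntegral p z f, fun z hz => ?_⟩
  obtain ⟨r, hr, hball⟩ := Metric.isOpen_iff.1 (isOpen_openCutStrip him) z hz
  have hcont : ContinuousOn f (openCutStrip Λ) := fun w hw => (hf w hw).continuousAt.continuousWithinAt
  have hconsv : IsConservativeOn f (Metric.ball z r) :=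
    (DifferentiableOn.isConservativeOn fun w hw =>
      (hf w (hball hw)).differentiableAt.differentiableWithinAt)
  have hder := hconsv.hasDerivAt_wedgeIntegral (hcont.mono hball) (Metric.mem_ball_self hr)
  refine (hder.const_add (wedgeIntegral p z f)).congr_of_eventuallyEq ?_
  filter_upwards [Metric.ball_mem_nhds z hr] with w hw
  have hcorner : ∀ x ∈ Set.uIcc z.re w.re, (x + z.im * I : ℂ) ∈ openCutStrip Λ := by
    intro x hx
    refine hball ?_
    rw [Metric.mem_ball, dist_eq_norm] at hw ⊢
    have e : (x + z.im * I - z : ℂ) = ((x - z.re : ℝ) : ℂ) := by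
      apply Complex.ext <;> simp
    rw [e, norm_real, Real.norm_eq_abs]
    refine lt_of_le_of_lt ?_ hw
    refine (Set.abs_sub_left_of_mem_uIcc hx).trans ?_
    simpa using abs_re_le_norm (w - z)
  have hrectmem : ∀ x ∈ Set.uIcc z.re w.re, ∀ y ∈ Set.uIcc 0 z.im,
      (x + y * I : ℂ) ∈ openCutStrip Λ := fun x hx y hy =>
    vertical_mem_openCutStrip him (hcorner x hx) (by simp) (by simpa using hy)
  have hrect := integral_boundary_rect_eq_zero_of_differentiableOn f (z.re : ℂ) (w.re + z.im * I)
    (fun v hv => by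
      have h1 : v.re ∈ Set.uIcc z.re w.re := by simpa using hv.1
      have h2 : v.im ∈ Set.uIcc 0 z.im := by simpa using hv.2
      have := hrectmem _ h1 _ h2
      rw [re_add_im] at this
      exact (hf v this).differentiableAt.differentiableWithinAt)
  have hhor : ∀ a b : ℝ, 0 < a → a < 1 → 0 < b → b < 1 →
      IntervalIntegrable (fun x : ℝ => f (x + (p.im : ℝ) * I)) volume a b := by
    intro a b ha ha' hb hb'
    refine ContinuousOn.intervalIntegrable fun x hx => ?_
    have hx' : 0 < x ∧ x < 1 := by
      rw [Set.mem_uIcc] at hx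
      rcases hx with hx | hx <;> constructor <;> linarith [hx.1, hx.2]
    have h1 := (hf _ (hreal x hx'.1 hx'.2)).continuousAt
    have h2 : ContinuousAt (fun x : ℝ => (x : ℂ)) x := by fun_prop
    have h3 := ContinuousAt.comp (g := f) (f := fun x : ℝ => (x : ℂ)) h1 h2
    have e : (fun x : ℝ => f (x + (p.im : ℝ) * I)) = f ∘ fun x : ℝ => (x : ℂ) := by
      ext x
      simp [hp]
    rw [e]
    exact h3.continuousWithinAt
  have hver : ∀ a b : ℝ, (∀ y ∈ Set.uIcc a b, (w.re + y * I : ℂ) ∈ openCutStrip Λ) →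
      IntervalIntegrable (fun y : ℝ => f (w.re + y * I)) volume a b := by
    intro a b hab
    refine ContinuousOn.intervalIntegrable fun y hy => ?_
    have h2 : ContinuousAt (fun y : ℝ => (w.re + y * I : ℂ)) y := by fun_prop
    exact (ContinuousAt.comp (g := f) (f := fun y : ℝ => (w.re + y * I : ℂ))
      (hf _ (hab y hy)).continuousAt h2).continuousWithinAt
  have hw0 := hball hw
  have hv1 := hver 0 z.im fun y hy => hrectmem _ Set.right_mem_uIcc y hy
  have hv2 := hver z.im w.im fun y hy => by
    refine hball ?_
    rw [Metric.mem_ball, dist_eq_re_im] at hw ⊢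
    refine lt_of_le_of_lt (Real.sqrt_le_sqrt ?_) hw
    have h1 := Set.abs_sub_left_of_mem_uIcc hy
    have h2 := sq_le_sq.2 h1
    simp only [add_re, ofReal_re, mul_re, ofReal_im, I_re, I_im, mul_zero, mul_one, sub_zero,
      add_zero, add_im, mul_im, zero_add]
    linarith
  have ha1 := intervalIntegral.integral_add_adjacent_intervals
    (hhor p.re z.re (by simp [hp]) (by simp [hp]; norm_num) hz.1 hz.2.1)
    (hhor z.re w.re hz.1 hz.2.1 hw0.1 hw0.2.1)
  have ha2 := intervalIntegral.integral_add_adjacent_intervals hv1 hv2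
  have him0 : p.im = 0 := by simp [hp]
  simp only [wedgeIntegral, smul_eq_mul]
  simp only [him0, ofReal_re, ofReal_im, add_re, add_im, mul_re, mul_im, I_re, I_im, mul_zero, mul_one,
      sub_zero, add_zero, zero_add, ofReal_zero, zero_mul, smul_eq_mul] at hrect ha1 ha2 ⊢
  linear_combination -ha1 - I * ha2 + hrect

theorem exists_isIteratedPrimitive {Λ : Finset ℂ} (him : ∀ c ∈ Λ, c.im ≠ 0) (M : ℕ) {f : ℂ → ℂ}
    (hf : AnalyticOnNhd ℂ f (openCutStrip Λ)) : ∃ F, IsIteratedPrimitive F f M Λ := by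
  have hopen := isOpen_openCutStrip him
  induction M generalizing f with
  | zero => exact ⟨f, hf, fun z _ => by rw [iteratedDeriv_zero]⟩
  | succ M ih =>
    obtain ⟨g, hg⟩ := exists_primitive_openCutStrip him hf
    have hga : AnalyticOnNhd ℂ g (openCutStrip Λ) := DifferentiableOn.analyticOnNhd
      (fun z hz => (hg z hz).differentiableAt.differentiableWithinAt) hopen
    obtain ⟨F, hF, hF'⟩ := ih hga
    refine ⟨F, hF, fun z hz => ?_⟩
    have hev : iteratedDeriv M F =ᶠ[𝓝 z] g := by
      filter_upwards [hopen.mem_nhds hz] with w hw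
      exact hF' w hw
    rw [iteratedDeriv_succ, hev.deriv_eq, (hg z hz).deriv]

/-! ### One-sided extensions from analytic continuation -/

/-- By the identity theorem the set of times at which the continued germ is that of `f` is open and
closed in `[0, 1)`, and it contains `0`. The last germ therefore extends `f` to the end of the path,
where `f` itself may fail to be analytic. -/
theorem ContinuesAlong.exists_analyticAt {f : ℂ → ℂ} {a b : ℂ} {γ : Path a b}
    (h : ContinuesAlong f γ) (hf : ∀ t, t ≠ 1 → AnalyticAt ℂ f (γ t)) :
    ∃ g, AnalyticAt ℂ g b ∧ ∀ᶠ t in 𝓝 (1 : unitInterval), t ≠ 1 → f =ᶠ[𝓝 (γ t)] g := by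
  obtain ⟨F, hF0, hFa, hFc⟩ := h
  set A : Set unitInterval := {t | F t =ᶠ[𝓝 (γ t)] f} with hA
  have hloc : ∀ t, t ≠ 1 → ∀ᶠ s in 𝓝 t, s ∈ A ↔ t ∈ A := by
    intro t ht
    obtain ⟨ρ, hρ, hball⟩ := Metric.eventually_nhds_iff_ball.1
      ((hFa t).eventually_analyticAt.and (hf t ht).eventually_analyticAt)
    have h1 : AnalyticOnNhd ℂ (F t) (Metric.ball (γ t) ρ) := fun z hz => (hball z hz).1
    have h2 : AnalyticOnNhd ℂ f (Metric.ball (γ t) ρ) := fun z hz => (hball z hz).2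
    have hpre := (convex_ball (γ t) ρ).isPreconnected
    have heq : ∀ s, γ s ∈ Metric.ball (γ t) ρ → F t =ᶠ[𝓝 (γ s)] f →
        ∀ s', γ s' ∈ Metric.ball (γ t) ρ → F t =ᶠ[𝓝 (γ s')] f := by
      intro s hs hse s' hs'
      have := h1.eqOn_of_preconnected_of_eventuallyEq h2 hpre hs hse
      exact this.eventuallyEq_of_mem (Metric.isOpen_ball.mem_nhds hs')
    filter_upwards [hFc t, γ.continuous.continuousAt.eventually (Metric.ball_mem_nhds (γ t) hρ)]
      with s hs hsb
    exact ⟨fun hsA => heq s hsb (hs.symm.trans hsA) t (Metric.mem_ball_self hρ),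
      fun htA => hs.trans (heq t (Metric.mem_ball_self hρ) htA s hsb)⟩
  have hall : Set.Iio (1 : unitInterval) ⊆ interior A := by
    refine isPreconnected_Iio.subset_left_of_subset_union isOpen_interior
      (isOpen_interior (s := Aᶜ)) ?_ ?_ ?_
    · exact (disjoint_compl_right (a := A)).mono interior_subset interior_subset
    · intro t ht
      have hl := hloc t (ne_of_lt ht)
      by_cases htA : t ∈ A
      · exact Or.inl (mem_interior_iff_mem_nhds.2 (hl.mono fun s hs => hs.2 htA))
      · exact Or.inr (mem_interior_iff_mem_nhds.2 (hl.mono fun s hs hsA => htA (hs.1 hsA)))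
    · have h0 : (0 : unitInterval) ∈ A := by
        change F 0 =ᶠ[𝓝 (γ 0)] f
        rw [γ.source]
        exact hF0
      refine ⟨0, ?_, mem_interior_iff_mem_nhds.2 ((hloc 0 (by simp)).mono fun s hs => hs.2 h0)⟩
      exact Set.mem_Iio.2 zero_lt_one
  refine ⟨F 1, by simpa using hFa 1, ?_⟩
  filter_upwards [hFc 1] with t ht hne
  have htA : t ∈ A := interior_subset (hall (lt_of_le_of_ne unitInterval.le_one' hne))
  exact htA.symm.trans ht

/-- The path from `0` along the real axis to `x`, and from there straight to `w`. -/
def elbowPath (x : ℝ) (w : ℂ) : Path (0 : ℂ) w where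
  toFun t := x * ((min 1 (2 * (t : ℝ)) : ℝ) : ℂ) + (w - x) * ((max 0 (2 * (t : ℝ) - 1) : ℝ) : ℂ)
  continuous_toFun := by fun_prop
  source' := by simp
  target' := by
    simp
    ring

theorem elbowPath_cases (x : ℝ) (w : ℂ) (t : unitInterval) :
    (∃ s : ℝ, 0 ≤ s ∧ s ≤ 1 ∧ elbowPath x w t = ((x * s : ℝ) : ℂ) ∧ (t : ℝ) ≤ 1 / 2) ∨
      ∃ s : ℝ, 0 ≤ s ∧ s ≤ 1 ∧ elbowPath x w t = x + (w - x) * s ∧ (s = 1 → t = 1) := by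
  have ht0 := t.2.1
  have ht1 := t.2.2
  have hdef : elbowPath x w t =
    x * ((min 1 (2 * (t : ℝ)) : ℝ) : ℂ) + (w - x) * ((max 0 (2 * (t : ℝ) - 1) : ℝ) : ℂ) := rfl
  rcases le_total (t : ℝ) (1 / 2) with h | h
  · refine Or.inl ⟨2 * t, by linarith, by linarith, ?_, h⟩
    rw [hdef, min_eq_right (by linarith), max_eq_left (by linarith)]
    push_cast
    ring
  · refine Or.inr ⟨2 * t - 1, by linarith, by linarith, ?_, fun heq => ?_⟩
    · rw [hdef, min_eq_left (by linarith), max_eq_right (by linarith)]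
      push_cast
      ring
    · apply Subtype.ext
      change (t : ℝ) = 1
      linarith

/-- The germ is continued along the real axis to `x`, where no singularity lies, and then straight
to `w` inside `H`. It agrees with `f` near a point of the path close to `w`, hence on the convex
intersection of `H` with a small disc. -/
theorem exists_side_extension {f : ℂ → ℂ} {S : Set ℂ} {Λ : Finset ℂ} (hres : EndlesslyContinuable f S)
    (him : ∀ c ∈ Λ, c.im ≠ 0) (hΛ : ∀ c : ℂ, c ∈ Λ ↔ c ∈ S ∧ 0 ≤ c.re ∧ c.re ≤ 1)
    (hf : AnalyticOnNhd ℂ f (cutStrip Λ)) {x : ℝ} {w : ℂ} {H : Set ℂ} (hx : 0 ≤ x) (hx' : x ≤ 1)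
    (hH : Convex ℝ H)
    (hS : ∀ s : ℝ, 0 ≤ s → s ≤ 1 → (x + (w - x) * s : ℂ) ∉ S)
    (hpath : ∀ s : ℝ, 0 ≤ s → s < 1 → (x + (w - x) * s : ℂ) ∈ cutStrip Λ ∩ H)
    (hnear : ∀ᶠ z in 𝓝 w, z ∈ H → z ∈ cutStrip Λ) :
    ∃ g, AnalyticAt ℂ g w ∧ ∀ᶠ z in 𝓝 w, z ∈ H → f z = g z := by
  have hreal : ∀ s : ℝ, 0 ≤ s → s ≤ 1 → 0 ≤ x * s ∧ x * s ≤ 1 := fun s hs hs' =>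
    ⟨mul_nonneg hx hs, mul_le_one₀ hx' hs hs'⟩
  obtain ⟨g, hg, hev⟩ := (hres.2 w (elbowPath x w) (fun t => by
    rcases elbowPath_cases x w t with ⟨s, hs, hs', he, -⟩ | ⟨s, hs, hs', he, -⟩
    · rw [he]
      intro hmem
      have := (hΛ _).2 ⟨hmem, by simpa using (hreal s hs hs').1, by simpa using (hreal s hs hs').2⟩
      exact him _ this (ofReal_im _)
    · rw [he]
      exact hS s hs hs')).exists_analyticAt (fun t ht => by
    rcases elbowPath_cases x w t with ⟨s, hs, hs', he, -⟩ | ⟨s, hs, hs', he, h1⟩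
    · rw [he]
      exact hf _ ⟨by simpa using (hreal s hs hs').1, by simpa using (hreal s hs hs').2,
        fun c hc => ofReal_notMem_cutRay (him c hc) _⟩
    · rw [he]
      exact hf _ (hpath s hs (hs'.lt_of_ne fun h => ht (h1 h))).1)
  refine ⟨g, hg, ?_⟩
  obtain ⟨r, hr, hball⟩ := Metric.eventually_nhds_iff_ball.1 (hnear.and hg.eventually_analyticAt)
  have hcont := (elbowPath x w).continuous.continuousAt (x := 1)
  have hb : ∀ᶠ t in 𝓝 (1 : unitInterval), elbowPath x w t ∈ Metric.ball w r := by
    refine hcont.eventually ?_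
    rw [Path.target]
    exact Metric.ball_mem_nhds w hr
  have hhalf : ∀ᶠ t : unitInterval in 𝓝 1, 1 / 2 < (t : ℝ) :=
    continuous_subtype_val.continuousAt.eventually (lt_mem_nhds (by norm_num))
  have hne : (𝓝[≠] (1 : unitInterval)).NeBot := inferInstance
  have hall : ∀ᶠ t in 𝓝[≠] (1 : unitInterval), _ :=
    Filter.Eventually.filter_mono nhdsWithin_le_nhds (hev.and (hb.and hhalf))
  obtain ⟨t, ⟨ht1, ht2, ht3⟩, ht4⟩ := (hall.and
    (self_mem_nhdsWithin (a := (1 : unitInterval)) (s := {1}ᶜ))).exists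
  have ht4 : t ≠ 1 := ht4
  have htH : elbowPath x w t ∈ H := by
    rcases elbowPath_cases x w t with ⟨s, -, -, -, h1⟩ | ⟨s, hs, hs', he, h1⟩
    · linarith
    · rw [he]
      exact (hpath s hs (hs'.lt_of_ne fun h => ht4 (h1 h))).2
  have heq := AnalyticOnNhd.eqOn_of_preconnected_of_eventuallyEq (f := f) (g := g)
    (U := Metric.ball w r ∩ H) (fun z hz => hf z ((hball z hz.1).1 hz.2))
    (fun z hz => (hball z hz.1).2) ((convex_ball w r).inter hH).isPreconnected ⟨ht2, htH⟩ (ht1 ht4)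
  filter_upwards [Metric.ball_mem_nhds w hr] with z hz hzH
  exact heq ⟨hz, hzH⟩

/-- With `δ` so small that no other singularity of the strip has real part within `δ` of `Re c`, the
segment from `Re c ± δ` to `w` avoids all cuts before `w`. It avoids `S` too, since it could meet it
only at `c`. -/
theorem exists_isSideExt_of_endlesslyContinuable {f : ℂ → ℂ} {S : Set ℂ} {Λ : Finset ℂ}
    (hres : EndlesslyContinuable f S)
    (hΛ : ∀ c : ℂ, c ∈ Λ ↔ c ∈ S ∧ 0 ≤ c.re ∧ c.re ≤ 1)
    (hre : ∀ c ∈ Λ, 0 < c.re ∧ c.re < 1) (him : ∀ c ∈ Λ, c.im ≠ 0)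
    (hdist : ∀ c ∈ Λ, ∀ c' ∈ Λ, c ≠ c' → c.re ≠ c'.re) (hf : AnalyticOnNhd ℂ f (cutStrip Λ))
    {c w : ℂ} (hc : c ∈ Λ) (hw : w.re = c.re) (hwc : w ≠ c) : ∃ gL gR, IsSideExt f gL gR w := by
  have hδ : ∃ δ : ℝ, 0 < δ ∧ δ < c.re ∧ δ < 1 - c.re ∧ ∀ c' ∈ Λ, |c'.re - c.re| ≤ δ → c' = c := by
    have hev : ∀ᶠ δ : ℝ in 𝓝[>] 0, ∀ c' ∈ Λ, |c'.re - c.re| ≤ δ → c' = c := by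
      refine (Finset.eventually_all Λ).2 fun c' hc' => ?_
      by_cases hcc : c' = c
      · exact Eventually.of_forall fun _ _ => hcc
      · have : 0 < |c'.re - c.re| := abs_pos.2 (sub_ne_zero.2 (hdist c' hc' c hc hcc))
        filter_upwards [nhdsWithin_le_nhds (gt_mem_nhds this)] with δ hδ hle
        linarith
    have hlt : ∀ y : ℝ, 0 < y → ∀ᶠ δ : ℝ in 𝓝[>] 0, δ < y := fun y hy =>
      Filter.Eventually.filter_mono nhdsWithin_le_nhds (gt_mem_nhds hy)
    obtain ⟨δ, ⟨h1, h2, h3⟩, h4⟩ := (((hlt _ (hre c hc).1).and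
      ((hlt _ (sub_pos.2 (hre c hc).2)).and hev)).and
      (self_mem_nhdsWithin (a := (0 : ℝ)) (s := Set.Ioi 0))).exists
    exact ⟨δ, h4, h1, h2, h3⟩
  obtain ⟨δ, hδ0, hδ1, hδ2, hδ⟩ := hδ
  have key : ∀ σ : ℝ, σ = 1 ∨ σ = -1 → ∃ g, AnalyticAt ℂ g w ∧
      ∀ᶠ z in 𝓝 w, z ∈ {z : ℂ | σ * c.re < σ * z.re} → f z = g z := by
    -- The sign `σ` treats both sides together: `1` is the right of the cut, `-1` the left.
    intro σ hσ
    have hσ2 : σ * σ = 1 := by rcases hσ with rfl | rfl <;> norm_num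
    have hσabs : |σ| = 1 := by rcases hσ with rfl | rfl <;> norm_num
    have hσle : |σ * δ| = δ := by rw [abs_mul, hσabs, one_mul, abs_of_pos hδ0]
    have hbounds := abs_le.1 hσle.le
    have hpre : ∀ s : ℝ, ((c.re + σ * δ : ℝ) + (w - (c.re + σ * δ : ℝ)) * s : ℂ).re =
        c.re + σ * (δ * (1 - s)) := by
      intro s
      simp [hw]
      ring
    have hclose : ∀ s : ℝ, 0 ≤ s → s ≤ 1 → |c.re + σ * (δ * (1 - s)) - c.re| ≤ δ := by
      intro s hs hs'
      rw [add_sub_cancel_left, abs_mul, hσabs, one_mul, abs_of_nonneg (by nlinarith)]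
      nlinarith
    have hstrip : ∀ y : ℝ, |y - c.re| ≤ δ → 0 ≤ y ∧ y ≤ 1 := by
      intro y hy
      have := abs_le.1 hy
      constructor <;> linarith
    refine exists_side_extension hres him hΛ hf (x := c.re + σ * δ) (by linarith) (by linarith)
      (convex_halfSpace_gt (σ • reLm).isLinear _) ?_ ?_ ?_
    · intro s hs hs' hmem
      have hd := hclose s hs hs'
      rw [← hpre] at hd
      have hst := hstrip _ hd
      have hmemΛ := (hΛ _).2 ⟨hmem, hst.1, hst.2⟩
      have heq := hδ _ hmemΛ hd
      have hre' := congrArg re heq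
      rw [hpre] at hre'
      have h0 : δ * (1 - s) = 0 := by
        have : σ * (δ * (1 - s)) = 0 := by linarith
        calc δ * (1 - s) = σ * σ * (δ * (1 - s)) := by rw [hσ2, one_mul]
          _ = 0 := by rw [mul_assoc, this, mul_zero]
      have hs1 : s = 1 := by
        rcases mul_eq_zero.1 h0 with h | h <;> linarith
      rw [hs1] at heq
      apply hwc
      rw [← heq]
      push_cast
      ring
    · intro s hs hs'
      have hd := hclose s hs hs'.le
      rw [← hpre] at hd
      have hst := hstrip _ hd
      have hpos : 0 < δ * (1 - s) := mul_pos hδ0 (by linarith)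
      refine ⟨⟨hst.1, hst.2, fun c' hc' hmem => ?_⟩, ?_⟩
      · have hre' := re_eq_of_mem_cutRay (him c' hc') hmem
        have hcc : c' = c := hδ c' hc' (by rwa [hre'] at hd)
        rw [hcc, hpre] at hre'
        have : σ * (δ * (1 - s)) = 0 := by linarith
        have : σ * σ * (δ * (1 - s)) = 0 := by rw [mul_assoc, this, mul_zero]
        rw [hσ2, one_mul] at this
        linarith
      · change σ * c.re < σ * _
        rw [hpre, mul_add, ← mul_assoc σ σ, hσ2, one_mul]
        linarith
    · filter_upwards [Metric.ball_mem_nhds w hδ0] with z hz hzH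
      have hzH : σ * c.re < σ * z.re := hzH
      rw [Metric.mem_ball, dist_eq_norm] at hz
      have hd : |z.re - c.re| ≤ δ := by
        have := abs_re_le_norm (z - w)
        rw [sub_re, hw] at this
        linarith
      have hst := hstrip _ hd
      refine ⟨hst.1, hst.2, fun c' hc' hmem => ?_⟩
      have hre' := re_eq_of_mem_cutRay (him c' hc') hmem
      have hcc : c' = c := hδ c' hc' (by rwa [hre'] at hd)
      rw [hre', hcc] at hzH
      exact lt_irrefl _ hzH
  obtain ⟨gR, hgR, hgR'⟩ := key 1 (Or.inl rfl)
  obtain ⟨gL, hgL, hgL'⟩ := key (-1) (Or.inr rfl)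
  refine ⟨gL, gR, hgL, hgR, ?_⟩
  filter_upwards [hgR', hgL'] with z h1 h2
  rw [hw]
  exact ⟨fun hlt => h2 (show -1 * c.re < -1 * z.re by linarith),
    fun hlt => h1 (show 1 * c.re < 1 * z.re by linarith)⟩

/-! ### Power bounds from the local form -/

/-- Since `α` is real, the modulus of `u ^ α` is `‖u‖ ^ α` for every branch. The logarithmic factor
costs an arbitrarily small power, provided that the imaginary part of the branch `l` is bounded; and
it is, because `l` differs from a principal logarithm by a quantity with constant imaginary part on
the slit disc. -/
theorem norm_le_of_hasLocalForm {f : ℂ → ℂ} {c : ℂ} {α β b : ℝ}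
    (h : HasLocalForm f c α β) (hb : -α < b) :
    ∃ C r : ℝ, 0 < r ∧ ∀ u : ℂ, ‖u‖ < r → c + u ∉ cutRay c → ‖f (c + u)‖ ≤ C * ‖u‖ ^ (-b) := by
  obtain ⟨g, l, ll, r, hr, hg, hl, hll, hform⟩ := h
  set D : Set ℂ := {u | ‖u‖ < r ∧ c + u ∉ cutRay c} with hD
  set d : ℂ := outDir c with hd
  have hdd : d * d = -1 := by
    rw [hd, outDir]
    split_ifs <;> simp
  have hd0 : d ≠ 0 := fun h0 => by simp [h0] at hdd
  have hdn : ‖d‖ = 1 := by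
    rw [hd, outDir]
    split_ifs <;> simp
  -- Multiplication by `d` turns the cut into the negative real axis, the cut of the principal
  -- logarithm.
  have hslit : ∀ u : ℂ, c + u ∉ cutRay c ↔ d * u ∈ slitPlane := by
    intro u
    rw [← not_iff_not, not_not, mem_slitPlane_iff_not_le_zero, not_not, cutRay]
    constructor
    · rintro ⟨s, hs, he⟩
      rw [add_right_inj] at he
      rw [he, mul_left_comm, ← hd, hdd]
      have : (s : ℂ) * -1 = ((-s : ℝ) : ℂ) := by push_cast; ring
      rw [this]
      exact_mod_cast neg_nonpos.2 hs
    · intro hle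
      obtain ⟨h1, h2⟩ := Complex.nonpos_iff.1 hle
      refine ⟨-(d * u).re, by linarith, ?_⟩
      have h3 : d * u = ((d * u).re : ℂ) := Complex.ext (by simp) (by simp [h2])
      rw [add_right_inj, ← hd]
      push_cast
      rw [← h3]
      linear_combination u * hdd
  have hDpre : IsPreconnected D := by
    have hconv : D = (fun v : ℂ => -d * v) '' (Metric.ball 0 r ∩ slitPlane) := by
      ext u
      constructor
      · intro hu
        refine ⟨d * u, ⟨by simpa [hdn] using hu.1, (hslit u).1 hu.2⟩, ?_⟩
        simp only
        linear_combination (-u) * hdd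
      · rintro ⟨v, ⟨hv1, hv2⟩, rfl⟩
        refine ⟨by simpa [hdn] using hv1, (hslit _).2 ?_⟩
        have : d * (-d * v) = v := by linear_combination (-v) * hdd
        rwa [this]
    rw [hconv]
    refine IsPreconnected.image ?_ _ (Continuous.continuousOn (by fun_prop))
    have hstar : StarConvex ℝ ((r / 2 : ℝ) : ℂ) (Metric.ball 0 r ∩ slitPlane) := by
      refine StarConvex.inter ((convex_ball _ _).starConvex ?_) (starConvex_slitPlane ?_)
      · simp [abs_of_pos hr]
        linarith
      · exact_mod_cast half_pos hr
    exact (hstar.isPathConnected ⟨by simp [abs_of_pos hr]; linarith,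
      Or.inl (by simp [hr])⟩).isConnected.isPreconnected
  have hconst : ∃ K : ℝ, 0 ≤ K ∧ ∀ u ∈ D, |(l u).im| ≤ K := by
    by_cases hne : D.Nonempty
    swap
    · exact ⟨0, le_rfl, fun u hu => absurd ⟨u, hu⟩ hne⟩
    obtain ⟨u₀, hu₀⟩ := hne
    set q : ℂ → ℂ := fun u => l u - log (d * u) with hq
    have hqc : ContinuousOn q D := hl.sub
      (ContinuousOn.clog (Continuous.continuousOn (by fun_prop)) fun u hu => (hslit u).1 hu.2)
    have hqe : ∀ u ∈ D, exp (q u) = d⁻¹ := by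
      intro u hu
      have hne : d * u ≠ 0 := slitPlane_ne_zero ((hslit u).1 hu.2)
      have hu0 : u ≠ 0 := right_ne_zero_of_mul hne
      rw [hq]
      simp only
      rw [exp_sub, exp_log hne, (hform u hu.1 hu.2).1]
      field_simp
    -- A continuous function on a connected set with values in the discrete group `2 π ℤ` is
    -- constant.
    have hmaps : Set.MapsTo (fun u => (q u).im - (q u₀).im) D
        (AddSubgroup.zmultiples (2 * Real.pi) : Set ℝ) := by
      intro u hu
      obtain ⟨n, hn⟩ := exp_eq_exp_iff_exists_int.1 ((hqe u hu).trans (hqe u₀ hu₀).symm)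
      refine AddSubgroup.mem_zmultiples_iff.2 ⟨n, ?_⟩
      have := congrArg im hn
      simp at this
      simp [this]
    have hzero : ∀ u ∈ D, (q u).im = (q u₀).im := by
      intro u hu
      have := hDpre.constant_of_mapsTo (T := (AddSubgroup.zmultiples (2 * Real.pi) : Set ℝ))
        (isDiscrete_iff_discreteTopology.2
          (inferInstanceAs (DiscreteTopology (AddSubgroup.zmultiples (2 * Real.pi)))))
        ((continuous_im.comp_continuousOn hqc).sub continuousOn_const) hmaps hu hu₀
      simpa [sub_eq_zero] using this
    refine ⟨|(q u₀).im| + Real.pi, by positivity, fun u hu => ?_⟩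
    have h1 := hzero u hu
    have h2 : (l u).im = (q u₀).im + (log (d * u)).im := by
      rw [← h1, hq]
      simp
    rw [h2, log_im]
    exact (abs_add_le _ _).trans (by gcongr; exact abs_arg_le_pi _)
  obtain ⟨K, hK0, hK⟩ := hconst
  obtain ⟨B, hB⟩ := hg.continuousAt.norm.isBoundedUnder_le
  obtain ⟨r', hr', hB⟩ := Metric.eventually_nhds_iff.1 (eventually_map.1 hB)
  -- With this choice `η * |β| ≤ b + α`: the loss from `‖l u‖ ^ |β|` fits in the available margin.
  -- The radius `exp (-1)` below ensures `‖l u‖ ≥ 1`, so that `β` may be replaced by `|β|`.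
  set η : ℝ := (b + α) / (|β| + 1) with hη
  have hη0 : 0 < η := div_pos (by linarith) (by positivity)
  refine ⟨((1 + K) / η) ^ |β| * B, min r (min r' (Real.exp (-1))), by positivity, fun u hu huc => ?_⟩
  obtain ⟨hur, hur', hue⟩ : ‖u‖ < r ∧ ‖u‖ < r' ∧ ‖u‖ < Real.exp (-1) := by simpa using hu
  have huD : u ∈ D := ⟨hur, huc⟩
  obtain ⟨e1, e2, e3⟩ := hform u hur huc
  have hu0 : 0 < ‖u‖ := by
    rw [← e1]
    exact norm_pos_iff.2 (exp_ne_zero _)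
  have hu1 : ‖u‖ ≤ 1 := hue.le.trans (by simp)
  have hre : (l u).re = Real.log ‖u‖ := by
    conv_rhs => rw [← e1, norm_exp, Real.log_exp]
  set L : ℝ := -Real.log ‖u‖ with hL
  have hL1 : 1 ≤ L := by
    have := Real.log_lt_log hu0 hue
    rw [Real.log_exp] at this
    linarith
  have hreL : |(l u).re| = L := by
    rw [hre, abs_of_nonpos (by linarith)]
  have hll1 : 1 ≤ ‖l u‖ := hL1.trans (hreL ▸ abs_re_le_norm _)
  have hll2 : ‖l u‖ ≤ (1 + K) * L := by
    refine (norm_le_abs_re_add_abs_im _).trans ?_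
    rw [hreL]
    nlinarith [hK u huD]
  have hLη : L ≤ ‖u‖ ^ (-η) / η := by
    have := Real.log_le_rpow_div (x := ‖u‖⁻¹) (by positivity) hη0
    rwa [Real.log_inv, Real.inv_rpow hu0.le, ← Real.rpow_neg hu0.le] at this
  have hβ : ‖exp (β * ll u)‖ ≤ ((1 + K) / η) ^ |β| * ‖u‖ ^ (-(b + α)) := by
    have h1 : ‖exp (β * ll u)‖ = ‖l u‖ ^ β := by
      rw [norm_exp, re_ofReal_mul, ← e2, norm_exp, ← Real.exp_mul, mul_comm]
    rw [h1]
    calc ‖l u‖ ^ β ≤ ‖l u‖ ^ |β| := Real.rpow_le_rpow_of_exponent_le hll1 (le_abs_self _)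
      _ ≤ ((1 + K) / η * ‖u‖ ^ (-η)) ^ |β| := by
        refine Real.rpow_le_rpow (norm_nonneg _) (hll2.trans ?_) (abs_nonneg _)
        calc (1 + K) * L ≤ (1 + K) * (‖u‖ ^ (-η) / η) := by gcongr
          _ = _ := by ring
      _ = ((1 + K) / η) ^ |β| * ‖u‖ ^ (-η * |β|) := by
        rw [Real.mul_rpow (by positivity) (by positivity), ← Real.rpow_mul hu0.le]
      _ ≤ _ := by
        refine mul_le_mul_of_nonneg_left
          (Real.rpow_le_rpow_of_exponent_ge hu0 hu1 ?_) (by positivity)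
        have : η * (|β| + 1) = b + α := div_mul_cancel₀ _ (by positivity)
        nlinarith
  have hα : ‖exp (α * l u)‖ = ‖u‖ ^ α := by
    rw [norm_exp, re_ofReal_mul, hre, mul_comm, Real.rpow_def_of_pos hu0]
  have hBu : ‖g u‖ ≤ B := hB (by simpa using hur')
  rw [e3, norm_mul, norm_mul, hα]
  calc ‖u‖ ^ α * ‖exp (β * ll u)‖ * ‖g u‖
      ≤ ‖u‖ ^ α * (((1 + K) / η) ^ |β| * ‖u‖ ^ (-(b + α))) * B := by gcongr
    _ = ((1 + K) / η) ^ |β| * B * (‖u‖ ^ α * ‖u‖ ^ (-(b + α))) := by ring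
    _ = _ := by
      rw [← Real.rpow_add hu0]
      ring_nf

/-! ### The transseries terms of one half of the strip -/

theorem LaplaceConverges.const_mul_congr {G G' : ℝ → ℂ} {x : ℝ} (h : LaplaceConverges G x) (a : ℂ)
    (hG : ∀ p : ℝ, 0 < p → G' p = a * G p) :
    LaplaceConverges G' x ∧ laplace G' x = a * laplace G x := by
  obtain ⟨h1, L, hL⟩ := h
  have ht : Tendsto (truncatedLaplace G' x) atTop (𝓝 (a * L)) := by
    refine (hL.const_mul a).congr' ?_
    filter_upwards [eventually_ge_atTop 0] with P hP
    rw [truncatedLaplace, truncatedLaplace, ← intervalIntegral.integral_const_mul]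
    refine intervalIntegral.integral_congr_ae (Eventually.of_forall fun p hp => ?_)
    rw [Set.uIoc_of_le hP] at hp
    rw [hG p hp.1]
    ring
  refine ⟨⟨fun P hP => ((h1 P hP).const_mul a).congr fun p hp => ?_, _, ht⟩, ?_⟩
  · rw [Set.uIoc_of_le hP.le] at hp
    rw [hG p hp.1]
    ring
  · rw [laplace, laplace, ht.limUnder_eq, hL.limUnder_eq]

/-- The substitution `p = 2 π m s` turns `e ^ (-N p)` into `e ^ (-2 π m N s)`, and the prefactor `1
/ (2 π m)` cancels the Jacobian. -/
theorem laplace_scaled {V : ℝ → ℂ} {L a : ℂ} {m N : ℕ} (hm : 1 ≤ m)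
    (hV : ∀ P : ℝ, 0 < P → IntervalIntegrable V volume 0 P)
    (hL : Tendsto (fun S : ℝ => ∫ s in (0 : ℝ)..S, exp (-(2 * Real.pi * (m * N : ℕ) * s)) * V s)
      atTop (𝓝 L)) :
    LaplaceConverges (fun p => a / (2 * Real.pi * m) * V (p / (2 * Real.pi * m))) N ∧
      laplace (fun p => a / (2 * Real.pi * m) * V (p / (2 * Real.pi * m))) N = a * L := by
  have hm0 : (0 : ℝ) < m := by exact_mod_cast hm
  set q : ℝ := 2 * Real.pi * m with hq
  have hq0 : 0 < q := by positivity
  have hqc : (2 * Real.pi * m : ℂ) = q := by rw [hq]; push_cast; rfl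
  have hqne : (q : ℂ) ≠ 0 := by exact_mod_cast hq0.ne'
  rw [hqc]
  have ht : Tendsto (truncatedLaplace (fun p => a / q * V (p / q)) N) atTop (𝓝 (a * L)) := by
    refine ((hL.comp (tendsto_id.atTop_div_const hq0)).const_mul a).congr fun P => ?_
    have hsub := intervalIntegral.integral_comp_div (a := 0) (b := P) (c := q)
      (fun s : ℝ => exp (-(2 * Real.pi * (m * N : ℕ) * s)) * V s) hq0.ne'
    rw [zero_div, real_smul] at hsub
    simp only [Function.comp_apply, id]
    have e1 : ∫ s in (0 : ℝ)..P / q, exp (-(2 * Real.pi * (m * N : ℕ) * s)) * V s =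
        (q : ℂ)⁻¹ * ∫ p in (0 : ℝ)..P, exp (-(2 * Real.pi * (m * N : ℕ) * (p / q : ℝ))) *
          V (p / q) := by
      rw [hsub, inv_mul_cancel_left₀ hqne]
    rw [e1, truncatedLaplace, ← intervalIntegral.integral_const_mul,
      ← intervalIntegral.integral_const_mul]
    congr 1
    ext p
    have : (2 * Real.pi * (m * N : ℕ) * (p / q : ℝ) : ℂ) = (N : ℝ) * p := by
      have hmc : (m : ℂ) ≠ 0 := by exact_mod_cast hm0.ne'
      have hpi : (Real.pi : ℂ) ≠ 0 := by exact_mod_cast Real.pi_ne_zero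
      rw [hq]
      push_cast
      field_simp
    rw [this]
    ring
  refine ⟨⟨fun P hP => ?_, _, ht⟩, ht.limUnder_eq⟩
  have h1 := (hV (P / q) (by positivity)).comp_mul_left (c := q⁻¹)
  have h2 : IntervalIntegrable (fun p => V (p / q)) volume 0 P := by
    convert! h1 using 2
    · rw [div_eq_inv_mul]
    · simp
    · field_simp
  exact (h2.const_mul (a / q)).continuousOn_mul (Continuous.continuousOn (by fun_prop))

/-- The `m + 1`-st term of the transseries attached to `c`, integrated by parts `M` times. -/
def transTerm (F : ℂ → ℂ) (c : ℂ) (M N m : ℕ) : ℂ :=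
  exp (2 * Real.pi * I * c * (m + 1) * N) *
    ((-(2 * Real.pi * I * (m + 1) * N)) ^ M * laplace (varG F c (m + 1)) N)

namespace UpperStrip

variable {f F : ℂ → ℂ} {Λ : Finset ℂ} {M : ℕ}

section cut

variable (h : UpperStrip f F Λ M) {c : ℂ} (hc : c ∈ Λ)
include h hc

theorem varG_eq (m : ℕ) : varG F c m = fun p : ℝ =>
    I / (2 * Real.pi * m) * variation F c (((p / (2 * Real.pi * m) : ℝ) : ℂ) * I) := by
  ext p
  rw [varG, outDir_of_pos (h.im_pos c hc), mul_comm I]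
  push_cast
  rfl

theorem laplaceConverges_varG {m N : ℕ} (hm : 1 ≤ m) (hN : 1 ≤ N) :
    LaplaceConverges (varG F c m) N := by
  obtain ⟨L, hL, -⟩ := h.exists_tendsto_integral_variation hc (Nat.mul_le_mul hm hN)
  rw [h.varG_eq hc]
  exact (laplace_scaled (a := I) hm (h.intervalIntegrable_variation hc) hL).1

theorem tendsto_jumpInt_transTerm {N : ℕ} (hN : 1 ≤ N) (m : ℕ) :
    Tendsto (jumpInt F c (2 * Real.pi * I * ((m + 1) * N : ℕ)) M) atTop
      (𝓝 (transTerm F c M N m)) := by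
  obtain ⟨L, hL, hJ⟩ := h.exists_tendsto_integral_variation hc
    (Nat.mul_le_mul (Nat.le_add_left 1 m) hN)
  have := (laplace_scaled (a := I) (Nat.le_add_left 1 m) (h.intervalIntegrable_variation hc) hL).2
  rw [← h.varG_eq hc] at this
  convert! hJ using 2
  rw [transTerm, this]
  push_cast
  rw [show (2 * Real.pi * I * c * (m + 1) * N : ℂ) = 2 * Real.pi * I * ((m + 1) * N) * c by ring,
    show (2 * Real.pi * I * (m + 1) * N : ℂ) = 2 * Real.pi * I * ((m + 1) * N) by ring]
  ring

/-- The weight of frequency `2` leaves a margin `e ^ (-2 π s)` over the growth of the variation, so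
one majorant serves all frequencies `≥ 2`. -/
theorem integrableOn_variation_mul_exp : IntegrableOn
    (fun s : ℝ => Real.exp (-(4 * Real.pi * s)) * ‖variation F c (s * I)‖) (Set.Ioi 0) := by
  have hcont : Continuous fun s : ℝ => Real.exp (-(4 * Real.pi * s)) := by fun_prop
  obtain ⟨R, hR⟩ := eventually_atTop.1 ((h.isLittleO_variation hc (Nat.zero_le M)).bound one_pos)
  set R' := max R 1 with hR'
  have hR0 : 0 < R' := zero_lt_one.trans_le (le_max_right _ _)
  rw [← Set.Ioc_union_Ioi_eq_Ioi hR0.le]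
  refine IntegrableOn.union ?_ ?_
  · rw [← intervalIntegrable_iff_integrableOn_Ioc_of_le hR0.le]
    exact (h.intervalIntegrable_variation hc R' hR0).norm.continuousOn_mul hcont.continuousOn
  · have hexp : IntegrableOn (fun s : ℝ => Real.exp (-(2 * Real.pi) * s)) (Set.Ioi R') :=
      integrableOn_exp_mul_Ioi (by linarith [Real.pi_pos]) R'
    refine hexp.mono' ?_ ?_
    · have hv : ContinuousOn (fun s : ℝ => variation F c (s * I)) (Set.Ioi R') := fun s hs => by
        have := h.continuousAt_variation hc (Nat.zero_le M) (hR0.trans hs)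
        simp only [iteratedDeriv_zero] at this
        exact this.continuousWithinAt
      exact (hcont.continuousOn.mul hv.norm).aestronglyMeasurable measurableSet_Ioi
    · refine (ae_restrict_iff' measurableSet_Ioi).2 (Eventually.of_forall fun s hs => ?_)
      have hv := hR s ((le_max_left _ _).trans (le_of_lt hs))
      rw [iteratedDeriv_zero, one_mul, Real.norm_of_nonneg (Real.exp_nonneg _)] at hv
      rw [Real.norm_of_nonneg (by positivity)]
      calc Real.exp (-(4 * Real.pi * s)) * ‖variation F c (s * I)‖
          ≤ Real.exp (-(4 * Real.pi * s)) * Real.exp (2 * Real.pi * s) := by gcongr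
        _ = _ := by
          rw [← Real.exp_add]
          ring_nf

/-- For `m ≥ 2` the frequency `m N` is at least `2` and the integral converges absolutely. The
excluded `m = 1` is a single term, irrelevant for summability. -/
theorem exists_norm_laplace_varG_le :
    ∃ C : ℝ, ∀ m N : ℕ, 2 ≤ m → 1 ≤ N → ‖laplace (varG F c m) N‖ ≤ C := by
  refine ⟨∫ s in Set.Ioi (0 : ℝ), Real.exp (-(4 * Real.pi * s)) * ‖variation F c (s * I)‖,
    fun m N hm hN => ?_⟩
  have hmN : 2 ≤ m * N := Nat.mul_le_mul hm hN
  obtain ⟨L, hL, -⟩ := h.exists_tendsto_integral_variation hc (n := m * N) (by omega)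
  have hlap := (laplace_scaled (a := I) (by omega) (h.intervalIntegrable_variation hc) hL).2
  rw [← h.varG_eq hc] at hlap
  rw [hlap, norm_mul, norm_I, one_mul]
  refine le_of_tendsto hL.norm ?_
  filter_upwards [eventually_gt_atTop 0] with S hS
  have hint := h.integrableOn_variation_mul_exp hc
  calc ‖∫ s in (0 : ℝ)..S, exp (-(2 * Real.pi * (m * N : ℕ) * s)) * variation F c (s * I)‖
      ≤ ∫ s in (0 : ℝ)..S, Real.exp (-(4 * Real.pi * s)) * ‖variation F c (s * I)‖ := by
        refine intervalIntegral.norm_integral_le_of_norm_le hS.le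
          (Eventually.of_forall fun s hs => ?_) ?_
        · rw [norm_mul, norm_exp]
          gcongr
          have hre : (-(2 * Real.pi * (m * N : ℕ) * s) : ℂ).re = -(2 * Real.pi * (m * N : ℕ) * s) := by
            rw [← ofReal_re (-(2 * Real.pi * (m * N : ℕ) * s))]
            push_cast
            rfl
          rw [hre]
          have h2 : (2 : ℝ) ≤ (m * N : ℕ) := by exact_mod_cast hmN
          have := mul_le_mul_of_nonneg_left h2 (mul_nonneg Real.pi_pos.le hs.1.le)
          linarith
        · rw [intervalIntegrable_iff_integrableOn_Ioc_of_le hS.le]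
          exact hint.mono_set Set.Ioc_subset_Ioi_self
    _ ≤ _ := by
        rw [intervalIntegral.integral_of_le hS.le]
        exact setIntegral_mono_set hint (Eventually.of_forall fun s => by positivity)
          Set.Ioc_subset_Ioi_self.eventuallyLE

/-- As `Im c > 0`, the exponential is geometric in `m` with ratio below `1`, which beats the factor
`(m + 1) ^ M` from the integrations by parts. -/
theorem summable_transTerm {N : ℕ} (hN : 1 ≤ N) : Summable (transTerm F c M N) := by
  obtain ⟨C, hC⟩ := h.exists_norm_laplace_varG_le hc
  have hN0 : (0 : ℝ) < N := by exact_mod_cast hN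
  set ρ : ℝ := Real.exp (-(2 * Real.pi * N * c.im)) with hρ
  have hρ1 : ρ < 1 := by
    rw [hρ, Real.exp_lt_one_iff]
    have := mul_pos (mul_pos Real.two_pi_pos hN0) (h.im_pos c hc)
    linarith
  have hsum : Summable fun m : ℕ => (2 * Real.pi * N) ^ M * C * ((m : ℝ) ^ M * ρ ^ m) :=
    (summable_pow_mul_geometric_of_norm_lt_one M (r := ρ)
      (by rwa [Real.norm_of_nonneg (Real.exp_nonneg _)])).mul_left _
  have hsum' := (summable_nat_add_iff 1).2 hsum
  refine Summable.of_norm_bounded_eventually_nat hsum' ?_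
  filter_upwards [eventually_ge_atTop 1] with m hm
  have hlap := hC (m + 1) N (by omega) hN
  have e1 : ‖exp (2 * Real.pi * I * c * (m + 1) * N)‖ = ρ ^ (m + 1) := by
    have := norm_exp_two_pi_mul ((m + 1) * N) c
    rw [hρ, ← Real.exp_nat_mul]
    convert! this using 2
    · push_cast
      ring_nf
    · push_cast
      ring
  have e2 : ‖(-(2 * Real.pi * I * (m + 1) * N) : ℂ)‖ = 2 * Real.pi * N * (m + 1 : ℕ) := by
    have : (-(2 * Real.pi * I * (m + 1) * N) : ℂ) = ((2 * Real.pi * N * (m + 1 : ℕ) : ℝ) : ℂ) * -I := by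
      push_cast
      ring
    rw [this, norm_mul, norm_real, norm_neg, norm_I, mul_one, Real.norm_of_nonneg (by positivity)]
  rw [transTerm, norm_mul, norm_mul, norm_pow, e1, e2, mul_pow]
  calc ρ ^ (m + 1) * ((2 * Real.pi * N) ^ M * ((m + 1 : ℕ) : ℝ) ^ M * ‖laplace (varG F c (m + 1)) N‖)
      ≤ ρ ^ (m + 1) * ((2 * Real.pi * N) ^ M * ((m + 1 : ℕ) : ℝ) ^ M * C) := by gcongr
    _ = _ := by ring

end cut

theorem tendsto_integral_sides_transTerm (h : UpperStrip f F Λ M) {N : ℕ} (hN : 1 ≤ N) (m : ℕ) :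
    Tendsto (fun T : ℝ => ∫ t in (0 : ℝ)..T, exp (-(2 * Real.pi * ((m + 1) * N : ℕ) * t)) *
        (f (1 + t * I) - f (t * I))) atTop
      (𝓝 (I * ((∫ x in (0 : ℝ)..1, f x * exp (2 * Real.pi * I * ((m + 1) * N : ℕ) * x)) -
        ∑ c ∈ Λ, transTerm F c M N m))) :=
  h.tendsto_integral_sides (Nat.mul_le_mul (Nat.le_add_left 1 m) hN)
    fun _ hc => h.tendsto_jumpInt_transTerm hc hN m

end UpperStrip

/-! ### Splitting the cut strip into its two halves -/

theorem IsSideExt.reflect {k gL gR : ℂ → ℂ} {w : ℂ} (h : IsSideExt k gL gR (1 - w)) :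
    IsSideExt (fun z => k (1 - z)) (fun z => gR (1 - z)) (fun z => gL (1 - z)) w := by
  have hsub : AnalyticAt ℂ (fun z : ℂ => 1 - z) w := by fun_prop
  refine ⟨h.2.1.comp_of_eq hsub rfl, h.1.comp_of_eq hsub rfl, ?_⟩
  filter_upwards [hsub.continuousAt.eventually h.2.2] with z hz
  simp only [sub_re, one_re] at hz
  exact ⟨fun hlt => hz.2 (by linarith), fun hlt => hz.1 (by linarith)⟩

theorem IsSideExt.variation_const_mul {k gL gR : ℂ → ℂ} {c : ℂ} {s : ℝ} (hs : 0 < s)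
    (h : IsSideExt k gL gR (c + s * I)) (a : ℂ) :
    variation (fun z => a * k z) c (s * I) = a * variation k c (s * I) := by
  have h' : IsSideExt (fun z => a * k z) (fun z => a * gL z) (fun z => a * gR z) (c + s * I) :=
    ⟨analyticAt_const.mul h.1, analyticAt_const.mul h.2.1, h.2.2.mono fun z hz =>
      ⟨fun hlt => congrArg (a * ·) (hz.1 hlt), fun hlt => congrArg (a * ·) (hz.2 hlt)⟩⟩
  rw [h'.variation_eq hs, h.variation_eq hs]
  ring

/-- The map `z ↦ 1 - z` is a rotation by `π`. It preserves orientation, so the variation acquires no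
sign. -/
theorem variation_reflect (k : ℂ → ℂ) (c u : ℂ) :
    variation (fun z => k (1 - z)) (1 - c) u = variation k c (-u) := by
  unfold variation
  congr 1
  ext δ
  ring_nf

theorem outDir_reflect {c : ℂ} (hc : c.im ≠ 0) : outDir (1 - c) = -outDir c := by
  rcases hc.lt_or_gt with hc | hc
  · rw [outDir_of_neg hc, outDir_of_pos (by simpa using hc), neg_neg]
  · rw [outDir_of_pos hc, outDir_of_neg (by simpa using hc)]

theorem mem_cutRay_reflect {c z : ℂ} (hc : c.im ≠ 0) : 1 - z ∈ cutRay c ↔ z ∈ cutRay (1 - c) := by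
  unfold cutRay
  rw [outDir_reflect hc]
  refine exists_congr fun s => and_congr_right fun _ => ⟨fun h => ?_, fun h => ?_⟩
  · linear_combination -h
  · linear_combination -h

/-- The assumptions on the cut strip that are stable under the reflection `z ↦ 1 - z`. -/
structure CutStripData (f F : ℂ → ℂ) (Λ : Finset ℂ) (M : ℕ) : Prop where
  re_pos : ∀ c ∈ Λ, 0 < c.re
  re_lt : ∀ c ∈ Λ, c.re < 1
  im_ne : ∀ c ∈ Λ, c.im ≠ 0
  re_inj : ∀ c ∈ Λ, ∀ c' ∈ Λ, c.re = c'.re → c = c'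
  analyticOnNhd : AnalyticOnNhd ℂ f (cutStrip Λ)
  primitive : IsIteratedPrimitive F f M Λ
  growth : StripGrowth f Λ
  sideExt : ∀ c ∈ Λ, ∀ w : ℂ, w.re = c.re → w ≠ c → ∃ gL gR, IsSideExt f gL gR w
  powerBound : ∀ c ∈ Λ, ∃ b C r : ℝ, b < M + 1 ∧ 0 < r ∧
    ∀ u : ℂ, ‖u‖ < r → c + u ∉ cutRay c → ‖f (c + u)‖ ≤ C * ‖u‖ ^ (-b)
  integrable : ∀ c ∈ Λ, IntegrableOn
    (fun s : ℝ => variation f c (s * outDir c) * exp (-(2 * Real.pi * s))) (Set.Ioi 1)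

namespace CutStripData

variable {f F : ℂ → ℂ} {Λ : Finset ℂ} {M : ℕ}

theorem notMem_cutRay (h : CutStripData f F Λ M) {z : ℂ} (hz : 0 ≤ z.im)
    (hz' : z ∉ upCuts (Λ.filter fun c => 0 < c.im)) : ∀ c ∈ Λ, z ∉ cutRay c := by
  intro c hc hmem
  rcases (h.im_ne c hc).lt_or_gt with hneg | hpos
  · have := ((mem_cutRay_of_neg hneg).1 hmem).2
    linarith
  · exact hz' ⟨c, Finset.mem_filter.2 ⟨hc, hpos⟩, (mem_cutRay_of_pos hpos).1 hmem⟩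

theorem mem_cutStrip (h : CutStripData f F Λ M) {z : ℂ}
    (hz : z ∈ closedUpper (Λ.filter fun c => 0 < c.im)) : z ∈ cutStrip Λ :=
  ⟨hz.1, hz.2.1, h.notMem_cutRay hz.2.2.1 hz.2.2.2⟩

theorem mem_openCutStrip (h : CutStripData f F Λ M) {z : ℂ}
    (hz : z ∈ openUpper (Λ.filter fun c => 0 < c.im)) : z ∈ openCutStrip Λ :=
  ⟨hz.1, hz.2.1, h.notMem_cutRay hz.2.2.1 hz.2.2.2⟩

theorem upper (h : CutStripData f F Λ M) : UpperStrip f F (Λ.filter fun c => 0 < c.im) M where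
  re_pos c hc := h.re_pos c (Finset.mem_filter.1 hc).1
  re_lt c hc := h.re_lt c (Finset.mem_filter.1 hc).1
  im_pos c hc := (Finset.mem_filter.1 hc).2
  re_inj c hc c' hc' := h.re_inj c (Finset.mem_filter.1 hc).1 c' (Finset.mem_filter.1 hc').1
  analyticAt_f z hz := h.analyticOnNhd z (h.mem_cutStrip hz)
  analyticAt_F z hz := h.primitive.1 z (h.mem_openCutStrip hz)
  iteratedDeriv_eq z hz := h.primitive.2 z (h.mem_openCutStrip hz)
  growth ε hε := by
    obtain ⟨R, hR⟩ := h.growth ε hε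
    refine ⟨R, fun z hz hzR => ?_⟩
    have := hR z (h.mem_cutStrip hz)
    rw [abs_of_nonneg hz.2.2.1] at this
    exact this hzR
  sideExt c hc s hs := h.sideExt c (Finset.mem_filter.1 hc).1 _ (by simp) fun heq => by
    have := congrArg im heq
    simp at this
    exact hs.ne' this
  slitBound c hc := by
    obtain ⟨b, C, r, hb, hr, hbd⟩ := h.powerBound c (Finset.mem_filter.1 hc).1
    refine ⟨b, hb, C, r, hr, fun u hu hu' => hbd u hu fun hmem => hu' ?_⟩
    simpa using (mem_cutRay_of_pos (Finset.mem_filter.1 hc).2).1 hmem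
  integrable c hc := by
    have := h.integrable c (Finset.mem_filter.1 hc).1
    rwa [outDir_of_pos (Finset.mem_filter.1 hc).2] at this

theorem mem_cutStrip_reflect (h : CutStripData f F Λ M) {z : ℂ}
    (hz : z ∈ cutStrip (Λ.image (1 - ·))) : 1 - z ∈ cutStrip Λ := by
  refine ⟨by simpa using hz.2.1, by simpa using hz.1, fun c hc hmem => ?_⟩
  exact hz.2.2 _ (Finset.mem_image_of_mem _ hc) ((mem_cutRay_reflect (h.im_ne c hc)).1 hmem)

theorem mem_openCutStrip_reflect (h : CutStripData f F Λ M) {z : ℂ}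
    (hz : z ∈ openCutStrip (Λ.image (1 - ·))) : 1 - z ∈ openCutStrip Λ := by
  refine ⟨by simpa using hz.2.1, by simpa using hz.1, fun c hc hmem => ?_⟩
  exact hz.2.2 _ (Finset.mem_image_of_mem _ hc) ((mem_cutRay_reflect (h.im_ne c hc)).1 hmem)

/-- The factor `(-1) ^ M` compensates the sign produced by differentiating `F (1 - z)` `M` times. -/
theorem reflect (h : CutStripData f F Λ M) :
    CutStripData (fun z => f (1 - z)) (fun z => (-1) ^ M * F (1 - z)) (Λ.image (1 - ·)) M where
  re_pos c hc := by
    obtain ⟨c, hcΛ, rfl⟩ := Finset.mem_image.1 hc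
    simpa using h.re_lt c hcΛ
  re_lt c hc := by
    obtain ⟨c, hcΛ, rfl⟩ := Finset.mem_image.1 hc
    simpa using h.re_pos c hcΛ
  im_ne c hc := by
    obtain ⟨c, hcΛ, rfl⟩ := Finset.mem_image.1 hc
    simpa using h.im_ne c hcΛ
  re_inj c hc c' hc' heq := by
    obtain ⟨c, hcΛ, rfl⟩ := Finset.mem_image.1 hc
    obtain ⟨c', hcΛ', rfl⟩ := Finset.mem_image.1 hc'
    rw [h.re_inj c hcΛ c' hcΛ' (by simpa using heq)]
  analyticOnNhd z hz := (h.analyticOnNhd _ (h.mem_cutStrip_reflect hz)).comp_of_eq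
    (f := fun z : ℂ => 1 - z) (by fun_prop) rfl
  primitive := by
    have hF : ∀ z ∈ openCutStrip (Λ.image (1 - ·)), AnalyticAt ℂ (fun z => F (1 - z)) z :=
      fun z hz => (h.primitive.1 _ (h.mem_openCutStrip_reflect hz)).comp_of_eq
        (f := fun z : ℂ => 1 - z) (by fun_prop) rfl
    refine ⟨fun z hz => analyticAt_const.mul (hF z hz), fun z hz => ?_⟩
    rw [iteratedDeriv_const_mul_field, iteratedDeriv_comp_const_sub]
    change (-1) ^ M * ((-1) ^ M * iteratedDeriv M F (1 - z)) = f (1 - z)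
    rw [← mul_assoc,
      ← mul_pow, neg_one_mul, neg_neg, one_pow, one_mul,
      h.primitive.2 _ (h.mem_openCutStrip_reflect hz)]
  growth ε hε := by
    obtain ⟨R, hR⟩ := h.growth ε hε
    refine ⟨R, fun z hz hzR => ?_⟩
    simpa using hR (1 - z) (h.mem_cutStrip_reflect hz) (by simpa using hzR)
  sideExt c hc w hw hwc := by
    obtain ⟨c, hcΛ, rfl⟩ := Finset.mem_image.1 hc
    obtain ⟨gL, gR, hg⟩ := h.sideExt c hcΛ (1 - w) (by simp [hw]) fun heq =>
      hwc (by rw [← heq, sub_sub_cancel])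
    exact ⟨_, _, hg.reflect⟩
  powerBound c hc := by
    obtain ⟨c, hcΛ, rfl⟩ := Finset.mem_image.1 hc
    obtain ⟨b, C, r, hb, hr, hbd⟩ := h.powerBound c hcΛ
    refine ⟨b, C, r, hb, hr, fun u hu hu' => ?_⟩
    have e : 1 - (1 - c + u) = c + -u := by ring
    have := hbd (-u) (by rwa [norm_neg]) fun hmem =>
      hu' ((mem_cutRay_reflect (h.im_ne c hcΛ)).1 (by rwa [e]))
    rwa [norm_neg, ← e] at this
  integrable c hc := by
    obtain ⟨c, hcΛ, rfl⟩ := Finset.mem_image.1 hc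
    have := h.integrable c hcΛ
    simpa only [variation_reflect, outDir_reflect (h.im_ne c hcΛ), mul_neg, neg_neg] using this

theorem mem_filter_reflect {c : ℂ} (hc : c ∈ Λ) (hneg : c.im < 0) :
    1 - c ∈ (Λ.image (1 - ·)).filter fun c => 0 < c.im :=
  Finset.mem_filter.2 ⟨Finset.mem_image_of_mem _ hc, by simpa using hneg⟩

theorem varG_reflect (h : CutStripData f F Λ M) {c : ℂ} (hc : c ∈ Λ) (hneg : c.im < 0) {m : ℕ}
    (hm : 1 ≤ m) {p : ℝ} (hp : 0 < p) :
    varG F c m p = (-1) ^ M * varG (fun z => (-1) ^ M * F (1 - z)) (1 - c) m p := by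
  have hmem := mem_filter_reflect hc hneg
  have hm0 : (0 : ℝ) < m := by exact_mod_cast hm
  have hs : 0 < p / (2 * Real.pi * m) := by positivity
  obtain ⟨gL, gR, hg⟩ := h.reflect.upper.exists_isSideExt hmem (Nat.zero_le M) hs
  rw [iteratedDeriv_zero] at hg
  -- The constant can be taken out because the limit defining the variation exists here, which is
  -- why `p > 0` is assumed.
  have h1 := hg.variation_const_mul hs ((-1) ^ M)
  simp only [← mul_assoc, ← mul_pow, neg_one_mul, neg_neg, one_pow, one_mul] at h1
  rw [variation_reflect] at h1
  rw [h.reflect.upper.varG_eq hmem, varG, outDir_of_neg hneg]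
  rw [show -I * (p / (2 * Real.pi * m) : ℂ) = -(((p / (2 * Real.pi * m) : ℝ) : ℂ) * I) by
    push_cast; ring, h1]
  ring

theorem laplace_varG_reflect (h : CutStripData f F Λ M) {c : ℂ} (hc : c ∈ Λ) (hneg : c.im < 0)
    {m N : ℕ} (hm : 1 ≤ m) (hN : 1 ≤ N) : LaplaceConverges (varG F c m) N ∧
      laplace (varG F c m) N =
        (-1) ^ M * laplace (varG (fun z => (-1) ^ M * F (1 - z)) (1 - c) m) N :=
  (h.reflect.upper.laplaceConverges_varG (mem_filter_reflect hc hneg) hm hN).const_mul_congr _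
    fun _ hp => h.varG_reflect hc hneg hm hp

/-- The exponentials agree because `e ^ (2 π i (m + 1) N) = 1`, and `(-1) ^ M` accounts for the
opposite sign under the power `M` in the lower half. -/
theorem transTerm_reflect (h : CutStripData f F Λ M) {c : ℂ} (hc : c ∈ Λ) (hneg : c.im < 0)
    {N : ℕ} (hN : 1 ≤ N) (m : ℕ) :
    exp (-(2 * Real.pi * I * c * (m + 1) * N)) *
        ((2 * Real.pi * I * (m + 1) * N) ^ M * laplace (varG F c (m + 1)) N) =
      transTerm (fun z => (-1) ^ M * F (1 - z)) (1 - c) M N m := by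
  rw [(h.laplace_varG_reflect hc hneg (Nat.le_add_left 1 m) hN).2, transTerm]
  have e1 : exp (2 * Real.pi * I * (1 - c) * (m + 1) * N) =
      exp (-(2 * Real.pi * I * c * (m + 1) * N)) := by
    rw [show (2 * Real.pi * I * (1 - c) * (m + 1) * N : ℂ) =
      -(2 * Real.pi * I * c * (m + 1) * N) + ((m + 1) * N : ℕ) * (2 * Real.pi * I) by
        push_cast; ring, exp_add, exp_nat_mul_two_pi_mul_I, mul_one]
  rw [e1, neg_pow (2 * Real.pi * I * (m + 1) * N : ℂ)]
  ring

theorem laplaceConverges_varG (h : CutStripData f F Λ M) {c : ℂ} (hc : c ∈ Λ) {m N : ℕ}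
    (hm : 1 ≤ m) (hN : 1 ≤ N) : LaplaceConverges (varG F c m) N := by
  rcases (h.im_ne c hc).lt_or_gt with hneg | hpos
  · exact (h.laplace_varG_reflect hc hneg hm hN).1
  · exact h.upper.laplaceConverges_varG (Finset.mem_filter.2 ⟨hc, hpos⟩) hm hN

theorem sum_reflect {Λ : Finset ℂ} {E : Type*} [AddCommMonoid E] (T : ℂ → E) :
    ∑ c ∈ (Λ.image (1 - ·)).filter (fun c => 0 < c.im), T c =
      ∑ c ∈ Λ.filter (fun c => c.im < 0), T (1 - c) := by
  rw [Finset.filter_image, Finset.sum_image fun x _ y _ hxy => sub_right_injective hxy]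
  simp

theorem vertical_mem_cutStrip (h : CutStripData f F Λ M) (t : ℝ) :
    (t * I : ℂ) ∈ cutStrip Λ ∧ (1 + t * I : ℂ) ∈ cutStrip Λ := by
  refine ⟨⟨by simp, by simp, fun c hc hmem => ?_⟩, ⟨by simp, by simp, fun c hc hmem => ?_⟩⟩
  · have := re_eq_of_mem_cutRay (h.im_ne c hc) hmem
    have := h.re_pos c hc
    simp_all
  · have := re_eq_of_mem_cutRay (h.im_ne c hc) hmem
    have := h.re_lt c hc
    simp_all

end CutStripData

/-! ### The Euler-MacLaurin formula -/

namespace CutStripData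

variable {f F : ℂ → ℂ} {Λ : Finset ℂ} {M : ℕ}

theorem analyticAt_vertical_zero (h : CutStripData f F Λ M) (t : ℝ) : AnalyticAt ℂ f (t * I) :=
  h.analyticOnNhd _ (h.vertical_mem_cutStrip t).1

theorem analyticAt_vertical_one (h : CutStripData f F Λ M) (t : ℝ) :
    AnalyticAt ℂ f (1 + t * I) :=
  h.analyticOnNhd _ (h.vertical_mem_cutStrip t).2

theorem norm_edgeDiff_le (h : CutStripData f F Λ M) (ε : ℝ) (hε : 0 < ε) :
    ∃ R, ∀ t : ℝ, R ≤ t → ‖edgeDiff f t‖ ≤ ε * Real.exp (2 * Real.pi * t) := by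
  obtain ⟨R, hR⟩ := h.growth (ε / 4) (by positivity)
  refine ⟨max R 0, fun t ht => ?_⟩
  have ht0 : 0 ≤ t := (le_max_right _ _).trans ht
  have htR : R ≤ t := (le_max_left _ _).trans ht
  have h1 := hR _ (h.vertical_mem_cutStrip t).1
  have h2 := hR _ (h.vertical_mem_cutStrip t).2
  have h3 := hR _ (h.vertical_mem_cutStrip (-t)).1
  have h4 := hR _ (h.vertical_mem_cutStrip (-t)).2
  simp only [ofReal_neg, neg_mul, ← sub_eq_add_neg] at h3 h4
  simp [abs_of_nonneg ht0, htR] at h1 h2 h3 h4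
  rw [edgeDiff]
  have h5 := norm_add_le (f (1 + t * I) - f (1 - t * I) - f (t * I)) (f (-(t * I)))
  have h6 := norm_sub_le (f (1 + t * I) - f (1 - t * I)) (f (t * I))
  have h7 := norm_sub_le (f (1 + t * I)) (f (1 - t * I))
  linarith

theorem continuous_sides (h : CutStripData f F Λ M) :
    Continuous fun t : ℝ => f (1 + t * I) - f (t * I) := by
  refine continuous_iff_continuousAt.2 fun t => ContinuousAt.sub ?_ ?_
  · exact ContinuousAt.comp (g := f) (f := fun t : ℝ => 1 + (t : ℂ) * I)
      (h.analyticAt_vertical_one t).continuousAt (by fun_prop)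
  · exact ContinuousAt.comp (g := f) (f := fun t : ℝ => (t : ℂ) * I)
      (h.analyticAt_vertical_zero t).continuousAt (by fun_prop)

/-- The edge difference is `f (1 + i t) - f (i t)` plus the same expression for `z ↦ f (1 - z)`, so
the upper half result is applied to both functions and added. -/
theorem tendsto_integral_edgeDiff (h : CutStripData f F Λ M) {N : ℕ} (hN : 1 ≤ N) (m : ℕ) :
    Tendsto (fun T : ℝ => ∫ t in (0 : ℝ)..T, exp (-(2 * Real.pi * ((m + 1) * N : ℕ) * t)) *
        edgeDiff f t) atTop
      (𝓝 (I * ((∫ x in (0 : ℝ)..1, f x * exp (2 * Real.pi * I * ((m + 1) * N : ℕ) * x)) +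
        (∫ x in (0 : ℝ)..1, f x * exp (-(2 * Real.pi * I * ((m + 1) * N : ℕ) * x))) -
        (∑ c ∈ Λ.filter (fun c => 0 < c.im), transTerm F c M N m +
          ∑ c ∈ Λ.filter (fun c => c.im < 0), exp (-(2 * Real.pi * I * c * (m + 1) * N)) *
            ((2 * Real.pi * I * (m + 1) * N) ^ M * laplace (varG F c (m + 1)) N))))) := by
  have hup := h.upper.tendsto_integral_sides_transTerm hN m
  have hlo := h.reflect.upper.tendsto_integral_sides_transTerm hN m
  rw [sum_reflect] at hlo
  have hrefl : ∫ x in (0 : ℝ)..1, f (1 - x) * exp (2 * Real.pi * I * ((m + 1) * N : ℕ) * x) =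
      ∫ x in (0 : ℝ)..1, f x * exp (-(2 * Real.pi * I * ((m + 1) * N : ℕ) * x)) := by
    have := intervalIntegral.integral_comp_sub_left (a := 0) (b := 1)
      (fun x : ℝ => f x * exp (-(2 * Real.pi * I * ((m + 1) * N : ℕ) * x))) 1
    rw [sub_self, sub_zero] at this
    rw [← this]
    congr 1
    ext x
    push_cast
    rw [show -(2 * Real.pi * I * (((m : ℂ) + 1) * N) * (1 - x)) =
      2 * Real.pi * I * ((m + 1) * N) * x - ((m + 1) * N : ℕ) * (2 * Real.pi * I) by
        push_cast; ring, exp_sub, exp_nat_mul_two_pi_mul_I, div_one]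
  rw [hrefl] at hlo
  have hsum : ∑ c ∈ Λ.filter (fun c => c.im < 0), exp (-(2 * Real.pi * I * c * (m + 1) * N)) *
        ((2 * Real.pi * I * (m + 1) * N) ^ M * laplace (varG F c (m + 1)) N) =
      ∑ c ∈ Λ.filter (fun c => c.im < 0), transTerm (fun z => (-1) ^ M * F (1 - z)) (1 - c) M N m :=
    Finset.sum_congr rfl fun c hc =>
      h.transTerm_reflect (Finset.mem_filter.1 hc).1 (Finset.mem_filter.1 hc).2 hN m
  rw [hsum]
  convert! hup.add hlo using 2
  · have hexp : Continuous fun t : ℝ => exp (-(2 * Real.pi * ((m + 1) * N : ℕ) * t)) := by fun_prop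
    refine Eq.trans ?_ (intervalIntegral.integral_add
      ((hexp.mul h.continuous_sides).intervalIntegrable _ _)
      ((hexp.mul h.reflect.continuous_sides).intervalIntegrable _ _))
    congr 1
    ext t
    rw [edgeDiff, show (1 - (1 + t * I) : ℂ) = -(t * I) by ring]
    ring
  · ring

theorem laplaceConverges_borelSum_and_hasSum (h : CutStripData f F Λ M) {N : ℕ} (hN : 1 ≤ N) :
    LaplaceConverges (fun p : ℝ => borelSum f p) N ∧
      HasSum (fun m : ℕ => (N : ℂ) *
        ((∫ x in (0 : ℝ)..1, f x * exp (2 * Real.pi * I * ((m + 1) * N : ℕ) * x)) +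
        (∫ x in (0 : ℝ)..1, f x * exp (-(2 * Real.pi * I * ((m + 1) * N : ℕ) * x))) -
        (∑ c ∈ Λ.filter (fun c => 0 < c.im), transTerm F c M N m +
          ∑ c ∈ Λ.filter (fun c => c.im < 0), exp (-(2 * Real.pi * I * c * (m + 1) * N)) *
            ((2 * Real.pi * I * (m + 1) * N) ^ M * laplace (varG F c (m + 1)) N))))
        (laplace (fun p : ℝ => borelSum f p) N) := by
  -- Every `n ≥ 1` is of the form `(m + 1) * N` with `m = 0` and `N = n`.
  have hex : ∀ n : ℕ, 1 ≤ n → ∃ L, Tendsto (fun T : ℝ => ∫ t in (0 : ℝ)..T,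
      exp (-(2 * Real.pi * n * t)) * edgeDiff f t) atTop (𝓝 L) := fun n hn =>
    ⟨_, by simpa only [zero_add, one_mul] using h.tendsto_integral_edgeDiff hn 0⟩
  obtain ⟨h1, h2⟩ := laplace_borelSum h.analyticAt_vertical_zero h.analyticAt_vertical_one
    h.norm_edgeDiff_le hN (Φ := fun n => limUnder atTop fun T : ℝ => ∫ t in (0 : ℝ)..T,
      exp (-(2 * Real.pi * n * t)) * edgeDiff f t) fun n hn => tendsto_nhds_limUnder (hex n hn)
  refine ⟨h1, ?_⟩
  convert! h2 using 2 with m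
  rw [(h.tendsto_integral_edgeDiff hN m).limUnder_eq]
  linear_combination ((N : ℂ) * ((∫ x in (0 : ℝ)..1, f x * exp (2 * Real.pi * I * ((m + 1) * N : ℕ) * x)) +
        (∫ x in (0 : ℝ)..1, f x * exp (-(2 * Real.pi * I * ((m + 1) * N : ℕ) * x))) -
        (∑ c ∈ Λ.filter (fun c => 0 < c.im), transTerm F c M N m +
          ∑ c ∈ Λ.filter (fun c => c.im < 0), exp (-(2 * Real.pi * I * c * (m + 1) * N)) *
            ((2 * Real.pi * I * (m + 1) * N) ^ M * laplace (varG F c (m + 1)) N)))) * I_sq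

theorem summable_lower (h : CutStripData f F Λ M) {c : ℂ} (hc : c ∈ Λ) (hneg : c.im < 0) {N : ℕ}
    (hN : 1 ≤ N) : Summable fun m : ℕ => exp (-(2 * Real.pi * I * c * (m + 1) * N)) *
      ((2 * Real.pi * I * (m + 1) * N) ^ M * laplace (varG F c (m + 1)) N) := by
  simp only [h.transTerm_reflect hc hneg hN]
  exact h.reflect.upper.summable_transTerm (mem_filter_reflect hc hneg) hN

theorem summable_upper (h : CutStripData f F Λ M) {c : ℂ} (hc : c ∈ Λ) (hpos : 0 < c.im) {N : ℕ}
    (hN : 1 ≤ N) : Summable (transTerm F c M N) :=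
  h.upper.summable_transTerm (Finset.mem_filter.2 ⟨hc, hpos⟩) hN

/-- The terms of the Borel part are the Fourier terms minus the transseries terms. Adding the
summable transseries back gives the Fourier series of the trapezoidal rule, and a series has only
one sum. -/
theorem sum_eq (h : CutStripData f F Λ M) {N : ℕ} (hN : 1 ≤ N) :
    ∑ k ∈ Finset.Icc 1 N, f (k / N) =
      N * (∫ s in (0 : ℝ)..1, f s) + (f 1 - f 0) / 2 + laplace (fun p : ℝ => borelSum f p) N
      + N * ∑ c ∈ Λ with 0 < c.im, ∑' m : ℕ, transTerm F c M N m
      + N * ∑ c ∈ Λ with c.im < 0, ∑' m : ℕ,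
          exp (-(2 * Real.pi * I * c * (m + 1) * N)) *
            ((2 * Real.pi * I * (m + 1) * N) ^ M * laplace (varG F c (m + 1)) N) := by
  have hreal : ∀ x ∈ Set.Icc (0 : ℝ) 1, AnalyticAt ℂ f x := fun x hx =>
    h.analyticOnNhd _ ⟨by simpa using hx.1, by simpa using hx.2,
      fun c hc => ofReal_notMem_cutRay (h.im_ne c hc) x⟩
  have hup := hasSum_sum (s := Λ.filter fun c => 0 < c.im) fun c hc =>
    (h.summable_upper (Finset.mem_filter.1 hc).1 (Finset.mem_filter.1 hc).2 hN).hasSum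
  have hlo := hasSum_sum (s := Λ.filter fun c => c.im < 0) fun c hc =>
    (h.summable_lower (Finset.mem_filter.1 hc).1 (Finset.mem_filter.1 hc).2 hN).hasSum
  have hall := (h.laplaceConverges_borelSum_and_hasSum hN).2.add ((hup.add hlo).mul_left (N : ℂ))
  have huniq := (hasSum_fourier_eq_trapezoid hreal hN).unique (by convert! hall using 2 with m; ring)
  linear_combination huniq

end CutStripData

/-! ### The main theorem -/

theorem mainTheorem3 (f : ℂ → ℂ) (S : Set ℂ) (Λ : Finset ℂ) (α β : ℂ → ℝ)
    (hres : EndlesslyContinuable f S)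
    (hΛ : ∀ c : ℂ, c ∈ Λ ↔ c ∈ S ∧ 0 ≤ c.re ∧ c.re ≤ 1)
    (hre : ∀ c ∈ Λ, 0 < c.re ∧ c.re < 1)
    (him : ∀ c ∈ Λ, c.im ≠ 0)
    (hdist : ∀ c ∈ Λ, ∀ c' ∈ Λ, c ≠ c' → c.re ≠ c'.re)
    (hf : AnalyticOnNhd ℂ f (cutStrip Λ))
    (hgrowth : StripGrowth f Λ)
    (hint : ∀ c ∈ Λ, IntegrableOn
      (fun s : ℝ => variation f c (s * outDir c) * exp (-(2 * Real.pi * s))) (Set.Ioi 1))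
    (hloc : ∀ c ∈ Λ, HasLocalForm f c (α c) (β c)) :
    ∃ G : ℂ → ℂ, IsContinuationToHalfLine G (formalBorel (emSeries f)) ∧
      (∀ N : ℕ, 1 ≤ N → LaplaceConverges (fun p : ℝ => G p) N) ∧
      ((∀ c ∈ Λ, -1 < α c) →
        ∀ N : ℕ, 1 ≤ N →
          (∀ c ∈ Λ, ∀ m : ℕ, 1 ≤ m → LaplaceConverges (varG f c m) N) ∧
          (∀ c ∈ Λ, 0 < c.im → Summable fun m : ℕ =>
            exp (2 * Real.pi * I * c * (m + 1) * N) * laplace (varG f c (m + 1)) N) ∧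
          (∀ c ∈ Λ, c.im < 0 → Summable fun m : ℕ =>
            exp (-(2 * Real.pi * I * c * (m + 1) * N)) * laplace (varG f c (m + 1)) N) ∧
          ∑ k ∈ Finset.Icc 1 N, f (k / N) =
            N * (∫ s in (0 : ℝ)..1, f s) + (f 1 - f 0) / 2 + laplace (fun p : ℝ => G p) N
            + N * ∑ c ∈ Λ with 0 < c.im, ∑' m : ℕ,
                exp (2 * Real.pi * I * c * (m + 1) * N) * laplace (varG f c (m + 1)) N
            + N * ∑ c ∈ Λ with c.im < 0, ∑' m : ℕ,
                exp (-(2 * Real.pi * I * c * (m + 1) * N)) * laplace (varG f c (m + 1)) N) ∧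
      ((∃ c ∈ Λ, α c ≤ -1) →
        ∀ M : ℕ, (∀ c ∈ Λ, α c ≤ -1 → ⌊-α c⌋ ≤ (M : ℤ)) →
          (∃ F : ℂ → ℂ, IsIteratedPrimitive F f M Λ) ∧
          ∀ F : ℂ → ℂ, IsIteratedPrimitive F f M Λ →
            ∀ N : ℕ, 1 ≤ N →
              (∀ c ∈ Λ, ∀ m : ℕ, 1 ≤ m → LaplaceConverges (varG F c m) N) ∧
              (∀ c ∈ Λ, 0 < c.im → Summable fun m : ℕ =>
                exp (2 * Real.pi * I * c * (m + 1) * N) *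
                  ((-(2 * Real.pi * I * (m + 1) * N)) ^ M * laplace (varG F c (m + 1)) N)) ∧
              (∀ c ∈ Λ, c.im < 0 → Summable fun m : ℕ =>
                exp (-(2 * Real.pi * I * c * (m + 1) * N)) *
                  ((2 * Real.pi * I * (m + 1) * N) ^ M * laplace (varG F c (m + 1)) N)) ∧
              ∑ k ∈ Finset.Icc 1 N, f (k / N) =
                N * (∫ s in (0 : ℝ)..1, f s) + (f 1 - f 0) / 2 + laplace (fun p : ℝ => G p) N
                + N * ∑ c ∈ Λ with 0 < c.im, ∑' m : ℕ,
                    exp (2 * Real.pi * I * c * (m + 1) * N) *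
                      ((-(2 * Real.pi * I * (m + 1) * N)) ^ M * laplace (varG F c (m + 1)) N)
                + N * ∑ c ∈ Λ with c.im < 0, ∑' m : ℕ,
                    exp (-(2 * Real.pi * I * c * (m + 1) * N)) *
                      ((2 * Real.pi * I * (m + 1) * N) ^ M * laplace (varG F c (m + 1)) N)) := by
  have hdata : ∀ (M : ℕ) (F : ℂ → ℂ), (∀ c ∈ Λ, -α c < M + 1) → IsIteratedPrimitive F f M Λ →
      CutStripData f F Λ M := fun M F hM hF =>
    { re_pos := fun c hc => (hre c hc).1
      re_lt := fun c hc => (hre c hc).2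
      im_ne := him
      re_inj := fun c hc c' hc' heq => by_contra fun hne => hdist c hc c' hc' hne heq
      analyticOnNhd := hf
      primitive := hF
      growth := hgrowth
      sideExt := fun c hc w hw hwc =>
        exists_isSideExt_of_endlesslyContinuable hres hΛ hre him hdist hf hc hw hwc
      powerBound := fun c hc => by
        obtain ⟨b, hb, hbM⟩ := exists_between (hM c hc)
        obtain ⟨C, r, hr, hbd⟩ := norm_le_of_hasLocalForm (hloc c hc) hb
        exact ⟨b, C, r, hbM, hr, hbd⟩
      integrable := hint }
  have hex : ∀ M : ℕ, ∃ F : ℂ → ℂ, IsIteratedPrimitive F f M Λ := fun M =>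
    exists_isIteratedPrimitive him M (hf.mono (openCutStrip_subset Λ))
  -- The Borel sum depends only on `f`, so any sufficiently large number of integrations establishes
  -- its properties, whatever the exponents are.
  obtain ⟨M₀, hM₀⟩ : ∃ M : ℕ, ∀ c ∈ Λ, -α c < M + 1 := by
    have : ∀ᶠ M : ℕ in atTop, ∀ c ∈ Λ, -α c < M + 1 := by
      refine (Finset.eventually_all Λ).2 fun c _ => ?_
      filter_upwards [tendsto_natCast_atTop_atTop.eventually_gt_atTop (-α c)] with M hM
      linarith
    exact this.exists
  obtain ⟨F₀, hF₀⟩ := hex M₀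
  have h₀ := hdata M₀ F₀ hM₀ hF₀
  refine ⟨borelSum f, isContinuationToHalfLine_borelSum h₀.analyticAt_vertical_zero
    h₀.analyticAt_vertical_one, fun N hN => (h₀.laplaceConverges_borelSum_and_hasSum hN).1,
    fun hα N hN => ?_, fun _ M hM => ⟨hex M, fun F hF N hN => ?_⟩⟩
  · have h := hdata 0 f (fun c hc => by
      rw [Nat.cast_zero]
      linarith [hα c hc]) ⟨hf.mono (openCutStrip_subset Λ), fun z _ => by rw [iteratedDeriv_zero]⟩
    refine ⟨fun c hc m hm => h.laplaceConverges_varG hc hm hN,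
      fun c hc hpos => ?_, fun c hc hneg => ?_, ?_⟩
    · refine (h.summable_upper hc hpos hN).congr fun m => ?_
      rw [transTerm, pow_zero, one_mul]
    · simpa only [pow_zero, one_mul] using h.summable_lower hc hneg hN
    · simpa only [transTerm, pow_zero, one_mul] using h.sum_eq hN
  · have h := hdata M F (fun c hc => by
      rcases le_or_gt (α c) (-1) with hle | hgt
      · have h1 := Int.lt_floor_add_one (-α c)
        have h2 : ((⌊-α c⌋ : ℤ) : ℝ) ≤ M := by exact_mod_cast hM c hc hle
        linarith
      · have : (0 : ℝ) ≤ M := M.cast_nonneg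
        linarith) hF
    exact ⟨fun c hc m hm => h.laplaceConverges_varG hc hm hN,
      fun c hc hpos => h.summable_upper hc hpos hN,
      fun c hc hneg => h.summable_lower hc hneg hN, h.sum_eq hN⟩

end
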